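/- **Setting.** Let $n\ge 1$ be odd. Let $R=\{\sum_i a_iT^{\beta_i} : a_i\in\mathbb R,\ \beta_i\in\frac1{n+1}\mathbb Z,\ \beta_i\to\infty\}$ be the Novikov field with valuation $\nu_R(\sum a_iT^{\beta_i})=\inf_{a_i\ne0}\beta_i$ and grading $|T^\beta|=2(n+1)\beta$, and let $R_0=\{\nu_R\ge0\}/\{\nu_R>0\}$. Let $$S=R\langle z_0,\dots,z_n\rangle/\langle(-1)^{n(n+1)/2}z_0\cdots z_n-T\rangle,$$ where $R\langle z_0,\dots,z_n\rangle$ is the Tate algebra, with $|z_i|=2$ and $W=z_0+\dots+z_n$. For $\zeta$ in the open simplex $\{\zeta_i>0,\ \sum_i\zeta_i=1\}$ let $\nu^S_\zeta$ be the valuation on $S$ induced from the valuation $\sum_k r_kz^k\mapsto\inf_k(\nu_R(r_k)+\sum_ik_i\zeta_i)$ on the Tate algebra (the supremum over all preimages). This is the valued Landau–Ginzburg model of $\mathbb CP^n$. Let $\mathrm{Cl}$ be the Clifford algebra over $S$ with generators $e_0,\dots,e_n$ of degree $1$ and relations $e_ie_j+e_je_i=2\delta_{ij}z_i$. Let $\varepsilon\in\{1,-1\}$,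 let $M=\mathrm{Cl}/\mathrm{Cl}\cdot(\varepsilon\,e_0\cdots e_n-T^{1/2})$ as a left $\mathrm{Cl}$-module, and let $D:M\to M$ be left multiplication by $e_0+\dots+e_n$. Let $\nu^M_\zeta$ be induced on $M$ from the tensor algebra on $e_0,\dots,e_n$ over $S$, on which the words in the $e_i$ are orthogonal and $\nu_\zeta(e_i)=\zeta_i/2$. Then $D$ has degree $1$, $D^2=W$, and $\nu^M_\zeta(Dm)\ge\nu^M_\zeta(m)$; $M=M_{\triangle^n}$ is the Dirac factorization. On $\mathrm{End}(M)=\mathrm{End}_S(M)$ put $$\nu(\Phi)=\inf_\zeta\ \inf_{m\ne0}\bigl(\nu^M_\zeta(\Phi m)-\nu^M_\zeta(m)\bigr),\qquad \delta(\Phi)=D\Phi-(-1)^{|\Phi|}\Phi D,$$ and let $\mathrm{End}(M)_0=\{\nu\ge0\}/\{\nu>0\}$ with the induced differential. **Theorem.** For every odd $n\ge1$ and every $\varepsilon\in\{1,-1\}$: 1. $R_0=\mathbb R$, that is, the structure map $\mathbb R\to R_0$ is bijective. 2. $H^*(\mathrm{End}(M)_0)\cong H^*(\mathbb RP^n;R_0)$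 as graded real vector spaces, where the right side is singular cohomology. 3. $H^*(\mathrm{End}(M)_0)\cong\mathbb R\oplus\mathbb R[-n]$: it is $\mathbb R$ in degrees $0$ and $n$ and vanishes in all other degrees. 4. $M$ is a spherical object of the category of normed matrix factorizations of $W$ (with $w=0$). That is: - (object) $M$ is a free graded $S$-module with a finite homogeneous basis $(m_i)$ that is $\nu^M_\zeta$-orthogonal for all $\zeta$, such that each $\zeta\mapsto\nu^M_\zeta(m_i)$ is affine with limits at the vertices of the simplex in the image of $\nu_R$; each $\nu^M_\zeta$ takes values in $\mathbb R\cup\{\infty\}$, satisfies $\nu^M_\zeta(m)=\infty$ only for $m=0$, and $\nu^M_\zeta(sm)=\nu^S_\zeta(s)+\nu^M_\zeta(m)$ for $s\in S$, $m\in M$; - (sphere) $H^*(\mathrm{End}(M)_0)\cong H^*(S^n;R_0)$ as graded real vector spaces, where $S^n$ is the $n$-sphere. -/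

import Mathlib

namespace DiracMF

noncomputable section

open Filter Topology

/-! ### Graded modules with valuations, and their endomorphism complexes -/

/-- A module `M` over `S` with a grading by subspaces of homogeneous elements, an endomorphism `D`
of degree one with `D² = W - w`, and a family of valuation functions such that `D` does not
decrease valuations. -/
structure FilteredFactorization (S M Λ : Type) [CommRing S] [Algebra ℝ S] [AddCommGroup M]
    [Module S M] [Module ℝ M] (W w : S) where
  /-- The homogeneous elements of each degree. -/
  gr : ℤ → Submodule ℝ M
  /-- The endomorphism `D`. -/
  D : M →ₗ[S] M
  /-- The family of valuations. -/
  val : Λ → M → EReal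
  D_mem_gr : ∀ p m, m ∈ gr p → D m ∈ gr (p + 1)
  D_D : ∀ m, D (D m) = (W - w) • m
  le_val_D : ∀ l m, val l m ≤ val l (D m)
  val_zero : ∀ l, val l 0 = ⊤
  le_val_add : ∀ l m m', min (val l m) (val l m') ≤ val l (m + m')
  le_val_smul : ∀ l (c : ℝ) m, val l m ≤ val l (c • m)

namespace FilteredFactorization

variable {S M Λ : Type} [CommRing S] [Algebra ℝ S] [AddCommGroup M] [Module S M] [Module ℝ M]
  {W w : S} (F : FilteredFactorization S M Λ W w)

/-- The norm `ν(Φ) = inf_λ inf_{m ≠ 0} (ν_λ(Φ m) - ν_λ(m))` on endomorphisms. The difference is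
written as `-(ν_λ(m) - ν_λ(Φ m))`, for which `∞ - ∞` would count as `∞`. -/
def endVal (Φ : M →ₗ[S] M) : EReal :=
  ⨅ (l : Λ) (m : M) (_ : m ≠ 0), -(F.val l m - F.val l (Φ m))

theorem endVal_le (Φ : M →ₗ[S] M) (l : Λ) (m : M) :
    F.endVal Φ ≤ -(F.val l m - F.val l (Φ m)) := by
  by_cases hm : m = 0
  · rw [hm, map_zero, F.val_zero, EReal.sub_top, EReal.neg_bot]
    exact le_top
  · exact iInf_le_of_le l (iInf₂_le m hm)

theorem endVal_zero : F.endVal 0 = ⊤ := by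
  refine top_unique (le_iInf fun l => le_iInf₂ fun m _ => ?_)
  rw [LinearMap.zero_apply, F.val_zero, EReal.sub_top, EReal.neg_bot]

theorem neg_sub_mono {a b c : EReal} (h : b ≤ c) : -(a - b) ≤ -(a - c) :=
  EReal.neg_le_neg_iff.2 (EReal.sub_le_sub le_rfl h)

theorem le_endVal_add (Φ Ψ : M →ₗ[S] M) :
    min (F.endVal Φ) (F.endVal Ψ) ≤ F.endVal (Φ + Ψ) := by
  refine le_iInf fun l => le_iInf₂ fun m _ => ?_
  refine le_trans ?_ (neg_sub_mono (F.le_val_add l (Φ m) (Ψ m)))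
  rcases min_choice (F.val l (Φ m)) (F.val l (Ψ m)) with h | h <;> rw [h]
  · exact (min_le_left _ _).trans (F.endVal_le Φ l m)
  · exact (min_le_right _ _).trans (F.endVal_le Ψ l m)

theorem le_endVal_comp_left (Φ : M →ₗ[S] M) : F.endVal Φ ≤ F.endVal (F.D ∘ₗ Φ) := by
  refine le_iInf fun l => le_iInf₂ fun m _ => ?_
  exact (F.endVal_le Φ l m).trans (neg_sub_mono (F.le_val_D l (Φ m)))

theorem le_endVal_comp_right (Φ : M →ₗ[S] M) : F.endVal Φ ≤ F.endVal (Φ ∘ₗ F.D) := by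
  refine le_iInf fun l => le_iInf₂ fun m _ => ?_
  exact (F.endVal_le Φ l (F.D m)).trans
    (EReal.neg_le_neg_iff.2 (EReal.sub_le_sub (F.le_val_D l m) le_rfl))

variable [IsScalarTower ℝ S M]

theorem le_endVal_smul (c : ℝ) (Φ : M →ₗ[S] M) : F.endVal Φ ≤ F.endVal (c • Φ) := by
  refine le_iInf fun l => le_iInf₂ fun m _ => ?_
  exact (F.endVal_le Φ l m).trans (neg_sub_mono (F.le_val_smul l c (Φ m)))

/-- The endomorphisms of degree `p`. -/
def endGr (p : ℤ) : Submodule ℝ (M →ₗ[S] M) where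
  carrier := {Φ | ∀ q, ∀ m ∈ F.gr q, Φ m ∈ F.gr (q + p)}
  zero_mem' := fun q _ _ => (F.gr (q + p)).zero_mem
  add_mem' := fun h h' q m hm => (F.gr (q + p)).add_mem (h q m hm) (h' q m hm)
  smul_mem' := fun c _ h q m hm => (F.gr (q + p)).smul_mem c (h q m hm)

/-- The endomorphisms of degree `p` with `ν ≥ 0`. -/
def endNonneg (p : ℤ) : Submodule ℝ (M →ₗ[S] M) where
  carrier := {Φ | Φ ∈ F.endGr p ∧ 0 ≤ F.endVal Φ}
  zero_mem' := ⟨(F.endGr p).zero_mem, by rw [F.endVal_zero]; exact le_top⟩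
  add_mem' := fun h h' => ⟨(F.endGr p).add_mem h.1 h'.1,
    (le_min h.2 h'.2).trans (F.le_endVal_add _ _)⟩
  smul_mem' := fun c _ h => ⟨(F.endGr p).smul_mem c h.1, h.2.trans (F.le_endVal_smul c _)⟩

/-- The endomorphisms of degree `p` with `ν > 0`. -/
def endPos (p : ℤ) : Submodule ℝ (M →ₗ[S] M) where
  carrier := {Φ | Φ ∈ F.endGr p ∧ 0 < F.endVal Φ}
  zero_mem' := ⟨(F.endGr p).zero_mem, by rw [F.endVal_zero]; exact EReal.zero_lt_top⟩
  add_mem' := fun h h' => ⟨(F.endGr p).add_mem h.1 h'.1,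
    (lt_min h.2 h'.2).trans_le (F.le_endVal_add _ _)⟩
  smul_mem' := fun c _ h => ⟨(F.endGr p).smul_mem c h.1, h.2.trans_le (F.le_endVal_smul c _)⟩

/-- The component of degree `p` of `End(M)₀ = {ν ≥ 0} / {ν > 0}`. -/
abbrev EndZero (p : ℤ) : Type := F.endNonneg p ⧸ (F.endPos p).submoduleOf (F.endNonneg p)

/-- The differential `δ(Φ) = D ∘ Φ - (-1) ^ p Φ ∘ D` on endomorphisms of degree `p`. -/
def delta (p : ℤ) : (M →ₗ[S] M) →ₗ[ℝ] (M →ₗ[S] M) where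
  toFun Φ := F.D ∘ₗ Φ - ((p.negOnePow : ℤ) : ℝ) • Φ ∘ₗ F.D
  map_add' Φ Ψ := by
    rw [LinearMap.comp_add, LinearMap.add_comp, smul_add]
    abel
  map_smul' c Φ := by
    have h : F.D ∘ₗ (c • Φ) = c • F.D ∘ₗ Φ := by
      ext m
      change F.D (c • Φ m) = c • F.D (Φ m)
      rw [← algebraMap_smul S c (Φ m), map_smul, algebraMap_smul]
    rw [RingHom.id_apply, h, LinearMap.smul_comp, smul_sub, smul_comm c]

theorem delta_mem_endGr (p q : ℤ) (h : p + 1 = q) {Φ : M →ₗ[S] M} (hΦ : Φ ∈ F.endGr p) :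
    F.delta p Φ ∈ F.endGr q := by
  subst h
  intro r m hm
  have h1 : F.D (Φ m) ∈ F.gr (r + (p + 1)) := by
    rw [← add_assoc]
    exact F.D_mem_gr _ _ (hΦ r m hm)
  have h2 : Φ (F.D m) ∈ F.gr (r + (p + 1)) := by
    rw [add_comm p 1, ← add_assoc]
    exact hΦ _ _ (F.D_mem_gr _ _ hm)
  exact (F.gr _).sub_mem h1 ((F.gr _).smul_mem _ h2)

theorem le_endVal_delta (p : ℤ) (Φ : M →ₗ[S] M) : F.endVal Φ ≤ F.endVal (F.delta p Φ) := by
  change _ ≤ F.endVal (F.D ∘ₗ Φ - ((p.negOnePow : ℤ) : ℝ) • Φ ∘ₗ F.D)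
  rw [sub_eq_add_neg, ← neg_smul]
  exact (le_min (F.le_endVal_comp_left Φ)
    ((F.le_endVal_comp_right Φ).trans (F.le_endVal_smul _ _))).trans (F.le_endVal_add _ _)

/-- The differential of `End(M)₀`. -/
def deltaZero (p q : ℤ) (h : p + 1 = q) : F.EndZero p →ₗ[ℝ] F.EndZero q :=
  Submodule.mapQ _ _
    ((F.delta p).restrict fun Φ (hΦ : Φ ∈ F.endNonneg p) =>
      (⟨F.delta_mem_endGr p q h hΦ.1, hΦ.2.trans (F.le_endVal_delta p Φ)⟩ :
        F.delta p Φ ∈ F.endNonneg q))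
    fun Φ hΦ => ⟨F.delta_mem_endGr p q h Φ.2.1, hΦ.2.trans_le (F.le_endVal_delta p Φ)⟩

theorem delta_delta (p : ℤ) (Φ : M →ₗ[S] M) : F.delta (p + 1) (F.delta p Φ) = 0 := by
  have hs : ((p.negOnePow : ℤ) : ℝ) * ((p.negOnePow : ℤ) : ℝ) = 1 := by
    rw [← Int.cast_mul, Int.units_coe_mul_self, Int.cast_one]
  have hp : (((p + 1).negOnePow : ℤ) : ℝ) = -((p.negOnePow : ℤ) : ℝ) := by
    rw [Int.negOnePow_succ, Units.val_neg, Int.cast_neg]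
  have hD : ∀ (c : ℝ) (m : M), F.D (c • m) = c • F.D m := fun c m => by
    rw [← algebraMap_smul S c m, map_smul, algebraMap_smul]
  ext m
  change F.D (F.D (Φ m) - ((p.negOnePow : ℤ) : ℝ) • Φ (F.D m)) -
    (((p + 1).negOnePow : ℤ) : ℝ) •
      (F.D (Φ (F.D m)) - ((p.negOnePow : ℤ) : ℝ) • Φ (F.D (F.D m))) = 0
  rw [hp, map_sub, hD, F.D_D, F.D_D, map_smul, smul_sub, smul_smul, neg_mul, hs]
  module

/-- The cohomology `H^p(End(M)₀)`. -/
abbrev H (p : ℤ) : Type :=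
  LinearMap.ker (F.deltaZero p (p + 1) rfl) ⧸
    (LinearMap.range (F.deltaZero (p - 1) p (sub_add_cancel p 1))).submoduleOf
      (LinearMap.ker (F.deltaZero p (p + 1) rfl))

end FilteredFactorization

/-! ### Singular cohomology -/

section SingularCohomology

open CategoryTheory Opposite Simplicial

variable (X : Type) [TopologicalSpace X] (A : Type) [AddCommGroup A] [Module ℝ A]

/-- The singular `k`-simplices of a space. -/
abbrev SingularSimplex (k : ℕ) : Type := (TopCat.toSSet.obj (TopCat.of X)).obj (op ⦋k⦌)

/-- The singular coboundary `(d φ)(σ) = ∑ (-1) ^ i φ(∂ᵢ σ)`. -/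
def singularCoboundary (k : ℕ) : (SingularSimplex X k → A) →ₗ[ℝ] (SingularSimplex X (k + 1) → A) :=
  ∑ i : Fin (k + 2), (-1 : ℝ) ^ (i : ℕ) •
    LinearMap.funLeft ℝ A ((TopCat.toSSet.obj (TopCat.of X)).δ i)

/-- The singular coboundaries of degree `k`. -/
def singularCoboundaries (k : ℕ) : Submodule ℝ (SingularSimplex X k → A) :=
  match k with
  | 0 => ⊥
  | k + 1 => LinearMap.range (singularCoboundary X A k)

/-- The singular cohomology `H^k(X; A)`. -/
abbrev SingularCohomology (k : ℕ) : Type :=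
  LinearMap.ker (singularCoboundary X A k) ⧸
    (singularCoboundaries X A k).submoduleOf (LinearMap.ker (singularCoboundary X A k))

end SingularCohomology

/-- The graded vector spaces `H^*(End(M)₀)` and `H^*(X; A)` are isomorphic. -/
def FilteredFactorization.HIso {S M Λ : Type} [CommRing S] [Algebra ℝ S] [AddCommGroup M]
    [Module S M] [Module ℝ M] [IsScalarTower ℝ S M] {W w : S}
    (F : FilteredFactorization S M Λ W w) (X : Type) [TopologicalSpace X] (A : Type)
    [AddCommGroup A] [Module ℝ A] : Prop :=
  (∀ k : ℕ, Nonempty (F.H k ≃ₗ[ℝ] SingularCohomology X A k)) ∧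
    ∀ p : ℤ, p < 0 → Subsingleton (F.H p)

/-- The unit sphere `Sⁿ` in `ℝⁿ⁺¹`. -/
abbrev UnitSphere (n : ℕ) : Type := Metric.sphere (0 : EuclideanSpace ℝ (Fin (n + 1))) 1

/-- Antipodal points of the sphere are identified. -/
def antipodal (n : ℕ) : Setoid (UnitSphere n) where
  r x y := x = y ∨ x = -y
  iseqv := by
    refine ⟨fun x => Or.inl rfl, ?_, ?_⟩
    · rintro x y (h | h)
      · exact Or.inl h.symm
      · exact Or.inr (by rw [h, neg_neg])
    · rintro x y z (rfl | rfl) (rfl | rfl)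
      · exact Or.inl rfl
      · exact Or.inr rfl
      · exact Or.inr rfl
      · exact Or.inl (neg_neg _)

/-- Real projective space `ℝPⁿ = Sⁿ / ±1`, with the quotient topology. -/
def RealProjectiveSpace (n : ℕ) : Type := Quotient (antipodal n)

instance (n : ℕ) : TopologicalSpace (RealProjectiveSpace n) :=
  inferInstanceAs (TopologicalSpace (Quotient (antipodal n)))

/-! ### The Novikov field -/

/-- The Novikov field of series `∑ aᵢ T ^ βᵢ` with `aᵢ` real, `βᵢ ∈ (1/(n+1))ℤ` and `βᵢ → ∞`.
Such a series is a Laurent series in the variable `T ^ (1/(n+1))`; the underlying ring does not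
depend on `n`, but the valuation below does. -/
abbrev Novikov : Type := HahnSeries ℤ ℝ

/-- The element `T ^ (k/(n+1))`. -/
def Tpow (k : ℤ) : Novikov := HahnSeries.single k 1

/-- The valuation `ν(∑ aᵢ T ^ βᵢ) = inf {βᵢ | aᵢ ≠ 0}`, where `T ^ (j/(n+1))` is the `j`-th power
of the variable. -/
def novVal (n : ℕ) (r : Novikov) : EReal :=
  ⨅ (j : ℤ) (_ : r.coeff j ≠ 0), (((j : ℝ) / (n + 1) : ℝ) : EReal)

/-- `r` is homogeneous of degree `p`, where `|T ^ β| = 2 (n+1) β`, so `T ^ (j/(n+1))` has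
degree `2 j`. -/
def NovHomogeneous (p : ℤ) (r : Novikov) : Prop := ∀ j, r.coeff j ≠ 0 → 2 * j = p

theorem novVal_gt_of (n : ℕ) (N : ℤ) (r : Novikov) (h : ∀ j < N, r.coeff j = 0) :
    (((N : ℝ) / (n + 1) : ℝ) : EReal) ≤ novVal n r := by
  refine le_iInf₂ fun j hj => ?_
  have : N ≤ j := not_lt.1 fun hlt => hj (h j hlt)
  rw [EReal.coe_le_coe_iff]
  have : (N : ℝ) ≤ j := by exact_mod_cast this
  gcongr

theorem coeff_eq_zero_of_lt (n : ℕ) (r : Novikov) (j : ℤ)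
    (h : (((j : ℝ) / (n + 1) : ℝ) : EReal) < novVal n r) : r.coeff j = 0 := by
  by_contra hj
  exact absurd (iInf₂_le j hj) (not_le.2 h)

theorem novVal_nonneg_iff (n : ℕ) (r : Novikov) :
    0 ≤ novVal n r ↔ ∀ j < 0, r.coeff j = 0 := by
  constructor
  · intro h j hj
    refine coeff_eq_zero_of_lt n r j (lt_of_lt_of_le ?_ h)
    have : (j : ℝ) < 0 := by exact_mod_cast hj
    exact_mod_cast div_neg_of_neg_of_pos this (by positivity : (0 : ℝ) < n + 1)
  · intro h
    simpa using novVal_gt_of n 0 r h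

theorem novVal_pos_iff (n : ℕ) (r : Novikov) :
    0 < novVal n r ↔ ∀ j < 1, r.coeff j = 0 := by
  constructor
  · intro h j hj
    refine coeff_eq_zero_of_lt n r j (lt_of_le_of_lt ?_ h)
    have : (j : ℝ) ≤ 0 := by exact_mod_cast (show j ≤ 0 by omega)
    exact_mod_cast div_nonpos_of_nonpos_of_nonneg this (by positivity : (0 : ℝ) ≤ n + 1)
  · intro h
    refine lt_of_lt_of_le ?_ (novVal_gt_of n 1 r h)
    have : (0 : ℝ) < ((1 : ℤ) : ℝ) / (n + 1) := by push_cast; positivity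
    exact_mod_cast this

theorem coeff_mul_eq_zero {a b : ℤ} {r s : Novikov} (hr : ∀ j < a, r.coeff j = 0)
    (hs : ∀ j < b, s.coeff j = 0) (j : ℤ) (hj : j < a + b) : (r * s).coeff j = 0 := by
  rw [HahnSeries.coeff_mul]
  refine Finset.sum_eq_zero fun x hx => ?_
  rw [Finset.mem_antidiagonal] at hx
  by_cases h : x.1 < a
  · rw [hr _ h, zero_mul]
  · rw [hs _ (by omega), mul_zero]

/-- The elements of non-negative valuation. -/
def novNonneg (n : ℕ) : Subring Novikov where
  carrier := {r | 0 ≤ novVal n r}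
  zero_mem' := by
    rw [Set.mem_ofPred_eq, novVal_nonneg_iff]
    intro j _
    rw [HahnSeries.coeff_zero]
  one_mem' := by
    rw [Set.mem_ofPred_eq, novVal_nonneg_iff]
    intro j hj
    exact HahnSeries.coeff_single_of_ne (by omega)
  neg_mem' := by
    intro a ha
    rw [Set.mem_ofPred_eq, novVal_nonneg_iff] at *
    exact fun j hj => by rw [HahnSeries.coeff_neg, ha j hj, neg_zero]
  mul_mem' := by
    intro a b ha hb
    rw [Set.mem_ofPred_eq, novVal_nonneg_iff] at *
    exact fun j hj => coeff_mul_eq_zero ha hb j (by simpa using hj)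
  add_mem' := by
    intro a b ha hb
    rw [Set.mem_ofPred_eq, novVal_nonneg_iff] at *
    exact fun j hj => by rw [HahnSeries.coeff_add, ha j hj, hb j hj, add_zero]

/-- The ideal of elements of positive valuation. -/
def novPos (n : ℕ) : Ideal (novNonneg n) where
  carrier := {r | 0 < novVal n (r : Novikov)}
  zero_mem' := by
    rw [Set.mem_ofPred_eq, novVal_pos_iff]
    intro j _
    rw [ZeroMemClass.coe_zero, HahnSeries.coeff_zero]
  add_mem' := by
    intro a b ha hb
    rw [Set.mem_ofPred_eq, novVal_pos_iff] at *
    exact fun j hj => by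
      rw [Subring.coe_add, HahnSeries.coeff_add, ha j hj, hb j hj, add_zero]
  smul_mem' := by
    intro c a ha
    have hc : 0 ≤ novVal n (c : Novikov) := c.2
    rw [Set.mem_ofPred_eq, novVal_pos_iff] at *
    rw [novVal_nonneg_iff] at hc
    exact fun j hj => coeff_mul_eq_zero hc ha j (by simpa using hj)

/-- The ring `R₀ = {ν ≥ 0} / {ν > 0}`. -/
def NovikovResidue (n : ℕ) : Type := novNonneg n ⧸ novPos n

instance (n : ℕ) : CommRing (NovikovResidue n) := inferInstanceAs (CommRing (_ ⧸ novPos n))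

/-- The real numbers as constant elements of valuation at least zero. -/
def realToNonneg (n : ℕ) : ℝ →+* novNonneg n :=
  (HahnSeries.C : ℝ →+* Novikov).codRestrict (novNonneg n) fun c => by
    change 0 ≤ novVal n (HahnSeries.C c)
    rw [novVal_nonneg_iff]
    intro j hj
    rw [HahnSeries.C_apply]
    exact HahnSeries.coeff_single_of_ne (by omega)

instance (n : ℕ) : Algebra ℝ (NovikovResidue n) :=
  ((Ideal.Quotient.mk (novPos n)).comp (realToNonneg n)).toAlgebra

/-! ### The Tate algebra and its quotient `S` -/

theorem exists_lower (r : Novikov) : ∃ N : ℤ, ∀ j < N, r.coeff j = 0 :=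
  ⟨r.order, fun _ hj => HahnSeries.coeff_eq_zero_of_lt_order hj⟩

/-- A power series in `z₀, …, zₙ` over the Novikov field belongs to the Tate algebra when its
coefficients tend to zero, i.e. their valuations tend to infinity. -/
def IsTate (n : ℕ) (f : MvPowerSeries (Fin (n + 1)) Novikov) : Prop :=
  Tendsto (fun k => novVal n (MvPowerSeries.coeff k f)) cofinite (𝓝 ⊤)

theorem isTate_iff (n : ℕ) (f : MvPowerSeries (Fin (n + 1)) Novikov) :
    IsTate n f ↔ ∀ N : ℤ, ∀ᶠ k in cofinite, ∀ j < N, (MvPowerSeries.coeff k f).coeff j = 0 := by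
  have hn : (0 : ℝ) < n + 1 := by positivity
  rw [IsTate, EReal.tendsto_nhds_top_iff_real]
  constructor
  · intro h N
    filter_upwards [h ((N : ℝ) / (n + 1))] with k hk j hj
    refine coeff_eq_zero_of_lt n _ j (lt_trans ?_ hk)
    have : (j : ℝ) < N := by exact_mod_cast hj
    rw [EReal.coe_lt_coe_iff]
    gcongr
  · intro h x
    obtain ⟨N, hN⟩ := exists_int_gt (x * (n + 1))
    filter_upwards [h N] with k hk
    refine lt_of_lt_of_le ?_ (novVal_gt_of n N _ hk)
    rw [EReal.coe_lt_coe_iff, lt_div_iff₀ hn]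
    exact hN

theorem IsTate.lower {n : ℕ} {f : MvPowerSeries (Fin (n + 1)) Novikov} (hf : IsTate n f) :
    ∃ B : ℤ, ∀ k, ∀ j < B, (MvPowerSeries.coeff k f).coeff j = 0 := by
  have h0 := (isTate_iff n f).1 hf 0
  rw [eventually_cofinite] at h0
  choose b hb using fun k => exists_lower (MvPowerSeries.coeff k f)
  obtain ⟨B, hB⟩ := (h0.image b).bddBelow
  refine ⟨min B 0, fun k j hj => ?_⟩
  by_cases hk : ∀ j < (0 : ℤ), (MvPowerSeries.coeff k f).coeff j = 0
  · exact hk j (lt_of_lt_of_le hj (min_le_right _ _))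
  · exact hb k j (lt_of_lt_of_le (lt_of_lt_of_le hj (min_le_left _ _)) (hB ⟨k, hk, rfl⟩))

theorem isTate_mul {n : ℕ} {f g : MvPowerSeries (Fin (n + 1)) Novikov} (hf : IsTate n f)
    (hg : IsTate n g) : IsTate n (f * g) := by
  obtain ⟨A, hA⟩ := hf.lower
  obtain ⟨B, hB⟩ := hg.lower
  rw [isTate_iff] at hf hg ⊢
  intro N
  have h1 := hf (N - B)
  have h2 := hg (N - A)
  rw [eventually_cofinite] at h1 h2 ⊢
  refine (h1.add h2).subset fun k hk => ?_
  by_contra hk2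
  refine hk fun j hj => ?_
  rw [MvPowerSeries.coeff_mul, HahnSeries.coeff_sum]
  refine Finset.sum_eq_zero fun x hx => ?_
  rw [Finset.HasAntidiagonal.mem_antidiagonal] at hx
  by_cases hx1 : ∀ j < N - B, (MvPowerSeries.coeff x.1 f).coeff j = 0
  · exact coeff_mul_eq_zero hx1 (hB x.2) j (by omega)
  · by_cases hx2 : ∀ j < N - A, (MvPowerSeries.coeff x.2 g).coeff j = 0
    · exact coeff_mul_eq_zero (hA x.1) hx2 j (by omega)
    · exact absurd ⟨x.1, hx1, x.2, hx2, hx⟩ hk2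

theorem isTate_of_finite {n : ℕ} {f : MvPowerSeries (Fin (n + 1)) Novikov}
    (hf : {k | MvPowerSeries.coeff k f ≠ 0}.Finite) : IsTate n f := by
  rw [isTate_iff]
  intro N
  rw [eventually_cofinite]
  refine hf.subset fun k hk h0 => hk fun j _ => ?_
  rw [h0, HahnSeries.coeff_zero]

/-- The Tate algebra `R⟨z₀, …, zₙ⟩`. -/
def tate (n : ℕ) : Subring (MvPowerSeries (Fin (n + 1)) Novikov) where
  carrier := {f | IsTate n f}
  mul_mem' := isTate_mul
  one_mem' := by
    classical
    refine isTate_of_finite ((Set.finite_singleton 0).subset fun k hk => ?_)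
    by_contra h0
    refine hk ?_
    rw [MvPowerSeries.coeff_one]
    exact if_neg h0
  zero_mem' := isTate_of_finite (Set.finite_empty.subset fun k hk => hk (map_zero _))
  add_mem' := by
    intro f g hf hg
    rw [Set.mem_ofPred_eq, isTate_iff] at *
    intro N
    filter_upwards [hf N, hg N] with k h1 h2 j hj
    rw [map_add, HahnSeries.coeff_add, h1 j hj, h2 j hj, add_zero]
  neg_mem' := by
    intro f hf
    rw [Set.mem_ofPred_eq, isTate_iff] at *
    intro N
    filter_upwards [hf N] with k h1 j hj
    rw [map_neg, HahnSeries.coeff_neg, h1 j hj, neg_zero]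

/-- The variable `zᵢ` of the Tate algebra. -/
def tateX (n : ℕ) (i : Fin (n + 1)) : tate n :=
  ⟨MvPowerSeries.X i, by
    classical
    refine isTate_of_finite ((Set.finite_singleton (Finsupp.single i 1)).subset fun k hk => ?_)
    by_contra h0
    refine hk ?_
    rw [MvPowerSeries.coeff_X]
    exact if_neg h0⟩

/-- The constants of the Tate algebra. -/
def tateC (n : ℕ) : Novikov →+* tate n :=
  (MvPowerSeries.C : Novikov →+* MvPowerSeries (Fin (n + 1)) Novikov).codRestrict (tate n)
    fun r => by
      classical
      refine isTate_of_finite ((Set.finite_singleton 0).subset fun k hk => ?_)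
      by_contra h0
      refine hk ?_
      rw [MvPowerSeries.coeff_C]
      exact if_neg h0

/-- The ideal generated by `(-1) ^ (n(n+1)/2) z₀ ⋯ zₙ - T`. -/
def relIdeal (n : ℕ) : Ideal (tate n) :=
  Ideal.span {(-1) ^ (n * (n + 1) / 2) * ∏ i, tateX n i - tateC n (Tpow (n + 1))}

/-- The algebra `S = R⟨z₀, …, zₙ⟩ / ⟨(-1) ^ (n(n+1)/2) z₀ ⋯ zₙ - T⟩`. -/
def S (n : ℕ) : Type := tate n ⧸ relIdeal n

instance (n : ℕ) : CommRing (S n) := inferInstanceAs (CommRing (_ ⧸ relIdeal n))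

/-- The projection from the Tate algebra to `S`. -/
def toS (n : ℕ) : tate n →+* S n := Ideal.Quotient.mk (relIdeal n)

/-- The structure map from the Novikov field to `S`. -/
def novToS (n : ℕ) : Novikov →+* S n := (toS n).comp (tateC n)

instance (n : ℕ) : Algebra ℝ (S n) := ((novToS n).comp HahnSeries.C).toAlgebra

/-- The element `zᵢ` of `S`. -/
def z (n : ℕ) (i : Fin (n + 1)) : S n := toS n (tateX n i)

/-- The superpotential `W = z₀ + ⋯ + zₙ`. -/
def superpotential (n : ℕ) : S n := ∑ i, z n i

/-- The interior of the standard `n`-simplex, in barycentric coordinates `ζ₀, …, ζₙ`. -/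
def Simplex (n : ℕ) : Type := {ζ : Fin (n + 1) → ℝ // (∀ i, 0 < ζ i) ∧ ∑ i, ζ i = 1}

/-- The valuation induced along a surjection `π` by a valuation `v`: the supremum of the
valuations of the preimages. -/
def quotVal {A B : Type} (π : A → B) (v : A → EReal) (b : B) : EReal :=
  ⨆ (a : A) (_ : π a = b), v a

/-- The valuation `∑ r_k z ^ k ↦ inf (ν(r_k) + ∑ kᵢ ζᵢ)` on the Tate algebra, for which the
monomials are orthogonal and `zᵢ` has valuation `ζᵢ`. -/
def tateVal {n : ℕ} (ζ : Simplex n) (f : tate n) : EReal :=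
  ⨅ k, novVal n (MvPowerSeries.coeff k (f : MvPowerSeries (Fin (n + 1)) Novikov)) +
    ((∑ i, (k i : ℝ) * ζ.1 i : ℝ) : EReal)

/-- The valuation `ν_ζ` of `S`, with `ν_ζ(zᵢ) = ζᵢ`. -/
def valS {n : ℕ} (ζ : Simplex n) : S n → EReal := quotVal (toS n) (tateVal ζ)

/-- A series is homogeneous of degree `p`, where `|zᵢ| = 2`. -/
def TateHomogeneous {n : ℕ} (p : ℤ) (f : tate n) : Prop :=
  ∀ k, NovHomogeneous (p - 2 * ∑ i, (k i : ℤ))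
    (MvPowerSeries.coeff k (f : MvPowerSeries (Fin (n + 1)) Novikov))

/-- An element of `S` is homogeneous of degree `p` if it is represented by a homogeneous series
of degree `p`. -/
def SHomogeneous {n : ℕ} (p : ℤ) (s : S n) : Prop := ∃ f, TateHomogeneous p f ∧ toS n f = s

/-! ### The Clifford algebra and the Dirac module -/

/-- The quadratic form `∑ zᵢ xᵢ ^ 2`. -/
def form (n : ℕ) : QuadraticForm (S n) (Fin (n + 1) → S n) :=
  QuadraticMap.weightedSumSquares (S n) (z n)

/-- The Clifford algebra, with generators `eᵢ` and relations `eᵢ eⱼ + eⱼ eᵢ = 2 δᵢⱼ zᵢ`. -/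
abbrev Cl (n : ℕ) : Type := CliffordAlgebra (form n)

/-- The generator `eᵢ` of the Clifford algebra. -/
def e (n : ℕ) (i : Fin (n + 1)) : Cl n := CliffordAlgebra.ι (form n) (Pi.single i 1)

/-- The left ideal generated by `ε e₀ ⋯ eₙ - T ^ (1/2)`, for `n` odd. The sign `ε` is
`(-1) ^ 𝔰(1)` for a combinatorial relative spin structure `𝔰`. -/
def diracIdeal (n : ℕ) (ε : ℤˣ) : Submodule (Cl n) (Cl n) :=
  Submodule.span (Cl n) {(ε : ℤ) • (List.ofFn (e n)).prod -
    algebraMap (S n) (Cl n) (novToS n (Tpow ((n + 1) / 2)))}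

/-- The Dirac module `Cl / ⟨ε e₀ ⋯ eₙ - T ^ (1/2)⟩`. -/
abbrev DiracModule (n : ℕ) (ε : ℤˣ) : Type := Cl n ⧸ diracIdeal n ε

/-- The tensor algebra on `e₀, …, eₙ` over `S`: combinations of the words in the `eᵢ`. -/
abbrev Tensor (n : ℕ) : Type := List (Fin (n + 1)) →₀ S n

/-- The projection from the tensor algebra to the Clifford algebra. -/
def toCl (n : ℕ) : Tensor n →ₗ[S n] Cl n :=
  Finsupp.linearCombination (S n) fun w => (w.map (e n)).prod

/-- The projection from the tensor algebra to the Dirac module. -/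
def toM (n : ℕ) (ε : ℤˣ) : Tensor n →ₗ[S n] DiracModule n ε :=
  ((diracIdeal n ε).mkQ.restrictScalars (S n)).comp (toCl n)

/-- The valuation on the tensor algebra for which words are orthogonal and `eᵢ` has valuation
`ζᵢ / 2`. -/
def tensorVal {n : ℕ} (ζ : Simplex n) (c : Tensor n) : EReal :=
  ⨅ w, valS ζ (c w) + (((w.map fun i => ζ.1 i / 2).sum : ℝ) : EReal)

/-- A combination of words is homogeneous of degree `p`, where `|eᵢ| = 1`. -/
def TensorHomogeneous {n : ℕ} (p : ℤ) (c : Tensor n) : Prop :=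
  ∀ w, SHomogeneous (p - w.length) (c w)

/-- The valuation `ν_ζ` of the Dirac module, induced from the tensor algebra through the
Clifford algebra. -/
def valM {n : ℕ} {ε : ℤˣ} (ζ : Simplex n) : DiracModule n ε → EReal :=
  quotVal (toM n ε) (tensorVal ζ)

theorem le_quotVal_add {A B : Type} [Add A] [Add B] {π : A → B}
    (hπ : ∀ a b, π (a + b) = π a + π b) {v : A → EReal}
    (hv : ∀ a b, min (v a) (v b) ≤ v (a + b)) (x y : B) :
    min (quotVal π v x) (quotVal π v y) ≤ quotVal π v (x + y) := by
  refine le_of_forall_lt fun t ht => ?_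
  obtain ⟨h1, h2⟩ := lt_min_iff.1 ht
  obtain ⟨a, h1⟩ := lt_iSup_iff.1 h1
  obtain ⟨ha, h1⟩ := lt_iSup_iff.1 h1
  obtain ⟨b, h2⟩ := lt_iSup_iff.1 h2
  obtain ⟨hb, h2⟩ := lt_iSup_iff.1 h2
  exact lt_of_lt_of_le (lt_of_lt_of_le (lt_min h1 h2) (hv a b))
    (le_iSup₂_of_le (a + b) (by rw [hπ, ha, hb]) le_rfl)

theorem quotVal_le_map {A B : Type} {π : A → B} {v : A → EReal} {φ : A → A} {ψ : B → B}
    (h : ∀ a, π (φ a) = ψ (π a)) (hv : ∀ a, v a ≤ v (φ a)) (x : B) :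
    quotVal π v x ≤ quotVal π v (ψ x) := by
  refine iSup₂_le fun a ha => ?_
  exact le_iSup₂_of_le (φ a) (by rw [h, ha]) (hv a)

theorem le_novVal_add (n : ℕ) (r s : Novikov) :
    min (novVal n r) (novVal n s) ≤ novVal n (r + s) := by
  refine le_iInf₂ fun j hj => ?_
  by_cases h : r.coeff j = 0
  · have hs : s.coeff j ≠ 0 := fun hs => hj (by rw [HahnSeries.coeff_add, h, hs, add_zero])
    exact (min_le_right _ _).trans (iInf₂_le j hs)
  · exact (min_le_left _ _).trans (iInf₂_le j h)

theorem le_novVal_C_mul (n : ℕ) (c : ℝ) (r : Novikov) :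
    novVal n r ≤ novVal n (HahnSeries.C c * r) := by
  refine le_iInf₂ fun j hj => iInf₂_le j fun h => hj ?_
  rw [HahnSeries.C_mul_eq_smul, HahnSeries.coeff_smul, h, smul_zero]

theorem novVal_zero (n : ℕ) : novVal n 0 = ⊤ := by
  refine top_unique (le_iInf₂ fun j hj => absurd (HahnSeries.coeff_zero) hj)

theorem tateVal_zero {n : ℕ} (ζ : Simplex n) : tateVal ζ 0 = ⊤ := by
  refine top_unique (le_iInf fun k => ?_)
  rw [ZeroMemClass.coe_zero, map_zero, novVal_zero, EReal.top_add_coe]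

theorem le_tateVal_add {n : ℕ} (ζ : Simplex n) (f g : tate n) :
    min (tateVal ζ f) (tateVal ζ g) ≤ tateVal ζ (f + g) := by
  refine le_iInf fun k => ?_
  rw [Subring.coe_add, map_add]
  refine le_trans ?_ (add_le_add_left (le_novVal_add n _ _) _)
  rcases min_choice (novVal n (MvPowerSeries.coeff k f.1)) (novVal n (MvPowerSeries.coeff k g.1))
    with h | h <;> rw [h]
  · exact (min_le_left _ _).trans (iInf_le _ k)
  · exact (min_le_right _ _).trans (iInf_le _ k)

theorem valS_zero {n : ℕ} (ζ : Simplex n) : valS ζ 0 = ⊤ :=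
  top_unique (le_iSup₂_of_le 0 (map_zero _) (tateVal_zero ζ).ge)

theorem le_valS_add {n : ℕ} (ζ : Simplex n) (s t : S n) :
    min (valS ζ s) (valS ζ t) ≤ valS ζ (s + t) :=
  le_quotVal_add (map_add (toS n)) (le_tateVal_add ζ) s t

theorem le_valS_smul {n : ℕ} (ζ : Simplex n) (c : ℝ) (s : S n) :
    valS ζ s ≤ valS ζ (c • s) := by
  refine quotVal_le_map (φ := fun f => tateC n (HahnSeries.C c) * f) (fun f => ?_)
    (fun f => iInf_mono fun k => ?_) s
  · rw [map_mul, Algebra.smul_def]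
    rfl
  · have h : MvPowerSeries.coeff k ((tateC n (HahnSeries.C c) * f : tate n) :
        MvPowerSeries (Fin (n + 1)) Novikov) =
        HahnSeries.C c * MvPowerSeries.coeff k f.1 := MvPowerSeries.coeff_C_mul _ _ _
    rw [h]
    exact add_le_add_left (le_novVal_C_mul n c _) _

theorem tensorVal_zero {n : ℕ} (ζ : Simplex n) : tensorVal ζ 0 = ⊤ := by
  refine top_unique (le_iInf fun w => ?_)
  rw [Finsupp.zero_apply, valS_zero, EReal.top_add_coe]

theorem le_tensorVal_add {n : ℕ} (ζ : Simplex n) (c d : Tensor n) :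
    min (tensorVal ζ c) (tensorVal ζ d) ≤ tensorVal ζ (c + d) := by
  refine le_iInf fun w => ?_
  rw [Finsupp.add_apply]
  refine le_trans ?_ (add_le_add_left (le_valS_add ζ _ _) _)
  rcases min_choice (valS ζ (c w)) (valS ζ (d w)) with h | h <;> rw [h]
  · exact (min_le_left _ _).trans (iInf_le _ w)
  · exact (min_le_right _ _).trans (iInf_le _ w)

theorem le_tensorVal_sum {n : ℕ} (ζ : Simplex n) {ι : Type} (t : Finset ι) (c : ι → Tensor n)
    (b : EReal) (h : ∀ i ∈ t, b ≤ tensorVal ζ (c i)) : b ≤ tensorVal ζ (∑ i ∈ t, c i) := by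
  classical
  induction t using Finset.induction_on with
  | empty => rw [Finset.sum_empty, tensorVal_zero]; exact le_top
  | insert i t hi ih =>
    rw [Finset.sum_insert hi]
    exact (le_min (h i (Finset.mem_insert_self i t))
      (ih fun j hj => h j (Finset.mem_insert_of_mem hj))).trans (le_tensorVal_add ζ _ _)

/-- Left multiplication by `e₀ + ⋯ + eₙ` on the tensor algebra. -/
def tensorD (n : ℕ) (c : Tensor n) : Tensor n :=
  ∑ i : Fin (n + 1), Finsupp.mapDomain (List.cons i) c

theorem le_tensorVal_cons {n : ℕ} (ζ : Simplex n) (i : Fin (n + 1)) (c : Tensor n) :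
    tensorVal ζ c ≤ tensorVal ζ (Finsupp.mapDomain (List.cons i) c) := by
  refine le_iInf fun w => ?_
  by_cases hw : w ∈ Set.range (List.cons i)
  · obtain ⟨v, rfl⟩ := hw
    rw [Finsupp.mapDomain_apply (List.cons_injective)]
    refine (iInf_le _ v).trans (add_le_add_right ?_ _)
    rw [EReal.coe_le_coe_iff, List.map_cons, List.sum_cons]
    have := ζ.2.1 i
    linarith
  · rw [Finsupp.mapDomain_of_notMem_range _ _ hw, valS_zero, EReal.top_add_coe]
    exact le_top

theorem NovHomogeneous.zero (p : ℤ) : NovHomogeneous p 0 :=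
  fun _ hj => absurd HahnSeries.coeff_zero hj

theorem NovHomogeneous.add {p : ℤ} {r s : Novikov} (hr : NovHomogeneous p r)
    (hs : NovHomogeneous p s) : NovHomogeneous p (r + s) := by
  intro j hj
  by_cases h : r.coeff j = 0
  · exact hs j fun h' => hj (by rw [HahnSeries.coeff_add, h, h', add_zero])
  · exact hr j h

theorem NovHomogeneous.C_mul {p : ℤ} {r : Novikov} (hr : NovHomogeneous p r) (c : ℝ) :
    NovHomogeneous p (HahnSeries.C c * r) := by
  refine fun j hj => hr j fun h => hj ?_
  rw [HahnSeries.C_mul_eq_smul, HahnSeries.coeff_smul, h, smul_zero]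

theorem SHomogeneous.zero {n : ℕ} (p : ℤ) : SHomogeneous p (0 : S n) := by
  refine ⟨0, fun k => ?_, map_zero _⟩
  rw [ZeroMemClass.coe_zero, map_zero]
  exact NovHomogeneous.zero _

theorem SHomogeneous.add {n : ℕ} {p : ℤ} {s t : S n} (hs : SHomogeneous p s)
    (ht : SHomogeneous p t) : SHomogeneous p (s + t) := by
  obtain ⟨f, hf, rfl⟩ := hs
  obtain ⟨g, hg, rfl⟩ := ht
  refine ⟨f + g, fun k => ?_, map_add _ _ _⟩
  rw [Subring.coe_add, map_add]
  exact (hf k).add (hg k)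

theorem SHomogeneous.smul {n : ℕ} {p : ℤ} {s : S n} (hs : SHomogeneous p s) (c : ℝ) :
    SHomogeneous p (c • s) := by
  obtain ⟨f, hf, rfl⟩ := hs
  refine ⟨tateC n (HahnSeries.C c) * f, fun k => ?_, ?_⟩
  · have h : MvPowerSeries.coeff k ((tateC n (HahnSeries.C c) * f : tate n) :
        MvPowerSeries (Fin (n + 1)) Novikov) =
        HahnSeries.C c * MvPowerSeries.coeff k f.1 := MvPowerSeries.coeff_C_mul _ _ _
    rw [h]
    exact (hf k).C_mul c
  · rw [map_mul, Algebra.smul_def]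
    rfl

theorem SHomogeneous.sum {n : ℕ} {p : ℤ} {ι : Type} (t : Finset ι) (c : ι → S n)
    (h : ∀ i ∈ t, SHomogeneous p (c i)) : SHomogeneous p (∑ i ∈ t, c i) := by
  classical
  induction t using Finset.induction_on with
  | empty => rw [Finset.sum_empty]; exact SHomogeneous.zero p
  | insert i t hi ih =>
    rw [Finset.sum_insert hi]
    exact (h i (Finset.mem_insert_self i t)).add
      (ih fun j hj => h j (Finset.mem_insert_of_mem hj))

theorem TensorHomogeneous.tensorD {n : ℕ} {p : ℤ} {c : Tensor n} (hc : TensorHomogeneous p c) :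
    TensorHomogeneous (p + 1) (tensorD n c) := by
  intro w
  rw [DiracMF.tensorD, Finsupp.finsetSum_apply]
  refine SHomogeneous.sum _ _ fun i _ => ?_
  by_cases hw : w ∈ Set.range (List.cons i)
  · obtain ⟨v, rfl⟩ := hw
    rw [Finsupp.mapDomain_apply (List.cons_injective), List.length_cons]
    have := hc v
    rwa [show p + 1 - ((v.length + 1 : ℕ) : ℤ) = p - v.length by push_cast; ring]
  · rw [Finsupp.mapDomain_of_notMem_range _ _ hw]
    exact SHomogeneous.zero _

theorem toM_smul {n : ℕ} {ε : ℤˣ} (c : ℝ) (x : Tensor n) : toM n ε (c • x) = c • toM n ε x := by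
  rw [← algebraMap_smul (S n) c x, map_smul]
  exact algebraMap_smul (S n) c (toM n ε x)

/-- The elements of degree `p` of the Dirac module: the images of the combinations of words of
degree `p`. -/
def grM (n : ℕ) (ε : ℤˣ) (p : ℤ) : Submodule ℝ (DiracModule n ε) where
  carrier := {m | ∃ c, TensorHomogeneous p c ∧ toM n ε c = m}
  zero_mem' := ⟨0, fun _ => SHomogeneous.zero _, map_zero _⟩
  add_mem' := by
    rintro _ _ ⟨c, hc, rfl⟩ ⟨d, hd, rfl⟩
    exact ⟨c + d, fun w => (hc w).add (hd w), map_add _ _ _⟩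
  smul_mem' := by
    rintro a _ ⟨c, hc, rfl⟩
    exact ⟨a • c, fun w => (hc w).smul a, toM_smul a c⟩

/-- Left multiplication by `e₀ + ⋯ + eₙ` on the Dirac module. -/
def diracD (n : ℕ) (ε : ℤˣ) : DiracModule n ε →ₗ[S n] DiracModule n ε :=
  Algebra.lsmul (S n) (S n) (DiracModule n ε) (∑ i, e n i)

theorem toM_tensorD (n : ℕ) (ε : ℤˣ) (c : Tensor n) :
    toM n ε (tensorD n c) = diracD n ε (toM n ε c) := by
  have h : toCl n (tensorD n c) = (∑ i, e n i) * toCl n c := by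
    rw [tensorD, map_sum, Finset.sum_mul]
    refine Finset.sum_congr rfl fun i _ => ?_
    rw [toCl, Finsupp.linearCombination_mapDomain, Finsupp.linearCombination_apply,
      Finsupp.linearCombination_apply, Finsupp.mul_sum]
    refine Finsupp.sum_congr fun w _ => ?_
    rw [Function.comp_apply, List.map_cons, List.prod_cons, mul_smul_comm]
  change (diracIdeal n ε).mkQ (toCl n (tensorD n c)) = (∑ i, e n i) • (diracIdeal n ε).mkQ (toCl n c)
  rw [h, ← smul_eq_mul, map_smul]

theorem sum_e_mul_self (n : ℕ) :
    (∑ i, e n i) * (∑ i, e n i) = algebraMap (S n) (Cl n) (superpotential n) := by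
  simp only [e]
  rw [← map_sum, CliffordAlgebra.ι_sq_scalar]
  congr 1
  rw [form, QuadraticMap.weightedSumSquares_apply, superpotential]
  refine Finset.sum_congr rfl fun i _ => ?_
  simp [Finset.sum_apply, Pi.single_apply]

/-- The Dirac factorization of the simplex `△ⁿ`, with `w = 0`. -/
def dirac (n : ℕ) (ε : ℤˣ) :
    FilteredFactorization (S n) (DiracModule n ε) (Simplex n) (superpotential n) 0 where
  gr := grM n ε
  D := diracD n ε
  val := valM
  D_mem_gr := by
    rintro p _ ⟨c, hc, rfl⟩
    exact ⟨tensorD n c, hc.tensorD, toM_tensorD n ε c⟩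
  D_D m := by
    change (∑ i, e n i) • (∑ i, e n i) • m = _
    rw [smul_smul, sum_e_mul_self, algebraMap_smul, sub_zero]
  le_val_D ζ m := quotVal_le_map (toM_tensorD n ε)
    (fun c => le_tensorVal_sum ζ _ _ _ fun i _ => le_tensorVal_cons ζ i c) m
  val_zero ζ := top_unique (le_iSup₂_of_le 0 (map_zero _) (tensorVal_zero ζ).ge)
  le_val_add ζ := le_quotVal_add (map_add (toM n ε)) (le_tensorVal_add ζ)
  le_val_smul ζ c := quotVal_le_map (φ := fun x => c • x) (toM_smul c)
    fun x => iInf_mono fun w => add_le_add_left (le_valS_smul ζ c (x w)) _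

/-- `F` is an object of the normed matrix factorization category of the model
`(S, {ν_ζ}, W)` of the simplex: the functions `F.val ζ` are valuations compatible with those of
`S`, and `M` is a free graded module with a finite homogeneous basis that is orthogonal for all
`ζ` and whose valuations are affine in `ζ`, with values at the vertices in the image of the
valuation of the Novikov field. An affine function on the simplex is given in barycentric
coordinates as `∑ aₗ ζₗ`, where `aₗ` is its limit at the `l`-th vertex. -/
structure IsMatrixFactorization {n : ℕ} {M : Type} [AddCommGroup M] [Module (S n) M] [Module ℝ M]
    {w : S n} (F : FilteredFactorization (S n) M (Simplex n) (superpotential n) w) : Prop where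
  val_eq_top_iff : ∀ ζ m, F.val ζ m = ⊤ ↔ m = 0
  val_ne_bot : ∀ ζ m, F.val ζ m ≠ ⊥
  val_smul : ∀ ζ (s : S n) m, F.val ζ (s • m) = valS ζ s + F.val ζ m
  exists_basis : ∃ (ι : Type) (_ : Fintype ι) (b : Module.Basis ι (S n) M) (deg : ι → ℤ)
    (a : ι → Fin (n + 1) → ℝ),
    (∀ p m, m ∈ F.gr p ↔ ∀ i, SHomogeneous (p - deg i) (b.repr m i)) ∧
    (∀ ζ m, F.val ζ m = ⨅ i, (valS ζ (b.repr m i) + F.val ζ (b i))) ∧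
    (∀ ζ i, F.val ζ (b i) = ((∑ l, a i l * ζ.1 l : ℝ) : EReal)) ∧
    (∀ i l, ∃ r : Novikov, novVal n r = ((a i l : ℝ) : EReal))

/-- An object of the normed matrix factorization category is spherical if
`H^*(End(M)₀) ≅ H^*(Sⁿ; R₀)`. -/
def IsSpherical {n : ℕ} {M : Type} [AddCommGroup M] [Module (S n) M] [Module ℝ M]
    [IsScalarTower ℝ (S n) M] {w : S n}
    (F : FilteredFactorization (S n) M (Simplex n) (superpotential n) w) : Prop :=
  IsMatrixFactorization F ∧ F.HIso (UnitSphere n) (NovikovResidue n)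

end

end DiracMF

/-!
The proof has a topological and an algebraic half, which meet in the statement that both sides are
one-dimensional in degrees `0` and `n` and vanish elsewhere.

**Topology.** Reduced singular cohomology is homotopy invariant (the prism operator), and
subdivision of singular simplices makes cochains on small simplices as good as all cochains, which
gives a Mayer–Vietoris sequence. Removing a point from `ℝ ^ N` and induction on the dimension give
the reduced cohomology of a punctured space, hence of the sphere. For real projective space of odd
dimension, simplices lift along the double cover in exactly two ways, so the cochains of `ℝPⁿ` are
the antipodally invariant cochains of the sphere. Averaging over the antipodal map, which is
possible because `2` is invertible, identifies the cohomology of `ℝPⁿ` with the invariant part of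
that of the sphere; for `n` odd the antipodal map is homotopic to the identity, and everything is
invariant.

**Algebra.** In `S` the variables are units, with product `±T`, so every element is a unique
(infinite) real combination of Laurent monomials `z ^ a`, where a power `T ^ β` with
`β ∈ (1/(n+1)) ℤ` adds `β` to every entry of `a`; the valuation `ν_ζ` is the smallest weight `∑ ζᵢ aᵢ` of a
monomial that occurs, and it is multiplicative. The relation `ε e₀ ⋯ eₙ = T ^ (1/2)` makes the words
in `e₁, …, eₙ` without repetition a basis of the Dirac module `M`, indexed by `(ZMod 2) ^ n`;
independence is shown by an explicit model of `M` on the free module with this index set, on which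
each `eᵢ` acts by a sign, a monomial and a shift of the index. The basis is orthogonal for every
`ν_ζ`.

An endomorphism of `M` is then a matrix of Laurent series, and its norm is at least zero when the
weights of all its monomials, relative to the basis, have non-negative entries. In degree `p` such a
weight has sum `p/2`, and if one of its entries vanishes, the congruences that hold between the
entries force it to be `k/2` with `k ∈ ℕ ^ (n + 1)`. Modulo norm greater than zero, only the
products `z ^ (k/2)` times a shift of the index by the parity of `k` matter. Thus `{ν ≥ 0}` maps
onto the finite-dimensional space `T₀` of families `c(k, J)` with `k ≥ 0` and `∑ kᵢ = p`, and
`{ν > 0}` is the preimage of the subspace `T₁` of the families supported on `k ≥ 1`.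

Since `D eⱼ + eⱼ D = 2 zⱼ`, left multiplication by `eⱼ / (2 zⱼ)` is a contracting homotopy on `T_m`,
as long as it does not leave the space, that is, up to the boundary `kⱼ = m` of the support. Using
these for all `j`, `T_m` is exact except in degree `m (n + 1)`, where the closed families are the
constants at `k = (m, …, m)`. So the quotient `T₀ / T₁` has cohomology `ℝ` in degree `0`, from the
identity, and `ℝ` in degree `n`, from the class of degree `n + 1` in `T₁`.
-/

namespace DiracMF

noncomputable section

/-! ### Simplices and combinations of points -/

/-- The standard simplex with `m` vertices; it is empty for `m = 0`. -/
abbrev Δ (m : ℕ) : Type := stdSimplex ℝ (Fin m)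

/-- A space in which convex combinations of finitely many points can be formed. -/
class HasComb (K : Type) [TopologicalSpace K] where
  comb : ∀ {m : ℕ}, (Fin m → K) → Δ m → K
  continuous_comb : ∀ {m : ℕ} (v : Fin m → K), Continuous (comb v)
  comb_vertex : ∀ {m : ℕ} (v : Fin m → K) (i : Fin m), comb v (stdSimplex.vertex i) = v i
  comb_map : ∀ {m m' : ℕ} (f : Fin m → Fin m') (v : Fin m' → K) (x : Δ m),
    comb v (stdSimplex.map f x) = comb (v ∘ f) x

/-- The point of `Δ q` with barycentric coordinates `∑ i, x i * v i j`. -/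
def mix {m q : ℕ} (v : Fin m → Δ q) (x : Δ m) : Δ q :=
  ⟨fun j => ∑ i, x i * v i j, fun j => Finset.sum_nonneg fun i _ =>
    mul_nonneg (stdSimplex.zero_le x i) (stdSimplex.zero_le (v i) j), by
    rw [Finset.sum_comm]
    simp only [← Finset.mul_sum, stdSimplex.sum_eq_one, mul_one]⟩

theorem mix_apply {m q : ℕ} (v : Fin m → Δ q) (x : Δ m) (j : Fin q) :
    mix v x j = ∑ i, x i * v i j := rfl

theorem simplex_ext {m : ℕ} {x y : Δ m} (h : ∀ i, x i = y i) : x = y :=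
  stdSimplex.ext (funext h)

theorem map_apply_sum {m m' : ℕ} (f : Fin m → Fin m') (x : Δ m) (g : Fin m' → ℝ) :
    ∑ j, stdSimplex.map f x j * g j = ∑ i, x i * g (f i) := by
  have h : ∀ j, stdSimplex.map f x j = ∑ i with f i = j, x i := fun j => by
    rw [stdSimplex.map_coe, FunOnFinite.linearMap_apply_apply]
  simp only [h, Finset.sum_mul]
  rw [← Finset.sum_fiberwise (s := Finset.univ) (g := f)]
  refine Finset.sum_congr rfl fun j _ => Finset.sum_congr rfl fun i hi => ?_
  rw [(Finset.mem_filter.1 hi).2]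

instance (q : ℕ) : HasComb (Δ q) where
  comb := mix
  continuous_comb v := by
    refine Continuous.subtype_mk (continuous_pi fun j => ?_) _
    refine continuous_finsetSum _ fun i _ => Continuous.mul ?_ continuous_const
    exact (continuous_apply i).comp continuous_subtype_val
  comb_vertex v i := by
    refine simplex_ext fun j => ?_
    rw [mix_apply]
    change ∑ k, (stdSimplex.vertex i : Δ _).1 k * _ = _
    simp [Pi.single_apply]
  comb_map f v x := simplex_ext fun j => map_apply_sum f x fun i => v i j

instance (K K' : Type) [TopologicalSpace K] [TopologicalSpace K'] [HasComb K] [HasComb K'] :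
    HasComb (K × K') where
  comb v x := (HasComb.comb (fun i => (v i).1) x, HasComb.comb (fun i => (v i).2) x)
  continuous_comb _ := (HasComb.continuous_comb _).prodMk (HasComb.continuous_comb _)
  comb_vertex _ i := Prod.ext (HasComb.comb_vertex _ i) (HasComb.comb_vertex _ i)
  comb_map f _ x := Prod.ext (HasComb.comb_map f _ x) (HasComb.comb_map f _ x)

/-- Maps that preserve convex combinations. -/
def PreservesComb {K K' : Type} [TopologicalSpace K] [TopologicalSpace K'] [HasComb K] [HasComb K']
    (f : K → K') : Prop :=
  ∀ (m : ℕ) (v : Fin m → K) (x : Δ m), f (HasComb.comb v x) = HasComb.comb (f ∘ v) x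

theorem preservesComb_mix {m q : ℕ} (v : Fin m → Δ q) :
    PreservesComb (HasComb.comb v) := by
  intro k w x
  refine simplex_ext fun j => ?_
  change ∑ i, (∑ l, x l * w l i) * v i j = ∑ l, x l * ∑ i, w l i * v i j
  simp only [Finset.sum_mul, Finset.mul_sum, mul_assoc]
  rw [Finset.sum_comm]

theorem PreservesComb.prodMap {K K' L L' : Type} [TopologicalSpace K] [TopologicalSpace K']
    [TopologicalSpace L] [TopologicalSpace L'] [HasComb K] [HasComb K'] [HasComb L] [HasComb L']
    {f : K → K'} {g : L → L'} (hf : PreservesComb f) (hg : PreservesComb g) :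
    PreservesComb (Prod.map f g) :=
  fun m v x => Prod.ext (hf m (fun i => (v i).1) x) (hg m (fun i => (v i).2) x)

theorem preservesComb_id {K : Type} [TopologicalSpace K] [HasComb K] :
    PreservesComb (id : K → K) := fun _ _ _ => rfl

/-- The combination of the points of a tuple with equal weights. -/
def centre {K : Type} [TopologicalSpace K] [HasComb K] {m : ℕ} (v : Fin (m + 1) → K) : K :=
  HasComb.comb v stdSimplex.barycenter

/-- The tuple of the vertices of the simplex. -/
def vert (m : ℕ) : Fin m → Δ m := fun i => stdSimplex.vertex i

theorem comb_vert {K : Type} [TopologicalSpace K] [HasComb K] {m : ℕ} (v : Fin m → K) :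
    HasComb.comb v ∘ vert m = v :=
  funext fun i => HasComb.comb_vertex v i

theorem comb_vert_eq {m : ℕ} (x : Δ m) : HasComb.comb (vert m) x = x := by
  refine simplex_ext fun j => ?_
  change ∑ i, x i * (stdSimplex.vertex i : Δ _).1 j = _
  simp [Pi.single_apply]

/-! ### Chains of tuples -/

/-- Formal combinations of `m`-tuples of points. -/
abbrev Ch (K : Type) (m : ℕ) : Type := (Fin m → K) →₀ ℝ

/-- The tuple `v` as a chain. -/
def tup {K : Type} {m : ℕ} (v : Fin m → K) : Ch K m := Finsupp.single v 1

theorem ch_ext {K : Type} {m : ℕ} {V : Type*} [AddCommGroup V] [Module ℝ V] {f g : Ch K m →ₗ[ℝ] V}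
    (h : ∀ v, f (tup v) = g (tup v)) : f = g :=
  Finsupp.lhom_ext' fun v => LinearMap.ext_ring (h v)

/-- The linear extension of a function on tuples. -/
def linExt {K : Type} {m : ℕ} {V : Type*} [AddCommGroup V] [Module ℝ V] (f : (Fin m → K) → V) :
    Ch K m →ₗ[ℝ] V := Finsupp.linearCombination ℝ f

@[simp] theorem linExt_tup {K : Type} {m : ℕ} {V : Type*} [AddCommGroup V] [Module ℝ V]
    (f : (Fin m → K) → V) (v : Fin m → K) : linExt f (tup v) = f v := by
  simp [linExt, tup]

/-- The alternating sum of the faces of a tuple. -/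
def bd (K : Type) (m : ℕ) : Ch K (m + 1) →ₗ[ℝ] Ch K m :=
  linExt fun v => ∑ i : Fin (m + 1), (-1 : ℝ) ^ (i : ℕ) • tup (v ∘ i.succAbove)

/-- Prepending the point `b` to the tuples of a chain. -/
def cone {K : Type} {m : ℕ} (b : K) : Ch K m →ₗ[ℝ] Ch K (m + 1) :=
  linExt fun v => tup (Fin.cons b v)

/-- The image of a chain under a map of the points. -/
def push {K K' : Type} (f : K → K') (m : ℕ) : Ch K m →ₗ[ℝ] Ch K' m := linExt fun v => tup (f ∘ v)

theorem bd_tup {K : Type} {m : ℕ} (v : Fin (m + 1) → K) :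
    bd K m (tup v) = ∑ i : Fin (m + 1), (-1 : ℝ) ^ (i : ℕ) • tup (v ∘ i.succAbove) :=
  linExt_tup _ _

theorem bd_cone {K : Type} {m : ℕ} (b : K) (c : Ch K (m + 1)) :
    bd K (m + 1) (cone b c) = c - cone b (bd K m c) := by
  suffices h : bd K (m + 1) ∘ₗ cone b = LinearMap.id - cone b ∘ₗ bd K m from
    LinearMap.congr_fun h c
  refine ch_ext fun v => ?_
  simp only [LinearMap.comp_apply, LinearMap.sub_apply, LinearMap.id_apply, cone, linExt_tup,
    bd_tup, map_sum, map_smul]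
  rw [Fin.sum_univ_succ]
  have h0 : (Fin.cons b v : Fin (m + 2) → K) ∘ Fin.succAbove 0 = v := by
    funext i; simp
  have h1 : ∀ i : Fin (m + 1), (Fin.cons b v : Fin (m + 2) → K) ∘ Fin.succAbove i.succ =
      Fin.cons b (v ∘ i.succAbove) := fun i => by
    funext j
    refine Fin.cases ?_ (fun j => ?_) j
    · simp
    · simp [Fin.succ_succAbove_succ]
  simp only [h0, h1, Fin.val_zero, pow_zero, one_smul, Fin.val_succ, pow_succ, mul_neg, mul_one,
    neg_smul, Finset.sum_neg_distrib]
  rw [sub_eq_add_neg]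

theorem bd_cone_zero {K : Type} (b : K) (c : Ch K 0) : bd K 0 (cone b c) = c := by
  suffices h : bd K 0 ∘ₗ cone b = LinearMap.id from LinearMap.congr_fun h c
  refine ch_ext fun v => ?_
  simp only [LinearMap.comp_apply, LinearMap.id_apply, cone, linExt_tup, bd_tup]
  simp [Subsingleton.elim _ v]

theorem bd_bd {K : Type} : ∀ {m : ℕ} (c : Ch K (m + 2)), bd K m (bd K (m + 1) c) = 0
  | m, c => by
    suffices h : bd K m ∘ₗ bd K (m + 1) = 0 from LinearMap.congr_fun h c
    refine ch_ext fun v => ?_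
    have hv : tup v = cone (v 0) (tup (Fin.tail v)) := by
      rw [cone, linExt_tup, Fin.cons_self_tail]
    rw [LinearMap.comp_apply, hv, bd_cone, map_sub, LinearMap.zero_apply]
    cases m with
    | zero => rw [bd_cone_zero, sub_self]
    | succ m => rw [bd_cone, bd_bd, map_zero, sub_zero, sub_self]

theorem push_cone {K K' : Type} (f : K → K') {m : ℕ} (b : K) (c : Ch K m) :
    push f _ (cone b c) = cone (f b) (push f _ c) := by
  suffices h : push f _ ∘ₗ cone b = cone (f b) ∘ₗ push f m from LinearMap.congr_fun h c
  refine ch_ext fun v => ?_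
  simp only [LinearMap.comp_apply, cone, push, linExt_tup]
  congr 1
  funext j
  refine Fin.cases rfl (fun j => rfl) j

theorem push_bd {K K' : Type} (f : K → K') {m : ℕ} (c : Ch K (m + 1)) :
    push f _ (bd K m c) = bd K' m (push f _ c) := by
  suffices h : push f _ ∘ₗ bd K m = bd K' m ∘ₗ push f _ from LinearMap.congr_fun h c
  refine ch_ext fun v => ?_
  simp only [LinearMap.comp_apply, push, linExt_tup, bd_tup, map_sum, map_smul]
  rfl

theorem push_tup {K K' : Type} (f : K → K') {m : ℕ} (v : Fin m → K) :
    push f m (tup v) = tup (f ∘ v) := linExt_tup _ _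

/-- A chain homotopy between the chain maps `f` and `g` in a convex target, built by coning off at
the points `c v`. -/
def homot {K K' : Type} (f g : ∀ m, Ch K m →ₗ[ℝ] Ch K' m) (c : ∀ {m}, (Fin (m + 1) → K) → K') :
    ∀ m, Ch K m →ₗ[ℝ] Ch K' (m + 1)
  | 0 => 0
  | m + 1 => linExt fun v =>
      cone (c v) (f (m + 1) (tup v) - g (m + 1) (tup v) - homot f g c m (bd K m (tup v)))

/-- The defining property of `homot`: each difference that is coned off is a cycle, by induction on
the dimension. -/
theorem bd_homot {K K' : Type} {f g : ∀ m, Ch K m →ₗ[ℝ] Ch K' m}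
    (c : ∀ {m}, (Fin (m + 1) → K) → K') (h0 : f 0 = g 0)
    (hf : ∀ m x, bd K' m (f (m + 1) x) = f m (bd K m x))
    (hg : ∀ m x, bd K' m (g (m + 1) x) = g m (bd K m x)) :
    ∀ (m : ℕ) (x : Ch K (m + 1)), bd K' (m + 1) (homot f g c (m + 1) x) =
      f (m + 1) x - g (m + 1) x - homot f g c m (bd K m x)
  | m, x => by
    suffices h : bd K' (m + 1) ∘ₗ homot f g c (m + 1) =
        f (m + 1) - g (m + 1) - homot f g c m ∘ₗ bd K m from LinearMap.congr_fun h x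
    refine ch_ext fun v => ?_
    simp only [LinearMap.comp_apply, LinearMap.sub_apply]
    have key : bd K' m (f (m + 1) (tup v) - g (m + 1) (tup v) -
        homot f g c m (bd K m (tup v))) = 0 := by
      rw [map_sub, map_sub, hf, hg]
      cases m with
      | zero => rw [h0, sub_self]; simp [homot]
      | succ m => rw [bd_homot c h0 hf hg m, bd_bd, map_zero, sub_zero, sub_self]
    rw [homot, linExt_tup, bd_cone, key, map_zero, sub_zero]

theorem push_homot {K K' L L' : Type} {f g : ∀ m, Ch K m →ₗ[ℝ] Ch K' m}
    {f' g' : ∀ m, Ch L m →ₗ[ℝ] Ch L' m} (c : ∀ {m}, (Fin (m + 1) → K) → K')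
    (c' : ∀ {m}, (Fin (m + 1) → L) → L') (φ : K → L) (ψ : K' → L')
    (hf : ∀ m x, push ψ m (f m x) = f' m (push φ m x))
    (hg : ∀ m x, push ψ m (g m x) = g' m (push φ m x))
    (hc : ∀ m (v : Fin (m + 1) → K), ψ (c v) = c' (φ ∘ v)) :
    ∀ (m : ℕ) (x : Ch K m), push ψ _ (homot f g c m x) = homot f' g' c' m (push φ m x)
  | 0, x => by simp [homot]
  | m + 1, x => by
    suffices h : push ψ _ ∘ₗ homot f g c (m + 1) = homot f' g' c' (m + 1) ∘ₗ push φ _ from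
      LinearMap.congr_fun h x
    refine ch_ext fun v => ?_
    simp only [LinearMap.comp_apply, push_tup]
    rw [homot, homot, linExt_tup, linExt_tup, push_cone, hc]
    congr 1
    rw [map_sub, map_sub, hf, hg, push_homot c c' φ ψ hf hg hc m, push_bd, push_tup]

/-! ### Barycentric subdivision -/

section Subdivision

variable {K : Type} [TopologicalSpace K] [HasComb K]

/-- Barycentric subdivision. -/
def sd (K : Type) [TopologicalSpace K] [HasComb K] : ∀ m, Ch K m →ₗ[ℝ] Ch K m
  | 0 => LinearMap.id
  | m + 1 => linExt fun v => cone (centre v) (sd K m (bd K m (tup v)))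

theorem bd_sd : ∀ (m : ℕ) (x : Ch K (m + 1)), bd K m (sd K (m + 1) x) = sd K m (bd K m x)
  | m, x => by
    suffices h : bd K m ∘ₗ sd K (m + 1) = sd K m ∘ₗ bd K m from LinearMap.congr_fun h x
    refine ch_ext fun v => ?_
    simp only [LinearMap.comp_apply]
    rw [sd, linExt_tup]
    cases m with
    | zero => rw [bd_cone_zero]
    | succ m => rw [bd_cone, bd_sd m, bd_bd, map_zero, map_zero, sub_zero]

theorem push_centre {L : Type} [TopologicalSpace L] [HasComb L] {f : K → L}
    (hf : PreservesComb f) {m : ℕ} (v : Fin (m + 1) → K) : f (centre v) = centre (f ∘ v) :=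
  hf _ v _

theorem push_sd {L : Type} [TopologicalSpace L] [HasComb L] {f : K → L} (hf : PreservesComb f) :
    ∀ (m : ℕ) (x : Ch K m), push f m (sd K m x) = sd L m (push f m x)
  | 0, x => rfl
  | m + 1, x => by
    suffices h : push f _ ∘ₗ sd K (m + 1) = sd L (m + 1) ∘ₗ push f _ from LinearMap.congr_fun h x
    refine ch_ext fun v => ?_
    simp only [LinearMap.comp_apply, push_tup]
    rw [sd, sd, linExt_tup, linExt_tup, push_cone, push_sd hf m, push_bd, push_centre hf, push_tup]

/-- The chain homotopy between the identity and barycentric subdivision. -/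
def sdHomot (K : Type) [TopologicalSpace K] [HasComb K] (m : ℕ) : Ch K m →ₗ[ℝ] Ch K (m + 1) :=
  homot (fun _ => LinearMap.id) (sd K) centre m

theorem bd_sdHomot (m : ℕ) (x : Ch K (m + 1)) :
    bd K (m + 1) (sdHomot K (m + 1) x) = x - sd K (m + 1) x - sdHomot K m (bd K m x) :=
  bd_homot (f := fun _ => LinearMap.id) (g := sd K) centre rfl (fun _ _ => rfl) bd_sd m x

theorem push_sdHomot {L : Type} [TopologicalSpace L] [HasComb L] {f : K → L}
    (hf : PreservesComb f) (m : ℕ) (x : Ch K m) :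
    push f _ (sdHomot K m x) = sdHomot L m (push f m x) :=
  push_homot centre centre f f (fun _ _ => rfl) (push_sd hf) (fun _ v => push_centre hf v) m x

end Subdivision

/-! ### Augmented singular cochains -/

/-- Augmented singular cochains, indexed by the number of vertices of the simplices. The simplex
without vertices is empty, so that the cochains of index `0` are the elements of `A`. -/
abbrev Coch (X : Type) [TopologicalSpace X] (A : Type) (m : ℕ) : Type := C(Δ m, X) → A

/-- The inclusion of the `i`-th face. -/
def face {m : ℕ} (i : Fin (m + 1)) : C(Δ m, Δ (m + 1)) :=
  ⟨stdSimplex.map i.succAbove, stdSimplex.continuous_map _⟩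

/-- The simplex spanned by a tuple of points. -/
def spanned {K : Type} [TopologicalSpace K] [HasComb K] {m : ℕ} (v : Fin m → K) : C(Δ m, K) :=
  ⟨HasComb.comb v, HasComb.continuous_comb v⟩

theorem spanned_comp_face {K : Type} [TopologicalSpace K] [HasComb K] {m : ℕ}
    (v : Fin (m + 1) → K) (i : Fin (m + 1)) :
    (spanned v).comp (face i) = spanned (v ∘ i.succAbove) :=
  ContinuousMap.ext fun x => HasComb.comb_map _ v x

theorem spanned_vert (m : ℕ) : spanned (vert m) = ContinuousMap.id (Δ m) :=
  ContinuousMap.ext fun x => comb_vert_eq x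

theorem face_eq_spanned {m : ℕ} (i : Fin (m + 1)) : face i = spanned (vert (m + 1) ∘ i.succAbove) := by
  rw [← spanned_comp_face, spanned_vert, ContinuousMap.id_comp]

section Cochains

variable {X : Type} [TopologicalSpace X] {A : Type} [AddCommGroup A] [Module ℝ A]

variable (X A) in
/-- The coboundary of augmented singular cochains. -/
def cobd (m : ℕ) : Coch X A m →ₗ[ℝ] Coch X A (m + 1) :=
  ∑ i : Fin (m + 1), (-1 : ℝ) ^ (i : ℕ) • LinearMap.funLeft ℝ A fun σ => σ.comp (face i)

theorem cobd_apply {m : ℕ} (φ : Coch X A m) (σ : C(Δ (m + 1), X)) :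
    cobd X A m φ σ = ∑ i : Fin (m + 1), (-1 : ℝ) ^ (i : ℕ) • φ (σ.comp (face i)) := by
  simp [cobd, LinearMap.funLeft]

/-- The value of a cochain on the chain of simplices `σ ∘ spanned v` given by a chain of tuples. -/
def ev {K : Type} [TopologicalSpace K] [HasComb K] {m : ℕ} (φ : Coch X A m) (σ : C(K, X)) :
    Ch K m →ₗ[ℝ] A :=
  linExt fun v => φ (σ.comp (spanned v))

section

variable {K : Type} [TopologicalSpace K] [HasComb K]

theorem ev_tup {m : ℕ} (φ : Coch X A m) (σ : C(K, X)) (v : Fin m → K) :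
    ev φ σ (tup v) = φ (σ.comp (spanned v)) := linExt_tup _ _

theorem ev_vert {m : ℕ} (φ : Coch X A m) (σ : C(Δ m, X)) : ev φ σ (tup (vert m)) = φ σ := by
  rw [ev_tup, spanned_vert, ContinuousMap.comp_id]

theorem ev_add {m : ℕ} (φ ψ : Coch X A m) (σ : C(K, X)) (c : Ch K m) :
    ev (φ + ψ) σ c = ev φ σ c + ev ψ σ c := by
  rw [← LinearMap.add_apply]
  congr 1
  exact ch_ext fun v => by simp [ev_tup]

theorem ev_smul {m : ℕ} (r : ℝ) (φ : Coch X A m) (σ : C(K, X)) (c : Ch K m) :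
    ev (r • φ) σ c = r • ev φ σ c := by
  rw [← LinearMap.smul_apply]
  congr 1
  exact ch_ext fun v => by simp [ev_tup]

theorem ev_cobd {m : ℕ} (φ : Coch X A m) (σ : C(K, X)) (c : Ch K (m + 1)) :
    ev (cobd X A m φ) σ c = ev φ σ (bd K m c) := by
  rw [← LinearMap.comp_apply]
  congr 1
  refine ch_ext fun v => ?_
  rw [LinearMap.comp_apply, ev_tup, bd_tup, map_sum, cobd_apply]
  refine Finset.sum_congr rfl fun i _ => ?_
  rw [map_smul, ev_tup, ContinuousMap.comp_assoc, spanned_comp_face]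

theorem ev_push {L : Type} [TopologicalSpace L] [HasComb L] {f : C(L, K)}
    (hf : PreservesComb f) {m : ℕ} (φ : Coch X A m) (σ : C(K, X)) (c : Ch L m) :
    ev φ (σ.comp f) c = ev φ σ (push f m c) := by
  rw [← LinearMap.comp_apply]
  congr 1
  refine ch_ext fun v => ?_
  rw [LinearMap.comp_apply, ev_tup, push_tup, ev_tup, ContinuousMap.comp_assoc]
  congr 2
  exact ContinuousMap.ext fun x => hf _ v x

end

theorem cobd_cobd {m : ℕ} (φ : Coch X A m) : cobd X A (m + 1) (cobd X A m φ) = 0 := by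
  funext σ
  rw [← ev_vert (cobd X A (m + 1) (cobd X A m φ)), ev_cobd, ev_cobd, bd_bd, map_zero]
  rfl

theorem preservesComb_face {m : ℕ} (i : Fin (m + 1)) : PreservesComb (face i) := by
  rw [face_eq_spanned]
  exact preservesComb_mix _

theorem push_face_vert {m : ℕ} (i : Fin (m + 1)) :
    push (face i) m (tup (vert m)) = tup (vert (m + 1) ∘ i.succAbove) := by
  rw [push_tup, face_eq_spanned]
  congr 1
  exact comb_vert _

/-! ### Small simplices -/

theorem mem_of_supported {K : Type} {m : ℕ} {s : Set (Fin m → K)} {V : Type*} [AddCommGroup V]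
    [Module ℝ V] (f : Ch K m →ₗ[ℝ] V) (N : Submodule ℝ V) (h : ∀ v ∈ s, f (tup v) ∈ N)
    {c : Ch K m} (hc : c ∈ Finsupp.supported ℝ ℝ s) : f c ∈ N := by
  rw [Finsupp.supported_eq_span_single] at hc
  have : Submodule.span ℝ ((fun i => Finsupp.single i (1 : ℝ)) '' s) ≤ N.comap f :=
    Submodule.span_le.2 (by rintro _ ⟨v, hv, rfl⟩; exact h v hv)
  exact this hc

theorem tup_mem_supported {K : Type} {m : ℕ} {s : Set (Fin m → K)} {v : Fin m → K} (hv : v ∈ s) :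
    tup v ∈ Finsupp.supported ℝ ℝ s :=
  Finsupp.single_mem_supported ℝ 1 hv

theorem bd_tup_mem {K : Type} {m : ℕ} {s : Set (Fin m → K)} {v : Fin (m + 1) → K}
    (h : ∀ i : Fin (m + 1), v ∘ i.succAbove ∈ s) : bd K m (tup v) ∈ Finsupp.supported ℝ ℝ s := by
  rw [bd_tup]
  exact Submodule.sum_mem _ fun i _ => Submodule.smul_mem _ _ (tup_mem_supported (h i))

/-- The chains of tuples of points of `R`. -/
def inside {K : Type} (R : Set K) (m : ℕ) : Submodule ℝ (Ch K m) :=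
  Finsupp.supported ℝ ℝ {v | ∀ i, v i ∈ R}

section Inside

variable {K : Type} {R : Set K}

theorem cone_mem_inside {b : K} (hb : b ∈ R) {m : ℕ} {c : Ch K m} (hc : c ∈ inside R m) :
    cone b c ∈ inside R (m + 1) := by
  refine mem_of_supported _ _ (fun v hv => ?_) hc
  rw [cone, linExt_tup]
  refine tup_mem_supported fun i => ?_
  refine Fin.cases ?_ (fun j => ?_) i
  · exact hb
  · exact hv j

theorem bd_mem_inside {m : ℕ} {c : Ch K (m + 1)} (hc : c ∈ inside R (m + 1)) :
    bd K m c ∈ inside R m :=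
  mem_of_supported (s := {v : Fin (m + 1) → K | ∀ i, v i ∈ R}) _ _
    (fun _ hv => bd_tup_mem (s := {v | ∀ i, v i ∈ R}) fun _ _ => hv _) hc

variable [TopologicalSpace K] [HasComb K]

theorem sd_mem_inside (hR : ∀ (m : ℕ) (v : Fin m → K), (∀ i, v i ∈ R) → ∀ x, HasComb.comb v x ∈ R) :
    ∀ (m : ℕ) {c : Ch K m}, c ∈ inside R m → sd K m c ∈ inside R m
  | 0, _, hc => hc
  | m + 1, c, hc => by
    refine mem_of_supported _ _ (fun v hv => ?_) hc
    rw [sd, linExt_tup]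
    exact cone_mem_inside (hR _ v hv _)
      (sd_mem_inside hR m (bd_mem_inside (tup_mem_supported hv)))

theorem sdHomot_mem_inside
    (hR : ∀ (m : ℕ) (v : Fin m → K), (∀ i, v i ∈ R) → ∀ x, HasComb.comb v x ∈ R) :
    ∀ (m : ℕ) {c : Ch K m}, c ∈ inside R m → sdHomot K m c ∈ inside R (m + 1)
  | 0, c, _ => by
    rw [sdHomot, homot]
    exact Submodule.zero_mem _
  | m + 1, c, hc => by
    refine mem_of_supported _ _ (fun v hv => ?_) hc
    rw [sdHomot, homot, linExt_tup]
    have h := tup_mem_supported (s := {v : Fin (m + 1) → K | ∀ i, v i ∈ R}) hv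
    exact cone_mem_inside (hR _ v hv _) (Submodule.sub_mem _ (Submodule.sub_mem _ h
      (sd_mem_inside hR _ h)) (sdHomot_mem_inside hR m (bd_mem_inside h)))

end Inside

/-- Simplices that lie in `U` or in `V`. -/
def IsSmall (U V : Set X) {B : Type} [TopologicalSpace B] (σ : C(B, X)) : Prop :=
  (∀ x, σ x ∈ U) ∨ ∀ x, σ x ∈ V

theorem IsSmall.comp {U V : Set X} {B B' : Type} [TopologicalSpace B] [TopologicalSpace B']
    {σ : C(B, X)} (h : IsSmall U V σ) (f : C(B', B)) : IsSmall U V (σ.comp f) :=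
  h.imp (fun h _ => h _) fun h _ => h _

/-- The chains of tuples that span small simplices. -/
def smallCh (U V : Set X) {q : ℕ} (σ : C(Δ q, X)) (m : ℕ) : Submodule ℝ (Ch (Δ q) m) :=
  Finsupp.supported ℝ ℝ {v | IsSmall U V (σ.comp (spanned v))}

theorem inside_le_smallCh (U V : Set X) {q m k : ℕ} (σ : C(Δ q, X)) (v : Fin m → Δ q)
    (hv : IsSmall U V (σ.comp (spanned v))) :
    inside (Set.range (HasComb.comb v)) k ≤ smallCh U V σ k := by
  refine Finsupp.supported_mono fun w hw => ?_
  choose y hy using hw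
  have h : spanned w = (spanned v).comp (spanned y) := by
    refine ContinuousMap.ext fun x => ?_
    change HasComb.comb w x = HasComb.comb v (HasComb.comb y x)
    rw [preservesComb_mix v _ y x]
    congr 1
    exact (funext hy).symm
  rw [Set.mem_ofPred_eq, h, ← ContinuousMap.comp_assoc]
  exact hv.comp _

theorem range_comb_closed {q m : ℕ} (v : Fin m → Δ q) (k : ℕ) (w : Fin k → Δ q)
    (hw : ∀ i, w i ∈ Set.range (HasComb.comb v)) (x : Δ k) :
    HasComb.comb w x ∈ Set.range (HasComb.comb v) := by
  choose y hy using hw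
  refine ⟨HasComb.comb y x, ?_⟩
  rw [preservesComb_mix v _ y x]
  congr 1
  exact funext hy

theorem tup_mem_inside_range {q m : ℕ} (v : Fin m → Δ q) :
    tup v ∈ inside (Set.range (HasComb.comb v)) m :=
  tup_mem_supported fun i => ⟨_, HasComb.comb_vertex v i⟩

theorem sd_mem_smallCh {U V : Set X} {q m : ℕ} {σ : C(Δ q, X)} {c : Ch (Δ q) m}
    (hc : c ∈ smallCh U V σ m) : sd (Δ q) m c ∈ smallCh U V σ m :=
  mem_of_supported _ _ (fun v hv => inside_le_smallCh U V σ v hv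
    (sd_mem_inside (range_comb_closed v) m (tup_mem_inside_range v))) hc

theorem sdHomot_mem_smallCh {U V : Set X} {q m : ℕ} {σ : C(Δ q, X)} {c : Ch (Δ q) m}
    (hc : c ∈ smallCh U V σ m) : sdHomot (Δ q) m c ∈ smallCh U V σ (m + 1) :=
  mem_of_supported _ _ (fun v hv => inside_le_smallCh U V σ v hv
    (sdHomot_mem_inside (range_comb_closed v) m (tup_mem_inside_range v))) hc

theorem ev_eq_zero_of_small {U V : Set X} {q m : ℕ} {σ : C(Δ q, X)} {φ : Coch X A m}
    (hφ : ∀ τ, IsSmall U V τ → φ τ = 0) {c : Ch (Δ q) m} (hc : c ∈ smallCh U V σ m) :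
    ev φ σ c = 0 := by
  refine (Submodule.mem_bot ℝ).1 (mem_of_supported _ ⊥ (fun v hv => ?_) hc)
  rw [ev_tup, hφ _ hv]
  exact Submodule.zero_mem _

/-! ### The mesh of iterated subdivisions -/

/-- The chains of tuples of points whose coordinates differ by at most `r`. -/
def meshLE (q m : ℕ) (r : ℝ) : Submodule ℝ (Ch (Δ q) m) :=
  Finsupp.supported ℝ ℝ {v | ∀ i j l, |v i l - v j l| ≤ r}

theorem abs_sub_comb_le {q m : ℕ} (v : Fin m → Δ q) (x : Δ m) (b : Δ q) (l : Fin q) (r : ℝ)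
    (h : ∀ i, |b l - v i l| ≤ r) : |b l - (HasComb.comb v x : Δ q) l| ≤ r := by
  have h1 : b l - (HasComb.comb v x : Δ q) l = ∑ i, x i * (b l - v i l) := by
    simp only [mul_sub, Finset.sum_sub_distrib, ← Finset.sum_mul, stdSimplex.sum_eq_one, one_mul]
    rfl
  rw [h1]
  calc |∑ i, x i * (b l - v i l)| ≤ ∑ i, |x i * (b l - v i l)| := Finset.abs_sum_le_sum_abs _ _
    _ ≤ ∑ i, x i * r := Finset.sum_le_sum fun i _ => by
      rw [abs_mul, abs_of_nonneg (stdSimplex.zero_le x i)]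
      exact mul_le_mul_of_nonneg_left (h i) (stdSimplex.zero_le x i)
    _ = r := by rw [← Finset.sum_mul, stdSimplex.sum_eq_one, one_mul]

theorem abs_centre_sub_le {q m : ℕ} (v : Fin (m + 1) → Δ q) {r : ℝ}
    (h : ∀ i j l, |v i l - v j l| ≤ r) (i : Fin (m + 1)) (l : Fin q) :
    |(centre v : Δ q) l - v i l| ≤ (m / (m + 1) : ℝ) * r := by
  have h1 : (centre v : Δ q) l - v i l = ∑ j, ((m : ℝ) + 1)⁻¹ * (v j l - v i l) := by
    have : (centre v : Δ q) l = ∑ j, ((m : ℝ) + 1)⁻¹ * v j l := by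
      rw [centre]
      change ∑ j, (stdSimplex.barycenter : Δ (m + 1)) j * v j l = _
      refine Finset.sum_congr rfl fun j _ => ?_
      have hb : (stdSimplex.barycenter : Δ (m + 1)) j = ((m : ℝ) + 1)⁻¹ := by
        refine (stdSimplex.barycenter_apply (𝕜 := ℝ) j).trans ?_
        simp
      rw [hb]
    rw [this]
    simp only [mul_sub, Finset.sum_sub_distrib, Finset.sum_const, Finset.card_univ, Fintype.card_fin,
      nsmul_eq_mul]
    push_cast
    rw [← mul_assoc, mul_inv_cancel₀ (by positivity), one_mul]
  rw [h1]
  calc |∑ j, ((m : ℝ) + 1)⁻¹ * (v j l - v i l)|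
      ≤ ∑ j, |((m : ℝ) + 1)⁻¹ * (v j l - v i l)| := Finset.abs_sum_le_sum_abs _ _
    _ = ∑ j ∈ Finset.univ.erase i, |((m : ℝ) + 1)⁻¹ * (v j l - v i l)| := by
      rw [← Finset.sum_erase_add _ _ (Finset.mem_univ i)]
      simp
    _ ≤ ∑ j ∈ Finset.univ.erase i, ((m : ℝ) + 1)⁻¹ * r := Finset.sum_le_sum fun j _ => by
      rw [abs_mul, abs_of_nonneg (by positivity)]
      exact mul_le_mul_of_nonneg_left (h j i l) (by positivity)
    _ = (m / (m + 1) : ℝ) * r := by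
      rw [Finset.sum_const, Finset.card_erase_of_mem (Finset.mem_univ i), Finset.card_univ,
        Fintype.card_fin, nsmul_eq_mul, Nat.add_sub_cancel]
      ring

/-- Subdivision shrinks the mesh of a simplex with at most `M + 1` vertices by the factor
`M / (M + 1)`. -/
theorem sd_tup_mem_meshLE {q M : ℕ} {r : ℝ} (hr : 0 ≤ r) : ∀ (m : ℕ) (_ : m ≤ M + 1)
    (v : Fin m → Δ q) (_ : ∀ i j l, |v i l - v j l| ≤ r),
    sd (Δ q) m (tup v) ∈ meshLE q m ((M / (M + 1) : ℝ) * r)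
  | 0, _, v, _ => tup_mem_supported fun i => i.elim0
  | m + 1, hm, v, hv => by
    rw [sd, linExt_tup]
    have h1 : sd (Δ q) m (bd (Δ q) m (tup v)) ∈ meshLE q m ((M / (M + 1) : ℝ) * r) := by
      refine mem_of_supported (s := {w : Fin m → Δ q | ∀ i j l, |w i l - w j l| ≤ r}) _ _ (fun w hw => ?_)
        (bd_tup_mem fun i j k l => hv _ _ l)
      exact sd_tup_mem_meshLE hr m (by omega) w hw
    have h2 : sd (Δ q) m (bd (Δ q) m (tup v)) ∈ inside (Set.range (HasComb.comb v)) m :=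
      sd_mem_inside (range_comb_closed v) m (bd_mem_inside (tup_mem_inside_range v))
    have h3 := Submodule.mem_inf.2 ⟨h1, h2⟩
    rw [meshLE, inside, ← Finsupp.supported_inter] at h3
    refine mem_of_supported _ _ (fun w hw => ?_) h3
    rw [cone, linExt_tup]
    have hb : ∀ i l, |(centre v : Δ q) l - w i l| ≤ (M / (M + 1) : ℝ) * r := fun i l => by
      obtain ⟨x, hx⟩ := hw.2 i
      rw [← hx]
      refine abs_sub_comb_le v x _ l _ fun i => (abs_centre_sub_le v hv i l).trans ?_
      have hmM : (m : ℝ) ≤ M := by exact_mod_cast (by omega : m ≤ M)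
      refine mul_le_mul_of_nonneg_right ?_ hr
      rw [div_le_div_iff₀ (by positivity) (by positivity)]
      nlinarith
    have hr' : 0 ≤ (M / (M + 1) : ℝ) * r := by positivity
    refine tup_mem_supported fun i j l => ?_
    refine Fin.cases ?_ (fun i => ?_) i <;> refine Fin.cases ?_ (fun j => ?_) j
    · simpa using hr'
    · exact hb j l
    · rw [abs_sub_comm]; exact hb i l
    · exact hw.1 i j l

theorem sd_iterate_mem_meshLE (q : ℕ) (j : ℕ) :
    (sd (Δ q) q)^[j] (tup (vert q)) ∈ meshLE q q ((q / (q + 1) : ℝ) ^ j) := by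
  induction j with
  | zero =>
    refine tup_mem_supported fun i j l => ?_
    rw [pow_zero, abs_le]
    have h1 := stdSimplex.zero_le (vert q i) l
    have h2 := stdSimplex.le_one (vert q i) l
    have h3 := stdSimplex.zero_le (vert q j) l
    have h4 := stdSimplex.le_one (vert q j) l
    constructor <;> linarith
  | succ j ih =>
    rw [Function.iterate_succ_apply', pow_succ']
    exact mem_of_supported _ _
      (fun v hv => sd_tup_mem_meshLE (by positivity) q (by omega) v hv) ih

/-- By the Lebesgue number lemma, sufficiently fine subdivisions of a simplex are small. -/
theorem eventually_small {U V : Set X} (hU : IsOpen U) (hV : IsOpen V) (hUV : ∀ x, x ∈ U ∨ x ∈ V)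
    {q : ℕ} (σ : C(Δ q, X)) :
    ∃ J, ∀ j, J ≤ j → (sd (Δ q) q)^[j] (tup (vert q)) ∈ smallCh U V σ q := by
  obtain ⟨δ, hδ, h⟩ := lebesgue_number_lemma_of_metric (s := (Set.univ : Set (Δ q))) (ι := Bool)
    (c := fun b => σ ⁻¹' (bif b then U else V)) isCompact_univ
    (fun b => by cases b <;> exact IsOpen.preimage σ.continuous ‹_›)
    (fun x _ => Set.mem_iUnion.2 ((hUV (σ x)).elim (fun h => ⟨true, h⟩) fun h => ⟨false, h⟩))
  have hlt : (q / (q + 1) : ℝ) < 1 := by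
    rw [div_lt_one (by positivity)]
    linarith
  obtain ⟨J, hJ⟩ := exists_pow_lt_of_lt_one hδ hlt
  refine ⟨J, fun j hj => ?_⟩
  have hj2 : (q / (q + 1) : ℝ) ^ j < δ :=
    (pow_le_pow_of_le_one (by positivity) hlt.le hj).trans_lt hJ
  refine Finsupp.supported_mono (fun v hv => ?_) (sd_iterate_mem_meshLE q j)
  rw [Set.mem_ofPred_eq] at hv ⊢
  rcases q with _ | q
  · exact Or.inl fun x => absurd (stdSimplex.sum_eq_one x) (by simp)
  have hball : ∀ x : Δ (q + 1), (HasComb.comb v x : Δ (q + 1)) ∈ Metric.ball (v 0) δ := fun x => by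
    rw [Metric.mem_ball, dist_comm, Subtype.dist_eq, dist_pi_lt_iff hδ]
    intro l
    rw [Real.dist_eq]
    exact (abs_sub_comb_le v x (v 0) l _ fun i => hv 0 i l).trans_lt hj2
  obtain ⟨b, hb⟩ := h (v 0) trivial
  cases b
  · exact Or.inr fun x => hb (hball x)
  · exact Or.inl fun x => hb (hball x)

/-- The theorem of small simplices: the complex of cochains that vanish on the simplices of an open
cover `U, V` is acyclic. -/
theorem small_exact {U V : Set X} (hU : IsOpen U) (hV : IsOpen V) (hUV : ∀ x, x ∈ U ∨ x ∈ V)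
    {m : ℕ} (φ : Coch X A (m + 1)) (hd : cobd X A (m + 1) φ = 0)
    (hφ : ∀ τ, IsSmall U V τ → φ τ = 0) :
    ∃ ψ : Coch X A m, (∀ τ, IsSmall U V τ → ψ τ = 0) ∧ cobd X A m ψ = φ := by
  choose J hJ using fun (q : ℕ) (σ : C(Δ q, X)) => eventually_small hU hV hUV σ
  -- The term of a subdivision that is already small contributes nothing.
  have hz : ∀ {q : ℕ} (σ : C(Δ q, X)) (f : C(Δ m, Δ q)), PreservesComb f → ∀ j,
      (sd (Δ m) m)^[j] (tup (vert m)) ∈ smallCh U V (σ.comp f) m →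
      ev φ (σ.comp f) (sdHomot (Δ m) m ((sd (Δ m) m)^[j] (tup (vert m)))) = 0 :=
    fun σ f _ j h => ev_eq_zero_of_small hφ (sdHomot_mem_smallCh h)
  refine ⟨fun σ => ∑ j ∈ Finset.range (J m σ),
    ev φ σ (sdHomot (Δ m) m ((sd (Δ m) m)^[j] (tup (vert m)))), fun τ hτ => ?_, funext fun σ => ?_⟩
  · refine Finset.sum_eq_zero fun j hj => ev_eq_zero_of_small hφ (sdHomot_mem_smallCh ?_)
    clear hj
    induction j with
    | zero =>
      refine tup_mem_supported ?_
      rw [Set.mem_ofPred_eq, spanned_vert]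
      exact hτ
    | succ j ih =>
      rw [Function.iterate_succ_apply']
      exact sd_mem_smallCh ih
  · rw [cobd_apply]
    obtain ⟨M, hM0, hM⟩ : ∃ M, J _ σ ≤ M ∧ ∀ i : Fin (m + 1), J _ (σ.comp (face i)) ≤ M :=
      ⟨J _ σ + ∑ i : Fin (m + 1), J _ (σ.comp (face i)), by omega, fun i =>
        (Finset.single_le_sum (f := fun i : Fin (m + 1) => J _ (σ.comp (face i)))
          (fun _ _ => Nat.zero_le _) (Finset.mem_univ i)).trans (by omega)⟩
    have hpush : ∀ (i : Fin (m + 1)) (j : ℕ),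
        push (face i) m ((sd (Δ m) m)^[j] (tup (vert m))) =
          (sd (Δ (m + 1)) m)^[j] (tup (vert (m + 1) ∘ i.succAbove)) := fun i j => by
      induction j with
      | zero => exact push_face_vert i
      | succ j ih =>
        rw [Function.iterate_succ_apply', Function.iterate_succ_apply',
          push_sd (preservesComb_face i), ih]
    have h1 : ∀ i : Fin (m + 1), ∑ j ∈ Finset.range (J m (σ.comp (face i))),
        ev φ (σ.comp (face i)) (sdHomot (Δ m) m ((sd (Δ m) m)^[j] (tup (vert m)))) =
        ∑ j ∈ Finset.range M, ev φ σ (sdHomot (Δ (m + 1)) m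
          ((sd (Δ (m + 1)) m)^[j] (tup (vert (m + 1) ∘ i.succAbove)))) := fun i => by
      rw [Finset.sum_subset (Finset.range_mono (hM i))]
      · refine Finset.sum_congr rfl fun j _ => ?_
        rw [ev_push (preservesComb_face i), push_sdHomot (preservesComb_face i), hpush]
      · intro j _ hj
        exact hz σ (face i) (preservesComb_face i) j
          (hJ m _ j (not_lt.1 fun h => hj (Finset.mem_range.2 h)))
    simp only [h1]
    -- Summation over the faces turns the faces into the boundary of the subdivided simplex.
    have hiter : ∀ (k j : ℕ) (c : Ch (Δ (m + 1)) (k + 1)),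
        bd _ k ((sd (Δ (m + 1)) (k + 1))^[j] c) = (sd (Δ (m + 1)) k)^[j] (bd _ k c) :=
      fun k j c => by
        induction j with
        | zero => rfl
        | succ j ih => rw [Function.iterate_succ_apply', Function.iterate_succ_apply', bd_sd, ih]
    have hlin : ∀ (j : ℕ) (c : Ch (Δ (m + 1)) m),
        (sd (Δ (m + 1)) m)^[j] c = ((sd (Δ (m + 1)) m) ^ j) c := fun j c => by
      rw [Module.End.pow_apply]
    have h2 : ∀ j, ∑ i : Fin (m + 1), (-1 : ℝ) ^ (i : ℕ) • ev φ σ (sdHomot (Δ (m + 1)) m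
          ((sd (Δ (m + 1)) m)^[j] (tup (vert (m + 1) ∘ i.succAbove)))) =
        ev φ σ ((sd (Δ (m + 1)) (m + 1))^[j] (tup (vert (m + 1)))) -
          ev φ σ ((sd (Δ (m + 1)) (m + 1))^[j + 1] (tup (vert (m + 1)))) := fun j => by
      have h3 : ∑ i : Fin (m + 1), (-1 : ℝ) ^ (i : ℕ) • ev φ σ (sdHomot (Δ (m + 1)) m
          ((sd (Δ (m + 1)) m)^[j] (tup (vert (m + 1) ∘ i.succAbove)))) =
          ev φ σ (sdHomot _ m ((sd (Δ (m + 1)) m)^[j] (bd _ m (tup (vert (m + 1)))))) := by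
        simp only [hlin]
        rw [bd_tup]
        simp only [map_sum, map_smul]
      have h4 := bd_sdHomot (K := Δ (m + 1)) m ((sd (Δ (m + 1)) (m + 1))^[j] (tup (vert (m + 1))))
      rw [hiter] at h4
      have h5 := congrArg (ev φ σ) h4
      rw [← ev_cobd, hd, map_sub, map_sub] at h5
      have h6 : ∀ c : Ch (Δ (m + 1)) (m + 2), ev (0 : Coch X A (m + 2)) σ c = 0 := fun c => by
        have := ev_smul (0 : ℝ) (0 : Coch X A (m + 2)) σ c
        rwa [zero_smul, zero_smul] at this
      rw [h6] at h5
      rw [h3, Function.iterate_succ_apply', ← sub_eq_zero, ← neg_eq_zero, neg_sub, ← h5]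
    simp only [Finset.smul_sum]
    rw [Finset.sum_comm]
    simp only [h2]
    rw [Finset.sum_range_sub', Function.iterate_zero_apply, ev_vert,
      ev_eq_zero_of_small hφ (hJ _ σ M hM0), sub_zero]

end Cochains

/-! ### Homotopy invariance -/

/-- Quotients `Z / B` are isomorphic when a linear map induces a bijection between them. -/
theorem nonempty_quot_equiv {C C' : Type*} [AddCommGroup C] [Module ℝ C] [AddCommGroup C']
    [Module ℝ C'] {Z B : Submodule ℝ C} {Z' B' : Submodule ℝ C'} (f : C →ₗ[ℝ] C')
    (hZ : ∀ z ∈ Z, f z ∈ Z') (hB : ∀ z ∈ Z, (f z ∈ B' ↔ z ∈ B))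
    (hs : ∀ z' ∈ Z', ∃ z ∈ Z, f z - z' ∈ B') :
    Nonempty ((Z ⧸ B.submoduleOf Z) ≃ₗ[ℝ] (Z' ⧸ B'.submoduleOf Z')) := by
  let g : Z →ₗ[ℝ] (Z' ⧸ B'.submoduleOf Z') := (B'.submoduleOf Z').mkQ ∘ₗ f.restrict hZ
  have hk : LinearMap.ker g = B.submoduleOf Z := by
    ext z
    rw [LinearMap.mem_ker, LinearMap.comp_apply, Submodule.mkQ_apply, Submodule.Quotient.mk_eq_zero]
    exact hB z z.2
  have hg : Function.Surjective g := by
    intro y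
    obtain ⟨z', rfl⟩ := Submodule.mkQ_surjective _ y
    obtain ⟨z, hz, h⟩ := hs z' z'.2
    exact ⟨⟨z, hz⟩, (Submodule.Quotient.eq _).2 h⟩
  exact ⟨(Submodule.quotEquivOfEq _ _ hk.symm).trans (g.quotKerEquivOfSurjective hg)⟩

theorem subsingleton_quot {C : Type*} [AddCommGroup C] [Module ℝ C] {Z B : Submodule ℝ C}
    (h : Z ≤ B) : Subsingleton (Z ⧸ B.submoduleOf Z) := by
  rw [Submodule.Quotient.subsingleton_iff, Submodule.submoduleOf,
    Submodule.comap_subtype_eq_top]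
  exact h

section Homotopy

variable {X Y Z : Type} [TopologicalSpace X] [TopologicalSpace Y] [TopologicalSpace Z]

/-- The pullback of augmented cochains. -/
def pull (A : Type) [AddCommGroup A] [Module ℝ A] (f : C(X, Y)) (m : ℕ) :
    Coch Y A m →ₗ[ℝ] Coch X A m :=
  LinearMap.funLeft ℝ A fun σ => f.comp σ

variable {A : Type} [AddCommGroup A] [Module ℝ A]

theorem pull_apply (f : C(X, Y)) {m : ℕ} (φ : Coch Y A m) (σ : C(Δ m, X)) :
    pull A f m φ σ = φ (f.comp σ) := rfl

theorem pull_pull (f : C(X, Y)) (g : C(Y, Z)) {m : ℕ} (φ : Coch Z A m) :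
    pull A f m (pull A g m φ) = pull A (g.comp f) m φ := rfl

theorem pull_cobd (f : C(X, Y)) {m : ℕ} (φ : Coch Y A m) :
    pull A f (m + 1) (cobd Y A m φ) = cobd X A m (pull A f m φ) := by
  funext σ
  rw [pull_apply, cobd_apply, cobd_apply]
  rfl

theorem preservesComb_prodMk {K : Type} [TopologicalSpace K] [HasComb K] {q : ℕ} (p : Δ q) :
    PreservesComb (fun x : K => (x, p)) := fun _ v x => by
  refine Prod.ext rfl (simplex_ext fun l => ?_)
  change _ = ∑ i, x i * p l
  rw [← Finset.sum_mul, stdSimplex.sum_eq_one, one_mul]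

/-- The prism chains: a chain homotopy between the two ends of the cylinder over `K`. -/
def prism (K : Type) [TopologicalSpace K] [HasComb K] {q : ℕ} (p₀ p₁ : Δ q) (m : ℕ) :
    Ch K m →ₗ[ℝ] Ch (K × Δ q) (m + 1) :=
  homot (fun m => push (fun x => (x, p₀)) m) (fun m => push (fun x => (x, p₁)) m)
    (fun v => (centre v, p₀)) m

theorem bd_prism {K : Type} [TopologicalSpace K] [HasComb K] {q : ℕ} (p₀ p₁ : Δ q) (m : ℕ)
    (x : Ch K (m + 1)) : bd _ (m + 1) (prism K p₀ p₁ (m + 1) x) =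
      push (fun x => (x, p₀)) _ x - push (fun x => (x, p₁)) _ x - prism K p₀ p₁ m (bd K m x) := by
  refine bd_homot (f := fun m => push (fun x => (x, p₀)) m) (g := fun m => push (fun x => (x, p₁)) m)
    (fun v => (centre v, p₀)) ?_ (fun m x => (push_bd _ x).symm) (fun m x => (push_bd _ x).symm) m x
  refine ch_ext fun v => ?_
  rw [push_tup, push_tup]
  congr 1
  exact funext fun i => i.elim0

theorem push_prism {K L : Type} [TopologicalSpace K] [HasComb K] [TopologicalSpace L] [HasComb L]
    {q : ℕ} (p₀ p₁ : Δ q) {f : K → L} (hf : PreservesComb f) (m : ℕ) (x : Ch K m) :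
    push (Prod.map f id) _ (prism K p₀ p₁ m x) = prism L p₀ p₁ m (push f m x) := by
  have h : ∀ (p : Δ q) (m : ℕ) (x : Ch K m), push (Prod.map f id) m (push (fun x => (x, p)) m x) =
      push (fun x => (x, p)) m (push f m x) := fun p m x => by
    rw [← LinearMap.comp_apply, ← LinearMap.comp_apply]
    congr 1
    exact ch_ext fun v => by simp only [LinearMap.comp_apply, push_tup]; rfl
  exact push_homot (fun v => (centre v, p₀)) (fun v => (centre v, p₀)) f (Prod.map f id) (h p₀)
    (h p₁) (fun _ v => Prod.ext (push_centre hf v) rfl) m x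

/-- Homotopic maps induce cochain homotopic maps on augmented cochains. -/
theorem exists_cochain_homotopy (A : Type) [AddCommGroup A] [Module ℝ A] {f g : C(X, Y)}
    (H : f.Homotopic g) : ∃ P : ∀ m, Coch Y A (m + 1) →ₗ[ℝ] Coch X A m, P 0 = 0 ∧
      ∀ (m : ℕ) (φ : Coch Y A (m + 1)),
        P (m + 1) (cobd Y A (m + 1) φ) + cobd X A m (P m φ) =
          pull A f (m + 1) φ - pull A g (m + 1) φ := by
  obtain ⟨H⟩ := H
  let θ : Δ 2 ≃ₜ unitInterval := stdSimplexHomeomorphUnitInterval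
  let p₀ : Δ 2 := θ.symm 0
  let p₁ : Δ 2 := θ.symm 1
  let cyl : ∀ m, C(Δ m, X) → C(Δ m × Δ 2, Y) := fun m σ =>
    ⟨fun y => H (θ y.2, σ y.1), by fun_prop⟩
  let P : ∀ m, Coch Y A (m + 1) →ₗ[ℝ] Coch X A m := fun m =>
    { toFun := fun φ σ => ev φ (cyl m σ) (prism (Δ m) p₀ p₁ m (tup (vert m)))
      map_add' := fun φ ψ => funext fun σ => ev_add φ ψ _ _
      map_smul' := fun r φ => funext fun σ => ev_smul r φ _ _ }
  refine ⟨P, LinearMap.ext fun φ => funext fun σ => ?_, fun m φ => funext fun σ => ?_⟩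
  · change ev φ (cyl 0 σ) (prism (Δ 0) p₀ p₁ 0 (tup (vert 0))) = 0
    rw [prism, homot, LinearMap.zero_apply, map_zero]
  have hend : ∀ (p : Δ 2) (k : C(X, Y)), (∀ x, H (θ p, x) = k x) →
      ev φ (cyl (m + 1) σ) (push (fun x => (x, p)) _ (tup (vert (m + 1)))) =
        pull A k (m + 1) φ σ := fun p k hk => by
    have := ev_push (L := Δ (m + 1)) (K := Δ (m + 1) × Δ 2)
      (f := ⟨fun x : Δ (m + 1) => (x, p), by fun_prop⟩) (preservesComb_prodMk (K := Δ (m + 1)) p) φ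
      (cyl (m + 1) σ) (tup (vert (m + 1)))
    refine this.symm.trans ?_
    rw [ev_vert, pull_apply]
    congr 1
    exact ContinuousMap.ext fun x => hk (σ x)
  have h1 : P (m + 1) (cobd Y A (m + 1) φ) σ = pull A f (m + 1) φ σ - pull A g (m + 1) φ σ -
      ev φ (cyl (m + 1) σ) (prism _ p₀ p₁ m (bd _ m (tup (vert (m + 1))))) := by
    change ev (cobd Y A (m + 1) φ) _ _ = _
    rw [ev_cobd, bd_prism, map_sub, map_sub, hend p₀ f, hend p₁ g]
    · intro x; simp [p₁]
    · intro x; simp [p₀]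
  have h2 : cobd X A m (P m φ) σ =
      ev φ (cyl (m + 1) σ) (prism _ p₀ p₁ m (bd _ m (tup (vert (m + 1))))) := by
    rw [cobd_apply, bd_tup]
    simp only [map_sum, map_smul]
    refine Finset.sum_congr rfl fun i _ => ?_
    congr 1
    rw [← push_face_vert, ← push_prism p₀ p₁ (preservesComb_face i)]
    change ev φ ((cyl (m + 1) σ).comp ((face i).prodMap (ContinuousMap.id _))) _ = _
    exact ev_push (f := (face i).prodMap (ContinuousMap.id _))
      (PreservesComb.prodMap (preservesComb_face i) preservesComb_id) φ (cyl (m + 1) σ) _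
  rw [Pi.add_apply, h1, h2, sub_add_cancel, Pi.sub_apply]

/-! ### Reduced cohomology -/

variable (X A) in
/-- The coboundaries among the augmented cochains. -/
def redBd (m : ℕ) : Submodule ℝ (Coch X A m) :=
  match m with
  | 0 => ⊥
  | m + 1 => LinearMap.range (cobd X A m)

variable (X A) in
/-- The cohomology of the augmented cochains, i.e. reduced cohomology, in the degree shifted
by one. -/
abbrev RH (m : ℕ) : Type :=
  LinearMap.ker (cobd X A m) ⧸ (redBd X A m).submoduleOf (LinearMap.ker (cobd X A m))

theorem cobd_mem_redBd {m : ℕ} (φ : Coch X A m) : cobd X A m φ ∈ redBd X A (m + 1) := ⟨φ, rfl⟩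

theorem pull_mem_redBd (f : C(X, Y)) {m : ℕ} {φ : Coch Y A m} (h : φ ∈ redBd Y A m) :
    pull A f m φ ∈ redBd X A m := by
  cases m with
  | zero =>
    rw [(Submodule.mem_bot ℝ).1 h, map_zero]
    exact Submodule.zero_mem _
  | succ m =>
    obtain ⟨ψ, rfl⟩ := h
    rw [pull_cobd]
    exact cobd_mem_redBd _

theorem pull_sub_mem_redBd {f g : C(X, Y)} (H : f.Homotopic g) {m : ℕ} {φ : Coch Y A m}
    (h : cobd Y A m φ = 0) : pull A f m φ - pull A g m φ ∈ redBd X A m := by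
  cases m with
  | zero =>
    have : pull A f 0 φ - pull A g 0 φ = 0 := funext fun σ => by
      rw [Pi.sub_apply, pull_apply, pull_apply]
      refine sub_eq_zero.2 (congrArg φ ?_)
      exact ContinuousMap.ext fun x => absurd (stdSimplex.sum_eq_one x) (by simp)
    rw [this]
    exact Submodule.zero_mem _
  | succ m =>
    obtain ⟨P, -, hP⟩ := exists_cochain_homotopy A H
    have := hP m φ
    rw [h, map_zero, zero_add] at this
    exact ⟨_, this⟩

theorem pull_id {m : ℕ} (φ : Coch X A m) : pull A (ContinuousMap.id X) m φ = φ := rfl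

/-- Reduced cohomology is invariant under homotopy equivalences. -/
theorem nonempty_RH_equiv (e : ContinuousMap.HomotopyEquiv X Y) (m : ℕ) :
    Nonempty (RH Y A m ≃ₗ[ℝ] RH X A m) := by
  have hk : ∀ {X Y : Type} [TopologicalSpace X] [TopologicalSpace Y] (f : C(X, Y)),
      ∀ φ ∈ LinearMap.ker (cobd Y A m), pull A f m φ ∈ LinearMap.ker (cobd X A m) :=
    fun f φ hφ => by
      rw [LinearMap.mem_ker] at *
      rw [← pull_cobd, hφ, map_zero]
  refine nonempty_quot_equiv (pull A e.toFun m) (hk e.toFun)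
    (fun φ hφ => ⟨fun h => ?_, pull_mem_redBd _⟩) fun φ hφ =>
      ⟨pull A e.invFun m φ, hk e.invFun φ hφ, ?_⟩
  · have h1 := pull_mem_redBd e.invFun h
    have h2 := pull_sub_mem_redBd e.right_inv hφ
    rw [pull_pull] at h1
    have := Submodule.sub_mem _ h1 h2
    rwa [sub_sub_cancel] at this
  · exact pull_sub_mem_redBd e.left_inv hφ

variable (X A) in
/-- Contracting homotopies of the augmented cochain complex. -/
def IsAcyclic : Prop :=
  ∃ h : ∀ m, Coch X A (m + 1) →ₗ[ℝ] Coch X A m,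
    (∀ φ : Coch X A 0, h 0 (cobd X A 0 φ) = φ) ∧
      ∀ (m : ℕ) (φ : Coch X A (m + 1)),
        h (m + 1) (cobd X A (m + 1) φ) + cobd X A m (h m φ) = φ

theorem sum_neg_one_pow (A : Type) [AddCommGroup A] [Module ℝ A] (m : ℕ) (a : A) :
    ∑ i : Fin m, (-1 : ℝ) ^ (i : ℕ) • a = if Even m then 0 else a := by
  rw [← Finset.sum_smul, Fin.sum_univ_eq_sum_range (fun i => (-1 : ℝ) ^ i), neg_one_geom_sum]
  split_ifs <;> simp

/-- The augmentation makes the constant cochains contractible, since the simplex without vertices is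
part of the complex. -/
theorem isAcyclic_of_contractible (p : X)
    (H : (ContinuousMap.id X).Homotopic (ContinuousMap.const X p)) : IsAcyclic X A := by
  obtain ⟨P, hP0, hP⟩ := exists_cochain_homotopy A H
  let q : ∀ m, Coch X A (m + 1) →ₗ[ℝ] Coch X A m := fun m =>
    LinearMap.funLeft ℝ A fun _ => ContinuousMap.const _ p
  have hq : ∀ m (φ : Coch X A (m + 1)) σ, q m φ σ = φ (ContinuousMap.const _ p) :=
    fun _ _ _ => rfl
  have hc : ∀ m (φ : Coch X A m), cobd X A m φ (ContinuousMap.const _ p) =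
      if Even m then φ (ContinuousMap.const _ p) else 0 := fun m φ => by
    rw [cobd_apply]
    simp only [ContinuousMap.const_comp]
    rw [sum_neg_one_pow]
    by_cases h : Even m <;> simp [h, Nat.even_add_one]
  have h0 : ∀ (φ : Coch X A 0) (σ τ : C(Δ 0, X)), φ σ = φ τ := fun φ σ τ => by
    congr 1
    exact ContinuousMap.ext fun x => absurd (stdSimplex.sum_eq_one x) (by simp)
  refine ⟨fun m => P m + q m, fun φ => funext fun σ => ?_, fun m φ => ?_⟩
  · change (P 0 + q 0) _ σ = _
    rw [hP0]
    refine (zero_add (q 0 _ σ)).trans ?_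
    rw [hq, hc, if_pos Even.zero]
    exact h0 φ _ _
  · have hqq : q (m + 1) (cobd X A (m + 1) φ) + cobd X A m (q m φ) =
        pull A (ContinuousMap.const X p) (m + 1) φ := by
      funext σ
      rw [Pi.add_apply, hq, hc, cobd_apply]
      simp only [hq]
      rw [sum_neg_one_pow, pull_apply, ContinuousMap.const_comp]
      split_ifs <;> simp
    have hPm := hP m φ
    rw [pull_id] at hPm
    rw [LinearMap.add_apply, LinearMap.add_apply, map_add, add_add_add_comm, hPm, hqq,
      sub_add_cancel]

end Homotopy

/-! ### The Mayer-Vietoris isomorphism -/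

section MayerVietoris

variable {X : Type} [TopologicalSpace X] {A : Type} [AddCommGroup A] [Module ℝ A]

/-- The inclusion of a subspace. -/
def incl (U : Set X) : C(U, X) := ⟨Subtype.val, continuous_subtype_val⟩

/-- The inclusion of a smaller subspace. -/
def inclLE {U V : Set X} (h : U ⊆ V) : C(U, V) := ⟨Set.inclusion h, continuous_inclusion h⟩

/-- A map with values in `U`, as a map to `U`. -/
def codRes {U : Set X} {B : Type} [TopologicalSpace B] (σ : C(B, X)) (h : ∀ x, σ x ∈ U) : C(B, U) :=
  ⟨fun x => ⟨σ x, h x⟩, σ.continuous.subtype_mk h⟩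

open Classical in
/-- The extension by zero of a cochain on a subspace. -/
def ext (U : Set X) {m : ℕ} (φ : Coch U A m) : Coch X A m := fun σ =>
  if h : ∀ x, σ x ∈ U then φ (codRes σ h) else 0

theorem pull_ext (U : Set X) {m : ℕ} (φ : Coch U A m) : pull A (incl U) m (ext U φ) = φ := by
  funext σ
  rw [pull_apply, ext, dif_pos (show ∀ x, (incl U).comp σ x ∈ U from fun x => (σ x).2)]
  rfl

theorem eq_zero_of_isSmall {U V : Set X} {m : ℕ} {φ : Coch X A m}
    (hU : pull A (incl U) m φ = 0) (hV : pull A (incl V) m φ = 0) (τ : C(Δ m, X))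
    (h : IsSmall U V τ) : φ τ = 0 := by
  rcases h with h | h
  · exact congrFun hU (codRes τ h)
  · exact congrFun hV (codRes τ h)

theorem pull_eq_zero_left {U V : Set X} {m : ℕ} {φ : Coch X A m}
    (h : ∀ τ, IsSmall U V τ → φ τ = 0) : pull A (incl U) m φ = 0 :=
  funext fun σ => h _ (Or.inl fun x => (σ x).2)

theorem pull_eq_zero_right {U V : Set X} {m : ℕ} {φ : Coch X A m}
    (h : ∀ τ, IsSmall U V τ → φ τ = 0) : pull A (incl V) m φ = 0 :=
  funext fun σ => h _ (Or.inr fun x => (σ x).2)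

open Classical in
theorem exists_glue {U V : Set X} {m : ℕ} (α : Coch U A m) (β : Coch V A m)
    (h : pull A (inclLE (Set.inter_subset_left (s := U) (t := V))) m α =
      pull A (inclLE Set.inter_subset_right) m β) :
    ∃ ψ : Coch X A m, pull A (incl U) m ψ = α ∧ pull A (incl V) m ψ = β := by
  refine ⟨fun σ => if hσ : ∀ x, σ x ∈ U then α (codRes σ hσ) else ext V β σ,
    funext fun σ => ?_, funext fun σ => ?_⟩
  · rw [pull_apply, dif_pos (show ∀ x, (incl U).comp σ x ∈ U from fun x => (σ x).2)]
    rfl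
  · have hV : ∀ x, (incl V).comp σ x ∈ V := fun x => (σ x).2
    rw [pull_apply]
    split_ifs with hU
    · exact congrFun h (codRes ((incl V).comp σ) fun x => ⟨hU x, hV x⟩)
    · rw [ext, dif_pos hV]
      rfl

/-- The Mayer-Vietoris isomorphism for a cover by two open sets with contractible cochains. -/
theorem mayerVietoris {U V : Set X} (hUo : IsOpen U) (hVo : IsOpen V)
    (hUV : ∀ x, x ∈ U ∨ x ∈ V) (hU : IsAcyclic U A) (hV : IsAcyclic V A) (m : ℕ) :
    Nonempty (RH X A (m + 1) ≃ₗ[ℝ] RH ↥(U ∩ V) A m) := by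
  obtain ⟨h, h0, h1⟩ := hU
  obtain ⟨k, k0, k1⟩ := hV
  let iU : C(↥(U ∩ V), U) := inclLE Set.inter_subset_left
  let iV : C(↥(U ∩ V), V) := inclLE Set.inter_subset_right
  have hcomp : ∀ {m} (φ : Coch X A m),
      pull A iU m (pull A (incl U) m φ) = pull A iV m (pull A (incl V) m φ) := fun φ => rfl
  have hcompU : ∀ {m} (φ : Coch X A m),
      pull A iU m (pull A (incl U) m φ) = pull A (incl (U ∩ V)) m φ := fun φ => rfl
  -- The homotopies are inverse to the coboundary up to coboundaries, and invert it on cocycles.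
  have hcoc : ∀ {W : Set X} (l : ∀ m, Coch W A (m + 1) →ₗ[ℝ] Coch W A m),
      (∀ (m : ℕ) (φ : Coch W A (m + 1)),
        l (m + 1) (cobd W A (m + 1) φ) + cobd W A m (l m φ) = φ) →
      ∀ {m} (φ : Coch W A (m + 1)), cobd W A (m + 1) φ = 0 → cobd W A m (l m φ) = φ :=
    fun l hl m φ hφ => by
      have := hl m φ
      rwa [hφ, map_zero, zero_add] at this
  have hex : ∀ {W : Set X} (l : ∀ m, Coch W A (m + 1) →ₗ[ℝ] Coch W A m),
      (∀ φ : Coch W A 0, l 0 (cobd W A 0 φ) = φ) →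
      (∀ (m : ℕ) (φ : Coch W A (m + 1)),
        l (m + 1) (cobd W A (m + 1) φ) + cobd W A m (l m φ) = φ) →
      ∀ {m} (φ : Coch W A m), l m (cobd W A m φ) - φ ∈ redBd W A m := fun l hl0 hl m φ => by
    cases m with
    | zero => rw [hl0, sub_self]; exact Submodule.zero_mem _
    | succ m =>
      have := hl m φ
      rw [← eq_sub_iff_add_eq] at this
      rw [this, sub_sub_cancel_left]
      exact Submodule.neg_mem _ (cobd_mem_redBd _)
  let δ : Coch X A (m + 1) →ₗ[ℝ] Coch ↥(U ∩ V) A m :=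
    pull A iU m ∘ₗ h m ∘ₗ pull A (incl U) (m + 1) - pull A iV m ∘ₗ k m ∘ₗ pull A (incl V) (m + 1)
  have hδ : ∀ φ, δ φ = pull A iU m (h m (pull A (incl U) (m + 1) φ)) -
      pull A iV m (k m (pull A (incl V) (m + 1) φ)) := fun φ => rfl
  refine nonempty_quot_equiv δ (fun φ hφ => ?_) (fun φ hφ => ⟨fun hB => ?_, ?_⟩) fun χ hχ => ?_
  · rw [LinearMap.mem_ker] at *
    rw [hδ, map_sub, ← pull_cobd, ← pull_cobd, hcoc h h1, hcoc k k1, hcomp, sub_self]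
    · rw [← pull_cobd, hφ, map_zero]
    · rw [← pull_cobd, hφ, map_zero]
  · rw [LinearMap.mem_ker] at hφ
    have hαU : cobd U A m (h m (pull A (incl U) (m + 1) φ)) = pull A (incl U) (m + 1) φ :=
      hcoc h h1 _ (by rw [← pull_cobd, hφ, map_zero])
    have hβV : cobd V A m (k m (pull A (incl V) (m + 1) φ)) = pull A (incl V) (m + 1) φ :=
      hcoc k k1 _ (by rw [← pull_cobd, hφ, map_zero])
    -- A primitive on `U` is corrected so that it agrees with the primitive on `V`.
    obtain ⟨α, hα, hαβ⟩ : ∃ α : Coch U A m, cobd U A m α = pull A (incl U) (m + 1) φ ∧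
        pull A iU m α = pull A iV m (k m (pull A (incl V) (m + 1) φ)) := by
      cases m with
      | zero =>
        refine ⟨_, hαU, ?_⟩
        rw [← sub_eq_zero, ← hδ]
        exact (Submodule.mem_bot ℝ).1 hB
      | succ m =>
        obtain ⟨γ, hγ⟩ := hB
        refine ⟨h (m + 1) (pull A (incl U) (m + 2) φ) -
          cobd U A m (pull A (incl U) m (ext (U ∩ V) γ)), ?_, ?_⟩
        · rw [map_sub, cobd_cobd, sub_zero, hαU]
        · rw [map_sub, pull_cobd, hcompU, pull_ext, hγ, hδ, sub_sub_cancel]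
    obtain ⟨ψ, hψU, hψV⟩ := exists_glue α (k m (pull A (incl V) (m + 1) φ)) hαβ
    obtain ⟨ψ', -, hψ'⟩ := small_exact hUo hVo hUV (φ - cobd X A m ψ)
      (by rw [map_sub, hφ, cobd_cobd, sub_zero])
      (eq_zero_of_isSmall (by rw [map_sub, pull_cobd, hψU, hα, sub_self])
        (by rw [map_sub, pull_cobd, hψV, hβV, sub_self]))
    exact ⟨ψ' + ψ, by rw [map_add, hψ', sub_add_cancel]⟩
  · rintro ⟨ψ, rfl⟩
    rw [hδ, pull_cobd, pull_cobd]
    have e1 := pull_mem_redBd iU (hex h h0 h1 (pull A (incl U) m ψ))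
    have e2 := pull_mem_redBd iV (hex k k0 k1 (pull A (incl V) m ψ))
    have := Submodule.sub_mem _ e1 e2
    rwa [map_sub, map_sub, hcomp, sub_sub_sub_cancel_right] at this
  · rw [LinearMap.mem_ker] at hχ
    set α : Coch U A m := pull A (incl U) m (ext (U ∩ V) χ) with hα
    have hαχ : pull A iU m α = χ := by rw [hα, hcompU, pull_ext]
    obtain ⟨φ₀, hφU, hφV⟩ := exists_glue (cobd U A m α) (0 : Coch V A (m + 1)) (by
      change pull A iU (m + 1) _ = pull A iV (m + 1) 0
      rw [pull_cobd, hαχ, hχ, map_zero])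
    obtain ⟨η, hη, hη'⟩ := small_exact hUo hVo hUV (cobd X A (m + 1) φ₀) (cobd_cobd _)
      (eq_zero_of_isSmall (by rw [pull_cobd, hφU, cobd_cobd]) (by rw [pull_cobd, hφV, map_zero]))
    refine ⟨φ₀ - η, by rw [LinearMap.mem_ker, map_sub, hη', sub_self], ?_⟩
    rw [hδ, map_sub (pull A (incl U) (m + 1)), map_sub (pull A (incl V) (m + 1)), hφU, hφV,
      pull_eq_zero_left hη, pull_eq_zero_right hη, sub_zero, sub_zero, map_zero, map_zero, sub_zero]
    have := pull_mem_redBd iU (hex h h0 h1 α)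
    rwa [map_sub, hαχ] at this

end MayerVietoris

/-! ### Spheres -/

section Sphere

variable (A : Type) [AddCommGroup A] [Module ℝ A]

/-- The complement of the origin in `ℝᴺ`. -/
abbrev Punctured (N : ℕ) : Type := {x : Fin N → ℝ // x ≠ 0}

/-- The complement in `ℝᴺ⁺¹` of a closed ray in the direction of the first axis; the sign `s`
chooses the ray. -/
def rayCompl (N : ℕ) (s : ℝ) : Set (Punctured (N + 1)) :=
  {x | (∀ i : Fin N, x.1 i.succ = 0) → 0 < s * x.1 0}

theorem continuous_coord {N : ℕ} (i : Fin N) : Continuous fun x : Punctured N => x.1 i :=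
  (continuous_apply i).comp continuous_subtype_val

theorem isOpen_rayCompl (N : ℕ) (s : ℝ) : IsOpen (rayCompl N s) := by
  have h : rayCompl N s = {x | ∀ i : Fin N, x.1 i.succ = 0}ᶜ ∪ {x | 0 < s * x.1 0} := by
    ext x
    exact imp_iff_not_or
  rw [h]
  refine IsOpen.union (IsClosed.isOpen_compl (self := ?_)) ?_
  · rw [Set.ofPred_forall]
    exact isClosed_iInter fun i => isClosed_eq (continuous_coord _) continuous_const
  · exact isOpen_lt continuous_const (continuous_const.mul (continuous_coord _))

theorem isAcyclic_rayCompl (N : ℕ) (s : ℝ) (hs : s ≠ 0) : IsAcyclic (rayCompl N s) A := by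
  let p : Fin (N + 1) → ℝ := Fin.cons s 0
  have hp0 : p 0 = s := rfl
  have hps : ∀ i : Fin N, p i.succ = 0 := fun i => rfl
  have hs2 : 0 < s * s := mul_self_pos.2 hs
  have hp : p ≠ 0 := fun h => hs (congrFun h 0)
  have hray : ∀ (x : rayCompl N s) (t : unitInterval),
      (∀ i : Fin N, ((1 - (t : ℝ)) • x.1.1 + (t : ℝ) • p) i.succ = 0) →
        0 < s * ((1 - (t : ℝ)) • x.1.1 + (t : ℝ) • p) 0 := fun x t h => by
    simp only [Pi.add_apply, Pi.smul_apply, smul_eq_mul, hp0, hps, mul_zero, add_zero] at h ⊢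
    rcases eq_or_lt_of_le (sub_nonneg.2 t.2.2) with h1 | h1
    · have : (t : ℝ) = 1 := by linarith
      rw [this]; linarith
    · have h2 : 0 < s * x.1.1 0 := x.2 fun i => by
        rcases mul_eq_zero.1 (h i) with h3 | h3
        · exact absurd h3 h1.ne'
        · exact h3
      have h3 : 0 ≤ (t : ℝ) := t.2.1
      have h4 := mul_pos h1 h2
      have h5 := mul_nonneg h3 hs2.le
      nlinarith
  have hne : ∀ (x : rayCompl N s) (t : unitInterval),
      ((1 - (t : ℝ)) • x.1.1 + (t : ℝ) • p) ≠ 0 := fun x t h => by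
    have := hray x t fun i => congrFun h i.succ
    rw [h] at this
    simp at this
  refine isAcyclic_of_contractible ⟨⟨p, hp⟩, fun _ => hs2⟩ ⟨⟨⟨fun y =>
    ⟨⟨(1 - (y.1 : ℝ)) • y.2.1.1 + (y.1 : ℝ) • p, hne y.2 y.1⟩, hray y.2 y.1⟩, ?_⟩, ?_, ?_⟩⟩
  · fun_prop
  · intro x
    refine Subtype.ext (Subtype.ext ?_)
    simp
  · intro x
    refine Subtype.ext (Subtype.ext ?_)
    simp

/-- Projection along the first axis. -/
def rayInterEquiv (N : ℕ) :
    ContinuousMap.HomotopyEquiv ↥(rayCompl N 1 ∩ rayCompl N (-1)) (Punctured N) := by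
  have h : ∀ x ∈ rayCompl N 1 ∩ rayCompl N (-1), Fin.tail x.1 ≠ 0 := fun x hx h0 => by
    have h1 := hx.1 fun i => congrFun h0 i
    have h2 := hx.2 fun i => congrFun h0 i
    linarith
  have h' : ∀ (a : ℝ) (y : Fin N → ℝ), y ≠ 0 → (Fin.cons a y : Fin (N + 1) → ℝ) ≠ 0 :=
    fun a y hy h0 => hy (funext fun i => congrFun h0 i.succ)
  have h'' : ∀ (a : ℝ) (y : Fin N → ℝ) (hy : y ≠ 0),
      (⟨Fin.cons a y, h' a y hy⟩ : Punctured (N + 1)) ∈ rayCompl N 1 ∩ rayCompl N (-1) :=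
    fun a y hy => ⟨fun h0 => absurd (funext h0) hy, fun h0 => absurd (funext h0) hy⟩
  exact
    { toFun := ⟨fun x => ⟨Fin.tail x.1.1, h _ x.2⟩, by
        exact Continuous.subtype_mk (continuous_pi fun i : Fin N =>
          (continuous_coord i.succ).comp continuous_subtype_val) _⟩
      invFun := ⟨fun y => ⟨⟨Fin.cons 0 y.1, h' _ _ y.2⟩, h'' _ _ y.2⟩, by
        refine Continuous.subtype_mk (Continuous.subtype_mk (continuous_pi fun i => ?_) _) _
        refine Fin.cases ?_ (fun i => ?_) i
        · exact continuous_const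
        · exact continuous_coord i⟩
      left_inv := ⟨⟨⟨fun y => ⟨⟨Fin.cons ((y.1 : ℝ) * y.2.1.1 0) (Fin.tail y.2.1.1),
          h' _ _ (h _ y.2.2)⟩, h'' _ _ (h _ y.2.2)⟩, by
        refine Continuous.subtype_mk (Continuous.subtype_mk (continuous_pi fun i => ?_) _) _
        have hc : ∀ i, Continuous fun y : unitInterval × ↥(rayCompl N 1 ∩ rayCompl N (-1)) =>
            y.2.1.1 i := fun i =>
          (continuous_coord i).comp (continuous_subtype_val.comp continuous_snd)
        refine Fin.cases ?_ (fun i => ?_) i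
        · exact (continuous_subtype_val.comp continuous_fst).mul (hc 0)
        · exact hc i.succ⟩, fun x => by
        refine Subtype.ext (Subtype.ext ?_)
        simp
        rfl, fun x => by
        refine Subtype.ext (Subtype.ext ?_)
        simp⟩⟩
      right_inv := by
        convert! ContinuousMap.Homotopic.refl (ContinuousMap.id (Punctured N)) }

theorem subsingleton_RH_zero {X : Type} [TopologicalSpace X] [Nonempty X] :
    Subsingleton (RH X A 0) := by
  refine subsingleton_quot fun φ hφ => ?_
  rw [LinearMap.mem_ker] at hφ
  refine (Submodule.mem_bot ℝ).2 (funext fun σ => ?_)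
  have p : X := Classical.arbitrary X
  have h := congrFun hφ (ContinuousMap.const _ p)
  rw [cobd_apply, Fin.sum_univ_one, Fin.val_zero, pow_zero, one_smul] at h
  rw [Pi.zero_apply] at h ⊢
  rw [← h]
  congr 1
  exact ContinuousMap.ext fun x => absurd (stdSimplex.sum_eq_one x) (by simp)

/-- The reduced cohomology of `ℝᴺ ∖ 0`. -/
theorem RH_punctured (N : ℕ) : Nonempty (RH (Punctured N) A N ≃ₗ[ℝ] A) ∧
    ∀ m, m ≠ N → Subsingleton (RH (Punctured N) A m) := by
  induction N with
  | zero =>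
    have hE : IsEmpty (Punctured 0) := ⟨fun x => x.2 (Subsingleton.elim _ _)⟩
    have hC : ∀ m, IsEmpty C(Δ (m + 1), Punctured 0) := fun m =>
      ⟨fun σ => hE.false (σ (stdSimplex.vertex 0))⟩
    constructor
    · have : Unique C(Δ 0, Punctured 0) :=
        { default := ⟨fun x => absurd (stdSimplex.sum_eq_one x) (by simp),
            continuous_iff_continuousAt.2 fun x => absurd (stdSimplex.sum_eq_one x) (by simp)⟩
          uniq := fun σ => ContinuousMap.ext fun x => absurd (stdSimplex.sum_eq_one x) (by simp) }
      have hk : LinearMap.ker (cobd (Punctured 0) A 0) = ⊤ :=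
        top_unique fun φ _ => LinearMap.mem_ker.2 (funext fun σ => ((hC 0).false σ).elim)
      have hb : (redBd (Punctured 0) A 0).submoduleOf (LinearMap.ker (cobd (Punctured 0) A 0)) =
          ⊥ := by
        rw [Submodule.submoduleOf]
        exact Submodule.ker_subtype _
      exact ⟨(Submodule.quotEquivOfEqBot _ hb).trans ((LinearEquiv.ofTop _ hk).trans
        (LinearEquiv.funUnique _ ℝ A))⟩
    · intro m hm
      obtain ⟨m, rfl⟩ := Nat.exists_eq_succ_of_ne_zero hm
      exact subsingleton_quot fun φ _ => by
        rw [show φ = 0 from funext fun σ => ((hC m).false σ).elim]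
        exact Submodule.zero_mem _
  | succ N ih =>
    have hMV : ∀ m, Nonempty (RH (Punctured (N + 1)) A (m + 1) ≃ₗ[ℝ] RH (Punctured N) A m) :=
      fun m => by
        obtain ⟨e⟩ := mayerVietoris (isOpen_rayCompl N 1) (isOpen_rayCompl N (-1)) (fun x => by
          by_contra! h
          simp only [rayCompl, Set.mem_ofPred_eq, Classical.not_imp] at h
          refine x.2 (funext fun i => ?_)
          refine Fin.cases ?_ (fun i => ?_) i
          · have h1 := h.1.2
            have h2 := h.2.2
            exact le_antisymm (by rw [Pi.zero_apply]; linarith) (by rw [Pi.zero_apply]; linarith)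
          · exact h.1.1 i) (isAcyclic_rayCompl A N 1 one_ne_zero)
          (isAcyclic_rayCompl A N (-1) (by norm_num)) m
        obtain ⟨e'⟩ := nonempty_RH_equiv (A := A) (rayInterEquiv N) m
        exact ⟨e.trans e'.symm⟩
    refine ⟨?_, fun m hm => ?_⟩
    · obtain ⟨e⟩ := hMV N
      obtain ⟨e'⟩ := ih.1
      exact ⟨e.trans e'⟩
    · cases m with
      | zero =>
        have : Nonempty (Punctured (N + 1)) := ⟨⟨1, one_ne_zero⟩⟩
        exact subsingleton_RH_zero A
      | succ m =>
        obtain ⟨e⟩ := hMV m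
        have := ih.2 m (by omega)
        exact e.toEquiv.subsingleton

end Sphere

/-! ### Singular cohomology and augmented cochains -/

/-- A quotient `Z / B` is isomorphic to `V` when a linear map to `V` is onto on `Z` and vanishes
there exactly on `B`. -/
theorem nonempty_quot_equiv_of_surjective {C V : Type*} [AddCommGroup C] [Module ℝ C]
    [AddCommGroup V] [Module ℝ V] {Z B : Submodule ℝ C} (f : C →ₗ[ℝ] V)
    (hB : ∀ z ∈ Z, (f z = 0 ↔ z ∈ B)) (hs : ∀ v, ∃ z ∈ Z, f z = v) :
    Nonempty ((Z ⧸ B.submoduleOf Z) ≃ₗ[ℝ] V) := by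
  have hk : LinearMap.ker (f ∘ₗ Z.subtype) = B.submoduleOf Z := by
    ext z
    exact hB z z.2
  have hg : Function.Surjective (f ∘ₗ Z.subtype) := fun v => by
    obtain ⟨z, hz, h⟩ := hs v
    exact ⟨⟨z, hz⟩, h⟩
  exact ⟨(Submodule.quotEquivOfEq _ _ hk.symm).trans
    ((f ∘ₗ Z.subtype).quotKerEquivOfSurjective hg)⟩

section Comparison

open CategoryTheory Opposite Simplicial

variable {X : Type} [TopologicalSpace X] {A : Type} [AddCommGroup A] [Module ℝ A]

variable (X) in
/-- Singular simplices are maps from the standard simplex. -/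
def simplexEquiv (k : ℕ) : SingularSimplex X k ≃ C(Δ (k + 1), X) :=
  TopCat.toSSetObjEquiv (TopCat.of X) (op ⦋k⦌)

variable (X A) in
/-- Singular cochains are the augmented cochains of positive index. -/
def toCoch (k : ℕ) : (SingularSimplex X k → A) ≃ₗ[ℝ] Coch X A (k + 1) :=
  LinearEquiv.funCongrLeft ℝ A (simplexEquiv X k).symm

theorem toCoch_coboundary (k : ℕ) (φ : SingularSimplex X k → A) :
    toCoch X A (k + 1) (singularCoboundary X A k φ) = cobd X A (k + 1) (toCoch X A k φ) := by
  funext σ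
  rw [cobd_apply]
  change singularCoboundary X A k φ ((simplexEquiv X (k + 1)).symm σ) = _
  rw [singularCoboundary, LinearMap.sum_apply, Finset.sum_apply]
  rfl

theorem toCoch_mem_ker (k : ℕ) (φ : SingularSimplex X k → A) :
    toCoch X A k φ ∈ LinearMap.ker (cobd X A (k + 1)) ↔
      φ ∈ LinearMap.ker (singularCoboundary X A k) := by
  rw [LinearMap.mem_ker, LinearMap.mem_ker, ← toCoch_coboundary, LinearEquiv.map_eq_zero_iff]

/-- In positive degrees singular cohomology is reduced cohomology. -/
theorem nonempty_singularCohomology_equiv (k : ℕ) :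
    Nonempty (SingularCohomology X A (k + 1) ≃ₗ[ℝ] RH X A (k + 2)) := by
  refine nonempty_quot_equiv (toCoch X A (k + 1)).toLinearMap
    (fun φ hφ => (toCoch_mem_ker _ φ).2 hφ) (fun φ _ => ⟨?_, ?_⟩) fun χ hχ =>
      ⟨(toCoch X A (k + 1)).symm χ, ?_, ?_⟩
  · rintro ⟨ψ, hψ⟩
    refine ⟨(toCoch X A k).symm ψ, (toCoch X A (k + 1)).injective ?_⟩
    rw [toCoch_coboundary, LinearEquiv.apply_symm_apply]
    exact hψ
  · rintro ⟨ψ, rfl⟩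
    exact ⟨toCoch X A k ψ, (toCoch_coboundary k ψ).symm⟩
  · rw [← toCoch_mem_ker, LinearEquiv.apply_symm_apply]
    exact hχ
  · rw [LinearEquiv.coe_coe, LinearEquiv.apply_symm_apply, sub_self]
    exact Submodule.zero_mem _

/-- The singular cohomology in degree zero of a space with trivial reduced cohomology there. -/
theorem nonempty_singularCohomology_zero [Nonempty X] (h : Subsingleton (RH X A 1)) :
    Nonempty (SingularCohomology X A 0 ≃ₗ[ℝ] A) := by
  have p : X := Classical.arbitrary X
  have hval : ∀ (c : Coch X A 0) (σ : C(Δ 1, X)),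
      cobd X A 0 c σ = c (ContinuousMap.const _ p) := fun c σ => by
    rw [cobd_apply, Fin.sum_univ_one, Fin.val_zero, pow_zero, one_smul]
    congr 1
    exact ContinuousMap.ext fun x => absurd (stdSimplex.sum_eq_one x) (by simp)
  have hcoc : ∀ φ ∈ LinearMap.ker (cobd X A 1), φ ∈ redBd X A 1 := fun φ hφ => by
    have := Subsingleton.elim (Submodule.Quotient.mk ⟨φ, hφ⟩ : RH X A 1) 0
    exact (Submodule.Quotient.mk_eq_zero ((redBd X A 1).submoduleOf _)).1 this
  refine nonempty_quot_equiv_of_surjective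
    ((LinearMap.proj (ContinuousMap.const (Δ 1) p)) ∘ₗ (toCoch X A 0).toLinearMap)
    (fun φ hφ => ⟨fun h0 => ?_, fun h0 => ?_⟩) fun a => ?_
  · obtain ⟨c, hc⟩ := hcoc _ ((toCoch_mem_ker 0 φ).2 hφ)
    refine (Submodule.mem_bot ℝ).2 ((toCoch X A 0).injective ?_)
    change toCoch X A 0 φ _ = 0 at h0
    rw [← hc, hval] at h0
    rw [← hc, map_zero]
    funext σ
    rw [hval, h0]
    rfl
  · rw [(Submodule.mem_bot ℝ).1 h0, map_zero]
  · refine ⟨(toCoch X A 0).symm (cobd X A 0 fun _ => a), ?_, ?_⟩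
    · rw [← toCoch_mem_ker, LinearEquiv.apply_symm_apply, LinearMap.mem_ker]
      exact cobd_cobd _
    · rw [LinearMap.comp_apply, LinearEquiv.coe_coe, LinearEquiv.apply_symm_apply]
      exact hval _ _

end Comparison

/-! ### The sphere -/

/-- The sphere is homotopy equivalent to the complement of the origin. -/
def sphereEquiv (n : ℕ) : ContinuousMap.HomotopyEquiv (UnitSphere n) (Punctured (n + 1)) := by
  have hne : ∀ x : Punctured (n + 1), (WithLp.toLp 2 x.1 : EuclideanSpace ℝ (Fin (n + 1))) ≠ 0 :=
    fun x h => x.2 (funext fun i => congrFun (congrArg WithLp.ofLp h) i)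
  have hpos : ∀ x : Punctured (n + 1),
      0 < ‖(WithLp.toLp 2 x.1 : EuclideanSpace ℝ (Fin (n + 1)))‖ := fun x => norm_pos_iff.2 (hne x)
  have hne' : ∀ x : UnitSphere n, x.1.ofLp ≠ 0 := fun x h => by
    have h1 : x.1 = 0 := WithLp.ofLp_injective 2 h
    have h2 := x.2
    rw [h1] at h2
    simp at h2
  have hc : Continuous fun x : Punctured (n + 1) =>
      (WithLp.toLp 2 x.1 : EuclideanSpace ℝ (Fin (n + 1))) :=
    (PiLp.continuous_toLp 2 _).comp continuous_subtype_val
  have hcn : Continuous fun x : Punctured (n + 1) =>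
      ‖(WithLp.toLp 2 x.1 : EuclideanSpace ℝ (Fin (n + 1)))‖⁻¹ :=
    hc.norm.inv₀ fun x => (hpos x).ne'
  have hmem : ∀ x : Punctured (n + 1),
      ‖(WithLp.toLp 2 x.1 : EuclideanSpace ℝ (Fin (n + 1)))‖⁻¹ •
        (WithLp.toLp 2 x.1 : EuclideanSpace ℝ (Fin (n + 1))) ∈
          Metric.sphere (0 : EuclideanSpace ℝ (Fin (n + 1))) 1 := fun x => by
    rw [mem_sphere_zero_iff_norm, norm_smul, norm_inv, norm_norm, inv_mul_cancel₀ (hpos x).ne']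
  exact
    { toFun := ⟨fun x => ⟨x.1.ofLp, hne' x⟩,
        ((PiLp.continuous_ofLp 2 _).comp continuous_subtype_val).subtype_mk _⟩
      invFun := ⟨fun x => ⟨_, hmem x⟩, Continuous.subtype_mk (by exact hcn.smul hc) hmem⟩
      left_inv := by
        convert! ContinuousMap.Homotopic.refl (ContinuousMap.id (UnitSphere n))
        refine ContinuousMap.ext fun x => Subtype.ext ?_
        have hx : ‖x.1‖ = 1 := mem_sphere_zero_iff_norm.1 x.2
        change ‖x.1‖⁻¹ • x.1 = x.1
        rw [hx, inv_one, one_smul]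
      right_inv := by
        have hpos2 : ∀ y : unitInterval × Punctured (n + 1),
            0 < (1 - (y.1 : ℝ)) * ‖(WithLp.toLp 2 y.2.1 : EuclideanSpace ℝ (Fin (n + 1)))‖⁻¹ +
              y.1 := fun y => by
          have h1 := inv_pos.2 (hpos y.2)
          have h2 : 0 ≤ (y.1 : ℝ) := y.1.2.1
          have h3 : 0 ≤ 1 - (y.1 : ℝ) := sub_nonneg.2 y.1.2.2
          rcases eq_or_lt_of_le h2 with h4 | h4
          · rw [← h4]; simpa using h1
          · have := mul_nonneg h3 h1.le
            linarith
        refine ⟨⟨⟨fun y => ⟨((1 - (y.1 : ℝ)) *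
          ‖(WithLp.toLp 2 y.2.1 : EuclideanSpace ℝ (Fin (n + 1)))‖⁻¹ + y.1) • y.2.1,
          smul_ne_zero (hpos2 y).ne' y.2.2⟩, ?_⟩, fun x => ?_, fun x => ?_⟩⟩
        · have h1 := hcn.comp (continuous_snd (X := unitInterval))
          have h2 : Continuous fun y : unitInterval × Punctured (n + 1) => (y.1 : ℝ) :=
            continuous_subtype_val.comp continuous_fst
          have h3 : Continuous fun y : unitInterval × Punctured (n + 1) => y.2.1 :=
            continuous_subtype_val.comp continuous_snd
          exact ((((continuous_const.sub h2).mul h1).add h2).smul h3).subtype_mk _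
        · refine Subtype.ext ?_
          simp
        · refine Subtype.ext ?_
          simp }

instance (n : ℕ) : Nonempty (UnitSphere n) :=
  ⟨⟨EuclideanSpace.single 0 1, by simp⟩⟩

/-- The real singular cohomology of a space with the reduced cohomology of an `n`-sphere,
`n > 0`. -/
theorem singularCohomology_of_RH {X : Type} [TopologicalSpace X] [Nonempty X] (A : Type)
    [AddCommGroup A] [Module ℝ A] {n : ℕ} (hn : 0 < n)
    (h : Nonempty (RH X A (n + 1) ≃ₗ[ℝ] A)) (h' : ∀ m, m ≠ n + 1 → Subsingleton (RH X A m)) :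
    Nonempty (SingularCohomology X A 0 ≃ₗ[ℝ] A) ∧ Nonempty (SingularCohomology X A n ≃ₗ[ℝ] A) ∧
      ∀ k, k ≠ 0 → k ≠ n → Subsingleton (SingularCohomology X A k) := by
  refine ⟨nonempty_singularCohomology_zero (h' 1 (by omega)), ?_, fun k hk hkn => ?_⟩
  · obtain ⟨k, rfl⟩ := Nat.exists_eq_succ_of_ne_zero hn.ne'
    obtain ⟨e⟩ := nonempty_singularCohomology_equiv (X := X) (A := A) k
    obtain ⟨e'⟩ := h
    exact ⟨e.trans e'⟩
  · obtain ⟨k, rfl⟩ := Nat.exists_eq_succ_of_ne_zero hk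
    obtain ⟨e⟩ := nonempty_singularCohomology_equiv (X := X) (A := A) k
    have := h' (k + 2) (by omega)
    exact e.toEquiv.subsingleton

theorem RH_sphere (A : Type) [AddCommGroup A] [Module ℝ A] (n : ℕ) :
    Nonempty (RH (UnitSphere n) A (n + 1) ≃ₗ[ℝ] A) ∧
      ∀ m, m ≠ n + 1 → Subsingleton (RH (UnitSphere n) A m) := by
  have he : ∀ m, Nonempty (RH (Punctured (n + 1)) A m ≃ₗ[ℝ] RH (UnitSphere n) A m) :=
    fun m => nonempty_RH_equiv (sphereEquiv n) m
  obtain ⟨⟨e'⟩, h⟩ := RH_punctured A (n + 1)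
  constructor
  · obtain ⟨e⟩ := he (n + 1)
    exact ⟨e.symm.trans e'⟩
  · intro m hm
    obtain ⟨e⟩ := he m
    have := h m hm
    exact e.symm.toEquiv.subsingleton

/-! ### Real projective space -/

section Projective

variable {n : ℕ}

/-- The sign group acts on the sphere through the antipodal map. -/
abbrev signAction (n : ℕ) : MulAction ℤˣ (UnitSphere n) where
  smul u x := ⟨(u : ℤ) • x.1, by
    rcases Int.units_eq_one_or u with rfl | rfl <;> simp⟩
  one_smul x := Subtype.ext (by change ((1 : ℤˣ) : ℤ) • x.1 = x.1; simp)
  mul_smul u v x := Subtype.ext (by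
    change ((u * v : ℤˣ) : ℤ) • x.1 = (u : ℤ) • (v : ℤ) • x.1
    rw [Units.val_mul, mul_smul])

/-- The projection from the sphere to projective space. -/
def proj (n : ℕ) : C(UnitSphere n, RealProjectiveSpace n) :=
  ⟨Quotient.mk (antipodal n), continuous_quotient_mk'⟩

/-- The antipodal map. -/
def anti (n : ℕ) : C(UnitSphere n, UnitSphere n) := ⟨fun x => -x, continuous_neg⟩

theorem proj_eq_iff (x y : UnitSphere n) : proj n x = proj n y ↔ x = y ∨ x = -y :=
  Quotient.eq (r := antipodal n)

theorem proj_comp_anti : (proj n).comp (anti n) = proj n :=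
  ContinuousMap.ext fun _ => (proj_eq_iff _ _).2 (Or.inr rfl)

theorem anti_anti (x : UnitSphere n) : anti n (anti n x) = x := neg_neg x

theorem isCoveringMap_proj (n : ℕ) : IsCoveringMap (proj n) := by
  let := signAction n
  have hneg : ∀ x : UnitSphere n, (-1 : ℤˣ) • x = -x := fun x => Subtype.ext (by
    change ((-1 : ℤˣ) : ℤ) • x.1 = -x.1
    simp)
  have h : IsQuotientCoveringMap (proj n) ℤˣ :=
    { toIsQuotientMap := isQuotientMap_quotient_mk'
      continuous_const_smul := fun u => by
        rcases Int.units_eq_one_or u with rfl | rfl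
        · simp only [one_smul]; exact continuous_id
        · simp only [hneg]; exact continuous_neg
      apply_eq_iff_mem_orbit := fun {x y} => by
        rw [proj_eq_iff, MulAction.mem_orbit_iff]
        constructor
        · rintro (rfl | rfl)
          · exact ⟨1, one_smul _ _⟩
          · exact ⟨-1, hneg _⟩
        · rintro ⟨u, rfl⟩
          rcases Int.units_eq_one_or u with rfl | rfl
          · exact Or.inl (one_smul _ _)
          · exact Or.inr (hneg _)
      disjoint := fun x => by
        -- Antipodal points have distance two.
        refine ⟨Metric.ball x 1, Metric.ball_mem_nhds _ one_pos, fun u hu => ?_⟩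
        rcases Int.units_eq_one_or u with rfl | rfl
        · rfl
        · exfalso
          obtain ⟨y, ⟨z, hz, hzy⟩, hy⟩ := hu
          rw [← hzy] at hy
          dsimp only at hy
          rw [hneg, Metric.mem_ball] at hy
          rw [Metric.mem_ball] at hz
          have h1 : dist z (-z) < 2 := by
            have := dist_triangle_right z (-z) x
            linarith
          have h2 : ‖z.1‖ = 1 := mem_sphere_zero_iff_norm.1 z.2
          have h3 : dist z (-z) = 2 := by
            rw [Subtype.dist_eq, dist_eq_norm]
            change ‖z.1 - -z.1‖ = 2
            rw [sub_neg_eq_add, ← two_smul ℝ z.1, norm_smul, h2]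
            norm_num
          linarith }
  exact h.isCoveringMap

/-- Singular simplices of projective space lift to the sphere. -/
theorem exists_lift : ∀ {m : ℕ} (τ : C(Δ m, RealProjectiveSpace n)),
    ∃ σ : C(Δ m, UnitSphere n), (proj n).comp σ = τ
  | 0, τ => ⟨ContinuousMap.const _ (Classical.arbitrary _),
      ContinuousMap.ext fun x => absurd (stdSimplex.sum_eq_one x) (by simp)⟩
  | m + 1, τ => by
    let line : C(unitInterval × Δ (m + 1), Δ (m + 1)) :=
      ⟨fun y => ⟨(1 - (y.1 : ℝ)) • (stdSimplex.vertex 0 : Δ (m + 1)).1 + (y.1 : ℝ) • y.2.1,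
        convex_stdSimplex ℝ _ (stdSimplex.vertex 0 : Δ (m + 1)).2 y.2.2
          (sub_nonneg.2 y.1.2.2) y.1.2.1 (by ring)⟩, by fun_prop⟩
    obtain ⟨x, hx⟩ := Quotient.exists_rep (τ (stdSimplex.vertex 0))
    have h0 : ∀ a : Δ (m + 1), (τ.comp line) (0, a) = proj n (ContinuousMap.const _ x a) :=
      fun a => by
        refine Eq.trans (congrArg τ ?_) hx.symm
        exact Subtype.ext (by simp [line])
    refine ⟨((isCoveringMap_proj n).liftHomotopy (τ.comp line) (ContinuousMap.const _ x) h0).comp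
      ⟨fun a => (1, a), by fun_prop⟩, ContinuousMap.ext fun a => ?_⟩
    have h1 := congrFun ((isCoveringMap_proj n).liftHomotopy_lifts (τ.comp line)
      (ContinuousMap.const _ x) h0) (1, a)
    refine h1.trans (congrArg τ (Subtype.ext ?_))
    simp [line]

/-- Two lifts of a singular simplex agree up to the antipodal map. -/
theorem eq_or_eq_anti : ∀ {m : ℕ} {σ σ' : C(Δ m, UnitSphere n)},
    (proj n).comp σ = (proj n).comp σ' → σ' = σ ∨ σ' = (anti n).comp σ
  | 0, _, _, _ => Or.inl (ContinuousMap.ext fun x => absurd (stdSimplex.sum_eq_one x) (by simp))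
  | m + 1, σ, σ', h => by
    have key : ∀ {σ σ' : C(Δ (m + 1), UnitSphere n)}, (proj n).comp σ = (proj n).comp σ' →
        σ (stdSimplex.vertex 0) = σ' (stdSimplex.vertex 0) → σ' = σ := fun {σ σ'} h h0 =>
      ContinuousMap.ext fun x => (congrFun ((isCoveringMap_proj n).eq_of_comp_eq σ.continuous
        σ'.continuous (congrArg DFunLike.coe h) (stdSimplex.vertex 0) h0) x).symm
    rcases (proj_eq_iff _ _).1 (DFunLike.congr_fun h (stdSimplex.vertex 0)) with h0 | h0
    · exact Or.inl (key h h0)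
    · refine Or.inr (key ?_ ?_)
      · rw [← ContinuousMap.comp_assoc, proj_comp_anti, h]
      · change -(σ (stdSimplex.vertex 0)) = _
        rw [h0, neg_neg]

/-- The quarter turn of `ℝⁿ⁺¹`, for odd `n`. -/
def quarterTurn (n : ℕ) (x : Fin (n + 1) → ℝ) (i : Fin (n + 1)) : ℝ :=
  (if i < i.rev then 1 else -1) * x i.rev

theorem sum_quarterTurn_sq (x : Fin (n + 1) → ℝ) :
    ∑ i, quarterTurn n x i ^ 2 = ∑ i, x i ^ 2 := by
  rw [← Equiv.sum_comp Fin.revPerm (fun i => x i ^ 2)]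
  refine Finset.sum_congr rfl fun i _ => ?_
  rw [quarterTurn, mul_pow, Fin.revPerm_apply]
  split_ifs <;> simp

theorem sum_mul_quarterTurn (hn : Odd n) (x : Fin (n + 1) → ℝ) :
    ∑ i, x i * quarterTurn n x i = 0 := by
  have h : ∑ i, x i * quarterTurn n x i = -∑ i, x i * quarterTurn n x i := by
    conv_lhs => rw [← Equiv.sum_comp Fin.revPerm]
    rw [← Finset.sum_neg_distrib]
    refine Finset.sum_congr rfl fun i _ => ?_
    rw [quarterTurn, quarterTurn, Fin.revPerm_apply, Fin.rev_rev]
    have hi : i ≠ i.rev := fun h => by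
      have := congrArg Fin.val h
      rw [Fin.val_rev] at this
      obtain ⟨k, rfl⟩ := hn
      omega
    rcases lt_or_gt_of_ne hi with h | h
    · rw [if_neg h.not_gt, if_pos h]; ring
    · rw [if_pos h, if_neg h.not_gt]; ring
  linarith

/-- In odd dimension the antipodal map is homotopic to the identity. -/
theorem anti_homotopic_id (hn : Odd n) : (anti n).Homotopic (ContinuousMap.id _) := by
  have hnorm : ∀ (t : ℝ) (x : UnitSphere n), WithLp.toLp 2 (fun i => Real.cos t * x.1 i +
      Real.sin t * quarterTurn n x.1.ofLp i) ∈ Metric.sphere (0 : EuclideanSpace ℝ (Fin (n + 1))) 1 :=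
    fun t x => by
      have hx : ∑ i, x.1 i ^ 2 = 1 := by
        have := EuclideanSpace.real_norm_sq_eq x.1
        rw [mem_sphere_zero_iff_norm.1 x.2, one_pow] at this
        exact this.symm
      have hsq : ‖(WithLp.toLp 2 (fun i => Real.cos t * x.1 i +
          Real.sin t * quarterTurn n x.1.ofLp i) : EuclideanSpace ℝ (Fin (n + 1)))‖ ^ 2 = 1 := by
        rw [EuclideanSpace.real_norm_sq_eq]
        have h1 : ∀ i, (Real.cos t * x.1 i + Real.sin t * quarterTurn n x.1.ofLp i) ^ 2 =
            Real.cos t ^ 2 * x.1 i ^ 2 + Real.sin t ^ 2 * quarterTurn n x.1.ofLp i ^ 2 +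
              2 * Real.cos t * Real.sin t * (x.1 i * quarterTurn n x.1.ofLp i) := fun i => by ring
        simp only [h1]
        rw [Finset.sum_add_distrib, Finset.sum_add_distrib, ← Finset.mul_sum, ← Finset.mul_sum,
          ← Finset.mul_sum, sum_quarterTurn_sq, sum_mul_quarterTurn hn, hx, mul_zero, add_zero,
          mul_one, mul_one, Real.cos_sq_add_sin_sq]
      rw [mem_sphere_zero_iff_norm]
      exact (pow_eq_one_iff_of_nonneg (norm_nonneg _) two_ne_zero).1 hsq
  refine ContinuousMap.Homotopic.symm ⟨⟨⟨fun y => ⟨_, hnorm (Real.pi * y.1) y.2⟩, ?_⟩,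
    fun x => ?_, fun x => ?_⟩⟩
  · refine Continuous.subtype_mk ((PiLp.continuous_toLp 2 _).comp (continuous_pi fun i => ?_)) _
    have h1 : Continuous fun y : unitInterval × UnitSphere n => Real.pi * (y.1 : ℝ) :=
      continuous_const.mul (continuous_subtype_val.comp continuous_fst)
    have h2 : ∀ j, Continuous fun y : unitInterval × UnitSphere n => y.2.1.ofLp j := fun j =>
      (continuous_apply j).comp ((PiLp.continuous_ofLp 2 _).comp
        (continuous_subtype_val.comp continuous_snd))
    exact ((Real.continuous_cos.comp h1).mul (h2 i)).add
      ((Real.continuous_sin.comp h1).mul (continuous_const.mul (h2 _)))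
  · refine Subtype.ext ?_
    simp
  · refine Subtype.ext ?_
    ext i
    simp [anti]

variable {A : Type} [AddCommGroup A] [Module ℝ A]

theorem pull_proj_injective (m : ℕ) : Function.Injective (pull A (proj n) m) := by
  intro φ ψ h
  funext τ
  obtain ⟨σ, rfl⟩ := exists_lift τ
  exact congrFun h σ

/-- Invariant cochains descend to projective space. -/
theorem exists_descend {m : ℕ} (ψ : Coch (UnitSphere n) A m)
    (h : pull A (anti n) m ψ = ψ) : ∃ φ, pull A (proj n) m φ = ψ := by
  choose l hl using fun τ : C(Δ m, RealProjectiveSpace n) => exists_lift τ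
  refine ⟨fun τ => ψ (l τ), funext fun σ => ?_⟩
  rw [pull_apply]
  rcases eq_or_eq_anti (hl ((proj n).comp σ)) with h1 | h1
  · rw [← h1]
  · conv_rhs => rw [h1]
    exact (congrFun h _).symm

theorem pull_anti_average {m : ℕ} (ψ : Coch (UnitSphere n) A m) :
    pull A (anti n) m ((1 / 2 : ℝ) • (ψ + pull A (anti n) m ψ)) =
      (1 / 2 : ℝ) • (ψ + pull A (anti n) m ψ) := by
  rw [map_smul, map_add, pull_pull]
  have h : (anti n).comp (anti n) = ContinuousMap.id _ := ContinuousMap.ext anti_anti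
  rw [h, pull_id, add_comm (pull A (anti n) m ψ) ψ]

/-- Over the reals, cochains of projective space are the antipodally invariant cochains of the
sphere, so for odd `n` averaging identifies the two cohomologies. -/
theorem nonempty_RH_projective (hn : Odd n) (m : ℕ) :
    Nonempty (RH (RealProjectiveSpace n) A m ≃ₗ[ℝ] RH (UnitSphere n) A m) := by
  refine nonempty_quot_equiv (pull A (proj n) m) (fun φ hφ => ?_)
    (fun φ _ => ⟨fun h => ?_, pull_mem_redBd _⟩) fun φ hφ => ?_
  · rw [LinearMap.mem_ker] at *
    rw [← pull_cobd, hφ, map_zero]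
  · cases m with
    | zero =>
      refine (Submodule.mem_bot ℝ).2 (pull_proj_injective 0 ?_)
      rw [(Submodule.mem_bot ℝ).1 h, map_zero]
    | succ m =>
      obtain ⟨ψ, hψ⟩ := h
      obtain ⟨ψ', hψ'⟩ := exists_descend _ (pull_anti_average ψ)
      refine ⟨ψ', pull_proj_injective (m + 1) ?_⟩
      rw [pull_cobd, hψ', map_smul, map_add, ← pull_cobd, hψ, pull_pull, proj_comp_anti,
        ← two_smul ℝ, smul_smul]
      norm_num
  · rw [LinearMap.mem_ker] at hφ
    obtain ⟨φ', hφ'⟩ := exists_descend _ (pull_anti_average φ)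
    refine ⟨φ', LinearMap.mem_ker.2 (pull_proj_injective _ ?_), ?_⟩
    · rw [pull_cobd, hφ', map_smul, map_add, ← pull_cobd, hφ, map_zero, map_zero, add_zero,
        smul_zero]
    · rw [hφ']
      have h := Submodule.smul_mem _ (1 / 2 : ℝ) (pull_sub_mem_redBd (anti_homotopic_id hn) hφ)
      rw [pull_id] at h
      convert h using 1
      module

instance (n : ℕ) : Nonempty (RealProjectiveSpace n) := ⟨proj n (Classical.arbitrary _)⟩

theorem RH_projective (A : Type) [AddCommGroup A] [Module ℝ A] (hn : Odd n) :
    Nonempty (RH (RealProjectiveSpace n) A (n + 1) ≃ₗ[ℝ] A) ∧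
      ∀ m, m ≠ n + 1 → Subsingleton (RH (RealProjectiveSpace n) A m) := by
  obtain ⟨⟨e'⟩, h⟩ := RH_sphere A n
  constructor
  · obtain ⟨e⟩ := nonempty_RH_projective (A := A) hn (n + 1)
    exact ⟨e.trans e'⟩
  · intro m hm
    obtain ⟨e⟩ := nonempty_RH_projective (A := A) hn m
    have := h m hm
    exact e.toEquiv.subsingleton

end Projective

/-! ### Expansion of elements of `S` in Laurent monomials -/

section Expansion

variable {n : ℕ}

/-- The monomials `T ^ (j/(n+1)) z ^ k` of the Tate algebra, as pairs `(k, j)`. -/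
abbrev Mon (n : ℕ) : Type := (Fin (n + 1) →₀ ℕ) × ℤ

/-- The coefficient of a monomial in an element of the Tate algebra. -/
def co (f : tate n) (x : Mon n) : ℝ :=
  (MvPowerSeries.coeff x.1 (f : MvPowerSeries (Fin (n + 1)) Novikov)).coeff x.2

theorem co_add (f g : tate n) (x : Mon n) : co (f + g) x = co f x + co g x := by
  rw [co, Subring.coe_add, map_add, HahnSeries.coeff_add]; rfl

theorem co_neg (f : tate n) (x : Mon n) : co (-f) x = -co f x := by
  rw [co, Subring.coe_neg, map_neg, HahnSeries.coeff_neg]; rfl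

theorem co_sub (f g : tate n) (x : Mon n) : co (f - g) x = co f x - co g x := by
  rw [sub_eq_add_neg, co_add, co_neg, sub_eq_add_neg]

theorem tate_ext {f g : tate n} (h : ∀ x, co f x = co g x) : f = g :=
  Subtype.ext (MvPowerSeries.ext fun k => HahnSeries.ext (funext fun j => h (k, j)))

theorem co_finite (f : tate n) (J : ℤ) : {x | co f x ≠ 0 ∧ x.2 < J}.Finite := by
  obtain ⟨B, hB⟩ := IsTate.lower f.2
  have h := (isTate_iff n f.1).1 f.2 J
  rw [Filter.eventually_cofinite] at h
  refine (h.prod (Set.finite_Ico B J)).subset fun x hx => ⟨fun h' => hx.1 (h' _ hx.2), ?_, hx.2⟩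
  exact not_lt.1 fun h' => hx.1 (hB _ _ h')

/-- Elements of the Tate algebra are given by coefficient functions of which only finitely many
values in bounded degree in `T` are nonzero. -/
theorem exists_co_eq (F : Mon n → ℝ) (hF : ∀ J : ℤ, {x | F x ≠ 0 ∧ x.2 < J}.Finite) :
    ∃ f : tate n, ∀ x, co f x = F x := by
  have hb : ∀ k, BddBelow (Function.support fun j => F (k, j)) := fun k => by
    obtain ⟨c, hc⟩ := ((hF 0).image Prod.snd).bddBelow
    refine ⟨min c 0, fun j hj => ?_⟩
    rcases lt_or_ge j 0 with h | h
    · exact (min_le_left _ _).trans (hc ⟨(k, j), ⟨hj, h⟩, rfl⟩)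
    · exact (min_le_right _ _).trans h
  refine ⟨⟨fun k => HahnSeries.ofSuppBddBelow _ (hb k), (isTate_iff n _).2 fun J => ?_⟩,
    fun x => rfl⟩
  rw [Filter.eventually_cofinite]
  refine ((hF J).image Prod.fst).subset fun k hk => ?_
  rw [Set.mem_ofPred_eq] at hk
  push Not at hk
  obtain ⟨j, hj, hj'⟩ := hk
  exact ⟨(k, j), ⟨hj', hj⟩, rfl⟩

/-- The sign for which `sgn (k, j) T ^ (j/(n+1)) z ^ k` depends, in `S`, only on `lat (k, j)`. -/
def sgn (x : Mon n) : ℝ := ((-1) ^ (n * (n + 1) / 2)) ^ (x.1 0)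

theorem sgn_add (x y : Mon n) : sgn (x + y) = sgn x * sgn y := pow_add _ _ _

theorem sgn_mul_self (x : Mon n) : sgn x * sgn x = 1 := by
  rcases neg_one_pow_eq_or ℝ (n * (n + 1) / 2) with h | h <;> rw [sgn, h]
  · simp
  · rw [← mul_pow]; simp

/-- The exponent vector of a monomial, written as a Laurent monomial in the `zᵢ ^ (1/(n+1))`
through `T = ± z₀ ⋯ zₙ`. -/
def lat (x : Mon n) : Fin (n + 1) → ℤ := fun i => x.2 + (n + 1) * x.1 i

theorem lat_add (x y : Mon n) : lat (x + y) = lat x + lat y := by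
  funext i
  simp only [lat, Prod.snd_add, Prod.fst_add, Finsupp.add_apply, Pi.add_apply]
  push_cast
  ring

theorem le_lat (x : Mon n) (i : Fin (n + 1)) : x.2 ≤ lat x i := by
  have : (0 : ℤ) ≤ (n + 1) * x.1 i := by positivity
  simp only [lat]
  omega

theorem fiber_finite (f : tate n) (a : Fin (n + 1) → ℤ) : {x | lat x = a ∧ co f x ≠ 0}.Finite :=
  (co_finite f (a 0 + 1)).subset fun x hx => ⟨hx.2, by
    have := le_lat x 0
    rw [hx.1] at this
    omega⟩

/-- The coefficient of the Laurent monomial with exponent vector `a` in the class of `f` in `S`. -/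
def lcoeff (f : tate n) (a : Fin (n + 1) → ℤ) : ℝ :=
  ∑ᶠ x ∈ {x | lat x = a}, sgn x * co f x

theorem lcoeff_eq_sum (f : tate n) (a : Fin (n + 1) → ℤ) (A : Finset (Mon n))
    (hA : ∀ x, co f x ≠ 0 → lat x = a → x ∈ A) :
    lcoeff f a = ∑ x ∈ A with lat x = a, sgn x * co f x := by
  refine finsum_mem_eq_sum_of_inter_support_eq _ (Set.ext fun x => ?_)
  rw [Set.mem_inter_iff, Set.mem_inter_iff, Finset.mem_coe, Finset.mem_filter]
  exact ⟨fun h => ⟨⟨hA x (right_ne_zero_of_mul h.2) h.1, h.1⟩, h.2⟩, fun h => ⟨h.1.2, h.2⟩⟩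

theorem exists_of_lcoeff_ne_zero {f : tate n} {a : Fin (n + 1) → ℤ} (h : lcoeff f a ≠ 0) :
    ∃ x, lat x = a ∧ co f x ≠ 0 := by
  by_contra! h'
  exact h (finsum_mem_eq_zero_of_forall_eq_zero fun x hx => by rw [h' x hx, mul_zero])

theorem fiber_support_finite (f : tate n) (a : Fin (n + 1) → ℤ) :
    ({x | lat x = a} ∩ Function.support fun x => sgn x * co f x).Finite :=
  (fiber_finite f a).subset fun _ hx => ⟨hx.1, right_ne_zero_of_mul hx.2⟩

theorem lcoeff_add (f g : tate n) (a : Fin (n + 1) → ℤ) :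
    lcoeff (f + g) a = lcoeff f a + lcoeff g a := by
  rw [lcoeff, lcoeff, lcoeff,
    ← finsum_mem_add_distrib' (fiber_support_finite f a) (fiber_support_finite g a)]
  refine finsum_congr fun x => finsum_congr fun _ => ?_
  rw [co_add, mul_add]

/-- The support of `lcoeff f` has finitely many elements with an entry less than `J`. -/
theorem lcoeff_support_finite (f : tate n) (J : ℤ) :
    {a | lcoeff f a ≠ 0 ∧ ∃ i, a i < J}.Finite := by
  refine ((co_finite f J).image lat).subset ?_
  rintro a ⟨ha, i, hi⟩
  obtain ⟨x, rfl, hx⟩ := exists_of_lcoeff_ne_zero ha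
  exact ⟨x, ⟨hx, (le_lat x i).trans_lt hi⟩, rfl⟩

/-- A set of integer vectors is partially well-ordered if it has only finitely many elements with
an entry below any given bound. -/
theorem isPWO_of_finite {s : Set (Fin (n + 1) → ℤ)} (hs : ∀ J : ℤ, {a | a ∈ s ∧ ∃ i, a i < J}.Finite) :
    s.IsPWO := by
  intro v
  set u : ℕ → Fin (n + 1) → ℤ := fun m => (v m).1 with hud
  have hu : ∀ m, u m ∈ s := fun m => (v m).2
  by_contra! h
  replace h : ∀ i j, i < j → ¬ u i ≤ u j := h
  have h0 : ∀ m, 0 < m → u m ∈ {a | a ∈ s ∧ ∃ i, a i < Finset.univ.sup' Finset.univ_nonempty (u 0)} := by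
    intro m hm
    refine ⟨hu m, ?_⟩
    by_contra! h'
    exact h 0 m hm fun i => (Finset.le_sup' (u 0) (Finset.mem_univ i)).trans (h' i)
  obtain ⟨x, -, y, -, h2, h3⟩ := (Set.infinite_univ (α := ℕ)).exists_ne_map_eq_of_mapsTo
    (f := fun m => u (m + 1)) (fun m _ => h0 (m + 1) m.succ_pos) (hs _)
  rcases lt_or_gt_of_ne h2 with h4 | h4
  · exact h (x + 1) (y + 1) (by omega) h3.le
  · exact h (y + 1) (x + 1) (by omega) h3.ge

/-- The Laurent expansions of elements of `S`. -/
abbrev Laurent (n : ℕ) : Type := HahnSeries (Fin (n + 1) → ℤ) ℝ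

/-- The Laurent expansion of the class in `S` of an element of the Tate algebra. -/
def theta (f : tate n) : Laurent n :=
  ⟨lcoeff f, isPWO_of_finite (lcoeff_support_finite f)⟩

theorem co_mul (f g : tate n) (y : Mon n) (A B : Finset (Mon n)) 
    (hA : ∀ p q, co f p ≠ 0 → co g q ≠ 0 → p + q = y → p ∈ A ∧ q ∈ B) :
    co (f * g) y = ∑ p ∈ A ×ˢ B with p.1 + p.2 = y, co f p.1 * co g p.2 := by
  classical
  rw [co, Subring.coe_mul, MvPowerSeries.coeff_mul, HahnSeries.coeff_sum]
  simp only [HahnSeries.coeff_mul]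
  rw [Finset.sum_sigma']
  refine Finset.sum_bij_ne_zero (fun p _ _ => ((p.1.1, p.2.1), (p.1.2, p.2.2))) ?_ ?_ ?_ ?_
  · rintro ⟨⟨k, l⟩, i, j⟩ h h'
    rw [Finset.mem_sigma, Finset.HasAntidiagonal.mem_antidiagonal, Finset.mem_antidiagonal] at h
    have h1 : (k, i) + (l, j) = y := Prod.ext h.1 h.2.2.2
    have h2 := hA (k, i) (l, j) (left_ne_zero_of_mul h') (right_ne_zero_of_mul h') h1
    rw [Finset.mem_filter, Finset.mem_product]
    exact ⟨h2, h1⟩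
  · rintro ⟨⟨k, l⟩, i, j⟩ - - ⟨⟨k', l'⟩, i', j'⟩ - - h
    simp only [Prod.mk.injEq] at h
    obtain ⟨⟨rfl, rfl⟩, rfl, rfl⟩ := h
    rfl
  · rintro ⟨⟨k, i⟩, l, j⟩ h h'
    rw [Finset.mem_filter] at h
    refine ⟨⟨(k, l), (i, j)⟩, ?_, h', rfl⟩
    rw [Finset.mem_sigma, Finset.HasAntidiagonal.mem_antidiagonal, Finset.mem_antidiagonal]
    exact ⟨congrArg Prod.fst h.2, left_ne_zero_of_mul h', right_ne_zero_of_mul h',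
      congrArg Prod.snd h.2⟩
  · rintro ⟨⟨k, l⟩, i, j⟩ h h'
    rfl

theorem exists_bound (f : tate n) : ∃ B : ℤ, ∀ x, co f x ≠ 0 → B ≤ x.2 := by
  obtain ⟨B, hB⟩ := IsTate.lower f.2
  exact ⟨B, fun x hx => not_lt.1 fun h => hx (hB _ _ h)⟩

/-- Multiplicativity of the expansion, because `lat` is additive and `sgn` is multiplicative. -/
theorem theta_mul (f g : tate n) : theta (f * g) = theta f * theta g := by
  classical
  obtain ⟨P, hP⟩ := exists_bound f
  obtain ⟨Q, hQ⟩ := exists_bound g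
  ext c
  set A := (co_finite f (c 0 - Q + 1)).toFinset with hAd
  set B := (co_finite g (c 0 - P + 1)).toFinset with hBd
  have hA : ∀ x, co f x ≠ 0 → x.2 + Q ≤ c 0 → x ∈ A := fun x h1 h2 => by
    rw [hAd, Set.Finite.mem_toFinset]; exact ⟨h1, by omega⟩
  have hB : ∀ x, co g x ≠ 0 → P + x.2 ≤ c 0 → x ∈ B := fun x h1 h2 => by
    rw [hBd, Set.Finite.mem_toFinset]; exact ⟨h1, by omega⟩
  set C := (fiber_finite (f * g) c).toFinset ∪ ((A ×ˢ B).image fun p => p.1 + p.2) with hC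
  -- both sides are the sum of the products of coefficients over pairs of monomials of weight `c`
  have h1 : lcoeff (f * g) c = ∑ p ∈ A ×ˢ B with lat p.1 + lat p.2 = c,
      (sgn p.1 * co f p.1) * (sgn p.2 * co g p.2) := by
    rw [lcoeff_eq_sum _ _ C fun x h h' => Finset.mem_union_left _
      ((Set.Finite.mem_toFinset _).2 ⟨h', h⟩)]
    have h2 : ∀ y ∈ C.filter (lat · = c), sgn y * co (f * g) y =
        ∑ p ∈ ((A ×ˢ B).filter fun p => lat p.1 + lat p.2 = c) with p.1 + p.2 = y,
          (sgn p.1 * co f p.1) * (sgn p.2 * co g p.2) := by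
      intro y hy
      rw [Finset.mem_filter] at hy
      have h3 := le_lat y 0
      rw [hy.2] at h3
      rw [co_mul f g y A B ?_, Finset.mul_sum, Finset.filter_filter]
      · refine Finset.sum_congr (Finset.filter_congr fun p _ => ?_) fun p hp => ?_
        · refine ⟨fun h => ⟨?_, h⟩, fun h => h.2⟩
          rw [← lat_add, h, hy.2]
        · rw [Finset.mem_filter] at hp
          rw [← hp.2.2, sgn_add]
          ring
      · rintro p q hp hq rfl
        rw [Prod.snd_add] at h3
        have := hP p hp
        have := hQ q hq
        exact ⟨hA p hp (by omega), hB q hq (by omega)⟩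
    rw [Finset.sum_congr rfl h2, Finset.sum_fiberwise_of_maps_to]
    intro p hp
    rw [Finset.mem_filter] at hp
    rw [Finset.mem_filter, lat_add]
    exact ⟨Finset.mem_union_right _ (Finset.mem_image_of_mem _ hp.1), hp.2⟩
  change lcoeff (f * g) c = _
  rw [h1, HahnSeries.coeff_mul]
  set D := Finset.antidiagonal (theta f).isPWO_support (theta g).isPWO_support c with hD
  set E := ((A ×ˢ B).filter fun p => lat p.1 + lat p.2 = c) with hE
  set D' := D ∪ E.image fun p => (lat p.1, lat p.2) with hD'
  have hD1 : ∀ ij ∈ D', ij.1 + ij.2 = c := by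
    intro ij h
    rw [hD', Finset.mem_union, Finset.mem_image] at h
    rcases h with h | ⟨p, hp, rfl⟩
    · rw [hD, Finset.mem_antidiagonal] at h
      exact h.2.2
    · rw [hE, Finset.mem_filter] at hp
      exact hp.2
  have hD2 : ∀ ij ∈ D', Q ≤ ij.2 0 ∧ P ≤ ij.1 0 := by
    intro ij h
    rw [hD', Finset.mem_union, Finset.mem_image] at h
    rcases h with h | ⟨p, hp, rfl⟩
    · rw [hD, Finset.mem_antidiagonal] at h
      obtain ⟨x, hx, hx'⟩ := exists_of_lcoeff_ne_zero (f := f) h.1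
      obtain ⟨y, hy, hy'⟩ := exists_of_lcoeff_ne_zero (f := g) h.2.1
      rw [← hx, ← hy]
      exact ⟨(hQ y hy').trans (le_lat _ _), (hP x hx').trans (le_lat _ _)⟩
    · rw [hE, Finset.mem_filter, Finset.mem_product, hAd, hBd, Set.Finite.mem_toFinset,
        Set.Finite.mem_toFinset] at hp
      exact ⟨(hQ _ hp.1.2.1).trans (le_lat _ _), (hP _ hp.1.1.1).trans (le_lat _ _)⟩
  have h5 : ∑ ij ∈ D, (theta f).coeff ij.1 * (theta g).coeff ij.2 =
      ∑ ij ∈ D', (theta f).coeff ij.1 * (theta g).coeff ij.2 := by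
    refine Finset.sum_subset Finset.subset_union_left fun ij h h' => ?_
    by_contra h0
    refine h' ?_
    rw [hD, Finset.mem_antidiagonal]
    exact ⟨left_ne_zero_of_mul h0, right_ne_zero_of_mul h0, hD1 ij h⟩
  have h6 : ∀ ij ∈ D', (theta f).coeff ij.1 * (theta g).coeff ij.2 =
      ∑ p ∈ E with (lat p.1, lat p.2) = ij, (sgn p.1 * co f p.1) * (sgn p.2 * co g p.2) := by
    intro ij h
    have h7 := hD1 ij h
    have h8 := hD2 ij h
    have h9 : ij.1 0 + ij.2 0 = c 0 := congrFun h7 0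
    change lcoeff f ij.1 * lcoeff g ij.2 = _
    rw [lcoeff_eq_sum f ij.1 A fun x hx hx' => hA x hx (by
        have := le_lat x 0
        rw [hx'] at this
        omega),
      lcoeff_eq_sum g ij.2 B fun x hx hx' => hB x hx (by
        have := le_lat x 0
        rw [hx'] at this
        omega), Finset.sum_mul_sum, ← Finset.sum_product']
    refine Finset.sum_congr (Finset.ext fun p => ?_) fun p _ => rfl
    rw [hE, Finset.mem_product, Finset.mem_filter, Finset.mem_filter, Finset.mem_filter,
      Finset.mem_filter, Finset.mem_product]
    constructor
    · rintro ⟨⟨h10, h11⟩, h12, h13⟩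
      exact ⟨⟨⟨h10, h12⟩, by rw [h11, h13, h7]⟩, Prod.ext h11 h13⟩
    · rintro ⟨⟨⟨h10, h12⟩, -⟩, h13⟩
      exact ⟨⟨h10, congrArg Prod.fst h13⟩, h12, congrArg Prod.snd h13⟩
  rw [h5, Finset.sum_congr rfl h6, Finset.sum_fiberwise_of_maps_to]
  exact fun p hp => Finset.mem_union_right _ (Finset.mem_image_of_mem _ hp)

end Expansion

/-! ### Laurent monomials in `S` -/

section Expansion

variable {n : ℕ}

theorem lat_injective {x y : Mon n} (h : lat x = lat y) (h' : x.2 = y.2) : x = y := by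
  refine Prod.ext (Finsupp.ext fun i => ?_) h'
  have h1 := congrFun h i
  simp only [lat, h', add_right_inj] at h1
  have h2 := mul_left_cancel₀ (by positivity : ((n : ℤ) + 1) ≠ 0) h1
  exact_mod_cast h2

theorem dvd_lat_sub (x : Mon n) (i j : Fin (n + 1)) : ((n : ℤ) + 1) ∣ lat x i - lat x j :=
  ⟨x.1 i - x.1 j, by simp only [lat]; ring⟩

/-- The vectors that occur as exponents of Laurent monomials: all entries are congruent modulo
`n + 1`. -/
def IsLat (a : Fin (n + 1) → ℤ) : Prop := ∀ i, ((n : ℤ) + 1) ∣ a i - a 0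

theorem IsLat.add {a b : Fin (n + 1) → ℤ} (ha : IsLat a) (hb : IsLat b) : IsLat (a + b) := fun i => by
  have := (ha i).add (hb i)
  rwa [show a i - a 0 + (b i - b 0) = (a + b) i - (a + b) 0 by simp only [Pi.add_apply]; ring] at this

/-- Every Laurent monomial is represented by a monomial not divisible by `z₀ ⋯ zₙ`. -/
theorem IsLat.exists_lat_eq {a : Fin (n + 1) → ℤ} (ha : IsLat a) :
    ∃ x : Mon n, lat x = a ∧ ∃ i, x.1 i = 0 := by
  obtain ⟨i, -, hi⟩ := Finset.exists_min_image Finset.univ a Finset.univ_nonempty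
  have h : ∀ l, ∃ k : ℕ, a l = a i + (n + 1) * k := fun l => by
    obtain ⟨c, hc⟩ : ((n : ℤ) + 1) ∣ a l - a i := by
      have := (ha l).sub (ha i)
      rwa [sub_sub_sub_cancel_right] at this
    have h1 := hi l (Finset.mem_univ l)
    have h2 : 0 ≤ c := by
      by_contra! h3
      nlinarith
    lift c to ℕ using h2
    exact ⟨c, by rw [← hc]; ring⟩
  choose k hk using h
  refine ⟨(Finsupp.equivFunOnFinite.symm k, a i), funext fun l => (hk l).symm, i, ?_⟩
  have h1 : ((n : ℤ) + 1) * k i = 0 := by have := hk i; omega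
  rcases mul_eq_zero.1 h1 with h2 | h2
  · omega
  · exact_mod_cast h2

/-- The element `c T ^ (j/(n+1)) z ^ k` of the Tate algebra. -/
def tateMono (x : Mon n) (c : ℝ) : tate n :=
  ⟨MvPowerSeries.monomial x.1 (HahnSeries.single x.2 c), by
    classical
    refine isTate_of_finite ((Set.finite_singleton x.1).subset fun k hk => ?_)
    by_contra h0
    refine hk ?_
    rw [MvPowerSeries.coeff_monomial]
    exact if_neg h0⟩

theorem co_tateMono (x : Mon n) (c : ℝ) (y : Mon n) [Decidable (y = x)] :
    co (tateMono x c) y = if y = x then c else 0 := by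
  classical
  have h : co (tateMono x c) y =
    (MvPowerSeries.coeff y.1 (MvPowerSeries.monomial x.1 (HahnSeries.single x.2 c))).coeff y.2 := rfl
  rw [h, MvPowerSeries.coeff_monomial]
  by_cases h1 : y.1 = x.1
  · rw [if_pos h1, HahnSeries.coeff_single]
    by_cases h2 : y.2 = x.2
    · rw [if_pos h2, if_pos (Prod.ext h1 h2)]
    · rw [if_neg h2, if_neg fun h => h2 (congrArg Prod.snd h)]
  · rw [if_neg h1, if_neg fun h => h1 (congrArg Prod.fst h), HahnSeries.coeff_zero]

theorem tateMono_mul (x y : Mon n) (c d : ℝ) :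
    tateMono x c * tateMono y d = tateMono (x + y) (c * d) := by
  refine Subtype.ext ?_
  change MvPowerSeries.monomial x.1 (HahnSeries.single x.2 c) *
    MvPowerSeries.monomial y.1 (HahnSeries.single y.2 d) = _
  rw [MvPowerSeries.monomial_mul_monomial, HahnSeries.single_mul_single]
  rfl

theorem tateMono_zero_one : (tateMono 0 1 : tate n) = 1 := rfl

theorem tateMono_neg (x : Mon n) (c : ℝ) : tateMono x (-c) = -tateMono x c := by
  classical
  refine tate_ext fun y => ?_
  rw [co_neg, co_tateMono, co_tateMono]
  split_ifs <;> simp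

theorem tateMono_prod {ι : Type} (s : Finset ι) (x : ι → Mon n) :
    ∏ i ∈ s, tateMono (x i) 1 = tateMono (∑ i ∈ s, x i) 1 := by
  classical
  induction s using Finset.induction_on with
  | empty => rfl
  | insert i s hi ih =>
    rw [Finset.prod_insert hi, Finset.sum_insert hi, ih, tateMono_mul, mul_one]

theorem tateX_eq (i : Fin (n + 1)) : tateX n i = tateMono (Finsupp.single i 1, 0) 1 := rfl

theorem tateC_Tpow (b : ℤ) : tateC n (Tpow b) = tateMono (0, b) 1 := rfl

theorem neg_one_pow_eq_tateMono (m : ℕ) : (-1 : tate n) ^ m = tateMono 0 ((-1) ^ m) := by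
  induction m with
  | zero => rfl
  | succ m ih => rw [pow_succ, ih, pow_succ, mul_neg_one, mul_neg_one, tateMono_neg]

/-- The monomial `z₀ ⋯ zₙ`. -/
def allOnes (n : ℕ) : Mon n := (Finsupp.equivFunOnFinite.symm fun _ => 1, 0)

theorem rel_eq : (-1) ^ (n * (n + 1) / 2) * ∏ i, tateX n i - tateC n (Tpow (n + 1)) =
    tateMono (allOnes n) ((-1) ^ (n * (n + 1) / 2)) - tateMono (0, (n : ℤ) + 1) 1 := by
  simp only [tateX_eq]
  rw [tateC_Tpow, neg_one_pow_eq_tateMono, tateMono_prod, tateMono_mul, zero_add, mul_one]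
  congr 2
  refine Prod.ext (Finsupp.ext fun i => ?_) ?_
  · rw [Prod.fst_sum, Finsupp.finsetSum_apply]
    simp [Finsupp.single_apply, allOnes]
  · rw [Prod.snd_sum]
    simp [allOnes]

theorem co_tateMono_mul (x : Mon n) (c : ℝ) (g : tate n) (y : Mon n) [Decidable (x.1 ≤ y.1)] :
    co (tateMono x c * g) y = if x.1 ≤ y.1 then c * co g (y.1 - x.1, y.2 - x.2) else 0 := by
  classical
  have h : co (tateMono x c * g) y = (MvPowerSeries.coeff y.1
    (MvPowerSeries.monomial x.1 (HahnSeries.single x.2 c) * g.1)).coeff y.2 := rfl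
  rw [h, MvPowerSeries.coeff_monomial_mul]
  split_ifs
  · rw [HahnSeries.coeff_single_mul]; rfl
  · rw [HahnSeries.coeff_zero]

theorem lcoeff_tateMono (x : Mon n) (c : ℝ) (a : Fin (n + 1) → ℤ) [Decidable (a = lat x)] :
    lcoeff (tateMono x c) a = if a = lat x then sgn x * c else 0 := by
  classical
  rw [lcoeff_eq_sum _ a {x} fun y hy _ => ?_]
  · rw [Finset.sum_filter, Finset.sum_singleton, co_tateMono, if_pos rfl]
    simp only [eq_comm]
  · rw [co_tateMono] at hy
    rw [Finset.mem_singleton]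
    by_contra h
    exact hy (if_neg h)

theorem theta_tateMono (x : Mon n) (c : ℝ) :
    theta (tateMono x c) = HahnSeries.single (lat x) (sgn x * c) := by
  classical
  ext a
  rw [HahnSeries.coeff_single]
  convert! lcoeff_tateMono x c a

theorem lat_zero : lat (0 : Mon n) = 0 := by
  funext i
  simp [lat]

theorem sgn_zero : sgn (0 : Mon n) = 1 := by simp [sgn]

/-- The Laurent expansion as a ring homomorphism on the Tate algebra. -/
def thetaHom (n : ℕ) : tate n →+* Laurent n where
  toFun := theta
  map_one' := by
    rw [← tateMono_zero_one, theta_tateMono, lat_zero, sgn_zero, mul_one]; rfl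
  map_mul' := theta_mul
  map_zero' := by
    ext a
    exact finsum_mem_eq_zero_of_forall_eq_zero fun x _ => by
      rw [show co (0 : tate n) x = 0 from rfl, mul_zero]
  map_add' f g := by
    ext a
    exact lcoeff_add f g a

/-! #### The kernel of the expansion -/

/-- The part of the sum defining `lcoeff f a` over monomials of `T`-exponent greater than `j`. -/
def partialCoeff (f : tate n) (a : Fin (n + 1) → ℤ) (j : ℤ) : ℝ :=
  ∑ᶠ x ∈ {x | lat x = a ∧ j < x.2}, sgn x * co f x

/-- The monomials in a fibre of `lat` are totally ordered, with steps `n + 1` in the `T`-exponent. -/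
theorem partialCoeff_step (f : tate n) (y : Mon n) :
    partialCoeff f (lat y) (y.2 - (n + 1)) = sgn y * co f y + partialCoeff f (lat y) y.2 := by
  have h : {x | lat x = lat y ∧ y.2 - (n + 1) < x.2} =
      insert y {x | lat x = lat y ∧ y.2 < x.2} := by
    ext x
    rw [Set.mem_insert_iff, Set.mem_ofPred_eq, Set.mem_ofPred_eq]
    constructor
    · rintro ⟨h1, h2⟩
      by_cases h3 : y.2 < x.2
      · exact Or.inr ⟨h1, h3⟩
      · refine Or.inl (lat_injective h1 ?_)
        have h4 := congrFun h1 0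
        simp only [lat] at h4
        have h5 : ((n : ℤ) + 1) ∣ y.2 - x.2 := ⟨x.1 0 - y.1 0, by linarith⟩
        have h6 := Int.eq_zero_of_dvd_of_nonneg_of_lt (by omega) (by omega) h5
        omega
    · rintro (rfl | ⟨h1, h2⟩)
      · exact ⟨rfl, by omega⟩
      · exact ⟨h1, by omega⟩
  rw [partialCoeff, h, finsum_mem_insert' _ fun h' => lt_irrefl _ h'.2]
  · rfl
  · exact (fiber_support_finite f (lat y)).subset fun x hx => ⟨hx.1.1, hx.2⟩

theorem exists_of_partialCoeff_ne_zero {f : tate n} {a : Fin (n + 1) → ℤ} {j : ℤ}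
    (hf : lcoeff f a = 0) (h : partialCoeff f a j ≠ 0) :
    ∃ x, lat x = a ∧ x.2 ≤ j ∧ co f x ≠ 0 := by
  by_contra! h'
  refine h ((finsum_mem_inter_support_eq' _ _ _ fun x hx => ?_).trans hf)
  refine ⟨fun h1 => h1.1, fun h1 => ⟨h1, ?_⟩⟩
  by_contra! h2
  exact right_ne_zero_of_mul hx (h' x h1 h2)

/-- An element of the Tate algebra with vanishing Laurent expansion is a multiple of the relation;
the coefficients of the quotient are partial sums of the vanishing sums `lcoeff f a`, so they
tend to zero. -/
theorem mem_relIdeal {f : tate n} (hf : ∀ a, lcoeff f a = 0) : f ∈ relIdeal n := by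
  classical
  set F : Mon n → ℝ := fun y => -(sgn y * partialCoeff f (lat y + fun _ => (n : ℤ) + 1) y.2) with hF
  obtain ⟨g, hg⟩ := exists_co_eq F fun J => by
    have h1 : ∀ x : Mon n, {y : Mon n | lat x = (lat y + fun _ => (n : ℤ) + 1) ∧
        x.2 ≤ y.2 ∧ y.2 < J}.Finite := fun x => by
      refine Set.Finite.of_injOn (f := Prod.snd) (t := Set.Ico x.2 J) (fun y hy => hy.2) ?_
        (Set.finite_Ico _ _)
      intro y hy y' hy' h
      exact lat_injective (add_right_cancel (hy.1.symm.trans hy'.1)) h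
    refine ((co_finite f J).biUnion fun x _ => h1 x).subset fun y hy => ?_
    obtain ⟨x, hx, hx2, hx3⟩ := exists_of_partialCoeff_ne_zero (hf _)
      (right_ne_zero_of_mul (neg_ne_zero.1 hy.1))
    exact Set.mem_biUnion (x := x) ⟨hx3, hx2.trans_lt hy.2⟩ ⟨hx, hx2, hy.2⟩
  refine Ideal.mem_span_singleton'.2 ⟨g, tate_ext fun y => ?_⟩
  have hl : ∀ x : Mon n, lat x + (fun _ => (n : ℤ) + 1) = lat (x + allOnes n) := fun x => by
    rw [lat_add]
    congr 1
    funext i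
    simp [lat, allOnes]
  have hl2 : ∀ x : Mon n, lat x + (fun _ => (n : ℤ) + 1) = lat (x.1, x.2 + ((n : ℤ) + 1)) := fun x => by
    funext i
    simp only [lat, Pi.add_apply]
    ring
  rw [mul_comm, rel_eq, sub_mul, co_sub, co_tateMono_mul, co_tateMono_mul, if_pos (zero_le), hg, hg,
    one_mul]
  have h2 : F (y.1 - 0, y.2 - ((n : ℤ) + 1)) =
      -(sgn y * (sgn y * co f y + partialCoeff f (lat y) y.2)) := by
    rw [← partialCoeff_step]
    simp only [hF]
    rw [hl2]
    simp only [tsub_zero, sub_add_cancel]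
    rfl
  have h3 : (if (allOnes n).1 ≤ y.1 then
      (-1) ^ (n * (n + 1) / 2) * F (y.1 - (allOnes n).1, y.2 - (allOnes n).2) else 0) =
      -(sgn y * partialCoeff f (lat y) y.2) := by
    have h4 : (y.1 - (allOnes n).1, y.2 - (allOnes n).2) = y - allOnes n := rfl
    split_ifs with h
    · have h5 : y - allOnes n + allOnes n = y :=
        Prod.ext (tsub_add_cancel_of_le h) (sub_add_cancel _ _)
      have h6 : sgn (allOnes n) = (-1) ^ (n * (n + 1) / 2) := by simp [sgn, allOnes]
      rw [h4]
      simp only [hF]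
      rw [hl, h5, ← h6]
      conv_rhs => rw [← h5, sgn_add, h5]
      rw [show (y - allOnes n).2 = y.2 from sub_zero _]
      ring
    · have h5 : partialCoeff f (lat y) y.2 = 0 := by
        refine finsum_mem_eq_zero_of_forall_eq_zero fun x hx => absurd (fun i => ?_) h
        have h6 := congrFun hx.1 i
        have h7 := hx.2
        simp only [lat] at h6
        change 1 ≤ y.1 i
        by_contra! h8
        have h9 : y.1 i = 0 := by omega
        rw [h9] at h6
        have : (0 : ℤ) ≤ (n + 1) * x.1 i := by positivity
        push_cast at h6
        linarith
      rw [h5, mul_zero, neg_zero]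
  rw [h3, h2, mul_add, ← mul_assoc, sgn_mul_self]
  ring

/-- The Laurent expansion of an element of `S`. -/
def hat (n : ℕ) : S n →+* Laurent n :=
  Ideal.Quotient.lift (relIdeal n) (thetaHom n) fun f hf => by
    have h : relIdeal n ≤ RingHom.ker (thetaHom n) := by
      rw [relIdeal, Ideal.span_singleton_le_iff_mem, RingHom.mem_ker, rel_eq, map_sub, sub_eq_zero]
      change theta _ = theta _
      rw [theta_tateMono, theta_tateMono]
      congr 1
      · congr 1
        funext i
        simp [lat, allOnes]
      · have h6 : sgn (allOnes n) = (-1) ^ (n * (n + 1) / 2) := by simp [sgn, allOnes]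
        rw [← h6, sgn_mul_self, mul_one]
        simp [sgn]
    exact h hf

theorem hat_toS (f : tate n) : hat n (toS n f) = theta f := rfl

theorem toS_surjective : Function.Surjective (toS n) := Ideal.Quotient.mk_surjective

theorem hat_injective : Function.Injective (hat n) := by
  rw [injective_iff_map_eq_zero]
  intro s hs
  obtain ⟨f, rfl⟩ := toS_surjective s
  refine Ideal.Quotient.eq_zero_iff_mem.2 (mem_relIdeal fun a => ?_)
  exact congrFun (congrArg HahnSeries.coeff hs) a

theorem hat_smul (c : ℝ) (s : S n) : hat n (c • s) = c • hat n s := by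
  rw [Algebra.smul_def, map_mul, ← HahnSeries.C_mul_eq_smul]
  congr 1
  change theta (tateMono 0 c) = _
  rw [theta_tateMono, sgn_zero, one_mul, lat_zero]
  rfl

theorem isLat_of_coeff_ne_zero {s : S n} {a : Fin (n + 1) → ℤ} (h : (hat n s).coeff a ≠ 0) :
    IsLat a := by
  obtain ⟨f, rfl⟩ := toS_surjective s
  obtain ⟨x, rfl, -⟩ := exists_of_lcoeff_ne_zero (f := f) h
  exact fun i => dvd_lat_sub x i 0

/-- Every element of `S` is represented by a series without monomials divisible by
`z₀ ⋯ zₙ`, in which only the monomials of the Laurent expansion occur. -/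
theorem exists_reduced (s : S n) :
    ∃ f, toS n f = s ∧ ∀ x, co f x ≠ 0 → (hat n s).coeff (lat x) ≠ 0 := by
  classical
  obtain ⟨g, rfl⟩ := toS_surjective s
  have hinj : ∀ x y : Mon n, (∃ i, x.1 i = 0) → (∃ i, y.1 i = 0) → lat x = lat y → x = y := by
    rintro x y ⟨i, hi⟩ ⟨j, hj⟩ h
    refine lat_injective h (le_antisymm ?_ ?_)
    · have h1 := le_lat x j
      rw [h] at h1
      simpa [lat, hj] using h1
    · have h1 := le_lat y i
      rw [← h] at h1
      simpa [lat, hi] using h1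
  obtain ⟨f, hf⟩ := exists_co_eq
    (fun x : Mon n => if ∃ i, x.1 i = 0 then sgn x * (hat n (toS n g)).coeff (lat x) else 0)
    fun J => by
      refine Set.Finite.of_injOn (f := lat) (t := {a | lcoeff g a ≠ 0 ∧ ∃ i, a i < J})
        (fun x hx => ?_) (fun x hx y hy h => ?_) (lcoeff_support_finite g J)
      · have h1 : ∃ i, x.1 i = 0 := by
          by_contra h
          exact hx.1 (if_neg h)
        have h2 := hx.1
        rw [if_pos h1] at h2
        obtain ⟨i, hi⟩ := h1
        refine ⟨right_ne_zero_of_mul h2, i, ?_⟩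
        simpa [lat, hi] using hx.2
      · refine hinj x y ?_ ?_ h
        · by_contra h
          exact hx.1 (if_neg h)
        · by_contra h
          exact hy.1 (if_neg h)
  have hne : ∀ x, co f x ≠ 0 → (∃ i, x.1 i = 0) ∧ (hat n (toS n g)).coeff (lat x) ≠ 0 := by
    intro x hx
    rw [hf] at hx
    have h1 : ∃ i, x.1 i = 0 := by
      by_contra h
      exact hx (if_neg h)
    rw [if_pos h1] at hx
    exact ⟨h1, right_ne_zero_of_mul hx⟩
  refine ⟨f, hat_injective (HahnSeries.ext (funext fun a => ?_)), fun x hx => (hne x hx).2⟩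
  change lcoeff f a = (hat n (toS n g)).coeff a
  by_cases h : (hat n (toS n g)).coeff a = 0
  · rw [h]
    by_contra h1
    obtain ⟨x, rfl, hx⟩ := exists_of_lcoeff_ne_zero h1
    exact (hne x hx).2 h
  · obtain ⟨x, rfl, hx⟩ := (isLat_of_coeff_ne_zero h).exists_lat_eq
    rw [lcoeff_eq_sum f _ {x} fun y hy hy' =>
      Finset.mem_singleton.2 (hinj y x (hne y hy).1 hx hy'), Finset.sum_filter,
      Finset.sum_singleton, if_pos rfl, hf, if_pos hx, ← mul_assoc, sgn_mul_self, one_mul]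

open Classical in
/-- The Laurent monomial with coefficient `c` and exponent vector `a`; it is zero by convention
if `a` is not an exponent vector of such a monomial. -/
def lmono (a : Fin (n + 1) → ℤ) (c : ℝ) : S n :=
  if h : IsLat a then toS n (tateMono h.exists_lat_eq.choose (sgn h.exists_lat_eq.choose * c)) else 0

theorem hat_lmono {a : Fin (n + 1) → ℤ} (ha : IsLat a) (c : ℝ) :
    hat n (lmono a c) = HahnSeries.single a c := by
  rw [lmono, dif_pos ha, hat_toS, theta_tateMono, ha.exists_lat_eq.choose_spec.1, ← mul_assoc,
    sgn_mul_self, one_mul]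

theorem lmono_mul {a b : Fin (n + 1) → ℤ} (ha : IsLat a) (hb : IsLat b) (c d : ℝ) :
    lmono a c * lmono b d = lmono (a + b) (c * d) := by
  apply hat_injective
  rw [map_mul, hat_lmono ha, hat_lmono hb, hat_lmono (ha.add hb), HahnSeries.single_mul_single]

theorem lmono_zero_one : (lmono 0 1 : S n) = 1 := by
  apply hat_injective
  rw [hat_lmono (fun i => by simp), (hat n).map_one]
  rfl

theorem lmono_add (a : Fin (n + 1) → ℤ) (c d : ℝ) :
    (lmono a (c + d) : S n) = lmono a c + lmono a d := by
  by_cases ha : IsLat a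
  · apply hat_injective
    rw [map_add, hat_lmono ha, hat_lmono ha, hat_lmono ha, HahnSeries.single_add]
  · rw [lmono, lmono, lmono, dif_neg ha, dif_neg ha, dif_neg ha, add_zero]

theorem lmono_zero (a : Fin (n + 1) → ℤ) : (lmono a 0 : S n) = 0 := by
  have := lmono_add a 0 0
  rw [add_zero] at this
  exact left_eq_add.1 this

theorem coeff_lmono {a : Fin (n + 1) → ℤ} (ha : IsLat a) (c : ℝ) (b : Fin (n + 1) → ℤ) 
    [Decidable (b = a)] : (hat n (lmono a c)).coeff b = if b = a then c else 0 := by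
  rw [hat_lmono ha, HahnSeries.coeff_single]
  congr

theorem coeff_lmono_mul {a : Fin (n + 1) → ℤ} (ha : IsLat a) (c : ℝ) (s : S n)
    (b : Fin (n + 1) → ℤ) : (hat n (lmono a c * s)).coeff b = c * (hat n s).coeff (b - a) := by
  rw [map_mul, hat_lmono ha, HahnSeries.coeff_single_mul]

theorem z_eq (i : Fin (n + 1)) :
    z n i = lmono (Pi.single i ((n : ℤ) + 1)) (if i = 0 then (-1) ^ (n * (n + 1) / 2) else 1) := by
  have hl : lat ((Finsupp.single i 1, 0) : Mon n) = Pi.single i ((n : ℤ) + 1) := by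
    funext l
    rcases eq_or_ne l i with rfl | h
    · simp [lat]
    · simp [lat, h]
  apply hat_injective
  rw [hat_lmono]
  · change theta (tateMono (Finsupp.single i 1, 0) 1) = _
    rw [theta_tateMono, hl, mul_one]
    congr 1
    rcases eq_or_ne i 0 with rfl | h
    · simp [sgn]
    · simp [sgn, h]
  · rw [← hl]
    exact fun l => dvd_lat_sub _ l 0

theorem novToS_Tpow (b : ℤ) : novToS n (Tpow b) = lmono (fun _ => b) 1 := by
  apply hat_injective
  rw [hat_lmono fun i => by simp]
  change theta (tateMono (0, b) 1) = _
  rw [theta_tateMono]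
  congr 1
  · congr 1
    funext i
    simp [lat]
  · simp [sgn]

end Expansion

/-! ### The valuations on `S` -/

section Valuations

variable {n : ℕ}

theorem le_add_coe_iff {a b : EReal} {c : ℝ} : a ≤ b + (c : EReal) ↔ a - c ≤ b :=
  (EReal.sub_le_iff_le_add (Or.inl (EReal.coe_ne_bot c)) (Or.inl (EReal.coe_ne_top c))).symm

/-- The valuation at `ζ` of the Laurent monomial with exponent vector `a`. -/
def wt (ζ : Simplex n) (a : Fin (n + 1) → ℤ) : ℝ := (∑ i, (a i : ℝ) * ζ.1 i) / (n + 1)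

theorem wt_add (ζ : Simplex n) (a b : Fin (n + 1) → ℤ) : wt ζ (a + b) = wt ζ a + wt ζ b := by
  simp only [wt, Pi.add_apply, Int.cast_add, add_mul, Finset.sum_add_distrib, add_div]

theorem wt_zero (ζ : Simplex n) : wt ζ 0 = 0 := by simp [wt]

theorem wt_neg (ζ : Simplex n) (a : Fin (n + 1) → ℤ) : wt ζ (-a) = -wt ζ a := by
  have := wt_add ζ a (-a)
  rw [add_neg_cancel, wt_zero] at this
  linarith

theorem wt_sub (ζ : Simplex n) (a b : Fin (n + 1) → ℤ) : wt ζ (a - b) = wt ζ a - wt ζ b := by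
  rw [sub_eq_add_neg, wt_add, wt_neg, sub_eq_add_neg]

theorem wt_lat (ζ : Simplex n) (x : Mon n) :
    wt ζ (lat x) = (x.2 : ℝ) / (n + 1) + ∑ i, (x.1 i : ℝ) * ζ.1 i := by
  have h : (n : ℝ) + 1 ≠ 0 := by positivity
  have h1 : (x.2 : ℝ) = ∑ i, (x.2 : ℝ) * ζ.1 i := by rw [← Finset.mul_sum, ζ.2.2, mul_one]
  rw [wt, div_eq_iff h, add_mul, div_mul_cancel₀ _ h, Finset.sum_mul, h1, ← Finset.sum_add_distrib]
  refine Finset.sum_congr rfl fun i _ => ?_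
  simp only [lat]
  push_cast
  ring

/-- The valuation on the Tate algebra in terms of coefficients. -/
theorem le_tateVal_iff (ζ : Simplex n) (f : tate n) (b : EReal) :
    b ≤ tateVal ζ f ↔ ∀ x, co f x ≠ 0 → b ≤ (wt ζ (lat x) : ℝ) := by
  rw [tateVal, le_iInf_iff]
  constructor
  · intro h x hx
    refine (h x.1).trans ?_
    rw [wt_lat, EReal.coe_add]
    exact add_le_add_left (iInf₂_le (f := fun j (_ : (MvPowerSeries.coeff x.1 f.1).coeff j ≠ 0) =>
      (((j : ℝ) / (n + 1) : ℝ) : EReal)) x.2 hx) _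
  · intro h k
    rw [le_add_coe_iff]
    refine le_iInf₂ fun j hj => ?_
    have h1 := h (k, j) hj
    rwa [wt_lat, EReal.coe_add, le_add_coe_iff] at h1

/-- The valuation on `S` is the least weight of a monomial of the Laurent expansion: the supremum over
the preimages in the Tate algebra is attained at the reduced one. -/
theorem le_valS_iff (ζ : Simplex n) (s : S n) (b : EReal) :
    b ≤ valS ζ s ↔ ∀ a, (hat n s).coeff a ≠ 0 → b ≤ (wt ζ a : ℝ) := by
  constructor
  · intro h a ha
    refine h.trans (iSup₂_le fun f hf => ?_)
    subst hf
    obtain ⟨x, rfl, hx⟩ := exists_of_lcoeff_ne_zero (f := f) ha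
    exact (le_tateVal_iff ζ f _).1 le_rfl x hx
  · intro h
    obtain ⟨f, rfl, hf⟩ := exists_reduced s
    exact le_iSup₂_of_le f rfl ((le_tateVal_iff ζ f b).2 fun x hx => h _ (hf x hx))

theorem wt_support_finite (ζ : Simplex n) (s : S n) (r : ℝ) :
    {a | (hat n s).coeff a ≠ 0 ∧ wt ζ a ≤ r}.Finite := by
  obtain ⟨f, rfl⟩ := toS_surjective s
  obtain ⟨J, hJ⟩ := exists_int_gt (r * (n + 1))
  refine ((co_finite f J).image lat).subset ?_
  rintro a ⟨ha, ha'⟩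
  obtain ⟨x, rfl, hx⟩ := exists_of_lcoeff_ne_zero (f := f) ha
  refine ⟨x, ⟨hx, ?_⟩, rfl⟩
  rw [wt_lat] at ha'
  have h1 : 0 ≤ ∑ i, (x.1 i : ℝ) * ζ.1 i :=
    Finset.sum_nonneg fun i _ => mul_nonneg (Nat.cast_nonneg _) (ζ.2.1 i).le
  have h2 : (x.2 : ℝ) / (n + 1) ≤ r := by linarith
  rw [div_le_iff₀ (by positivity)] at h2
  exact_mod_cast h2.trans_lt hJ

/-- The valuation of a nonzero element is attained by finitely many of its Laurent monomials. -/
theorem exists_leading (ζ : Simplex n) {s : S n} (hs : s ≠ 0) :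
    ∃ (r : ℝ) (A : Finset (Fin (n + 1) → ℤ)), A.Nonempty ∧
      (∀ a, a ∈ A ↔ (hat n s).coeff a ≠ 0 ∧ wt ζ a = r) ∧
      (∀ a, (hat n s).coeff a ≠ 0 → r ≤ wt ζ a) ∧ valS ζ s = r := by
  obtain ⟨a₀, h₀⟩ : ∃ a, (hat n s).coeff a ≠ 0 := by
    by_contra! h
    refine hs (hat_injective ?_)
    rw [map_zero]
    exact HahnSeries.ext (funext h)
  obtain ⟨a, ha, hmin⟩ := (wt_support_finite ζ s (wt ζ a₀)).toFinset.exists_min_image (wt ζ)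
    ⟨a₀, by rw [Set.Finite.mem_toFinset]; exact ⟨h₀, le_rfl⟩⟩
  rw [Set.Finite.mem_toFinset] at ha
  have hle : ∀ b, (hat n s).coeff b ≠ 0 → wt ζ a ≤ wt ζ b := fun b hb => by
    rcases le_total (wt ζ b) (wt ζ a₀) with h | h
    · exact hmin b (by rw [Set.Finite.mem_toFinset]; exact ⟨hb, h⟩)
    · exact ha.2.trans h
  have hfin : {b | (hat n s).coeff b ≠ 0 ∧ wt ζ b = wt ζ a}.Finite :=
    (wt_support_finite ζ s (wt ζ a)).subset fun b hb => ⟨hb.1, hb.2.le⟩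
  refine ⟨wt ζ a, hfin.toFinset, ⟨a, ?_⟩, fun b => ?_, hle, le_antisymm ?_ ?_⟩
  · rw [Set.Finite.mem_toFinset]; exact ⟨ha.1, rfl⟩
  · rw [Set.Finite.mem_toFinset]; rfl
  · exact (le_valS_iff ζ s _).1 le_rfl a ha.1
  · rw [le_valS_iff]
    exact fun b hb => EReal.coe_le_coe_iff.2 (hle b hb)

theorem exists_of_coeff_mul_ne_zero {s t : S n} {a : Fin (n + 1) → ℤ}
    (h : (hat n (s * t)).coeff a ≠ 0) :
    ∃ b c, (hat n s).coeff b ≠ 0 ∧ (hat n t).coeff c ≠ 0 ∧ b + c = a := by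
  rw [map_mul, HahnSeries.coeff_mul] at h
  obtain ⟨ij, h1, -⟩ := Finset.exists_ne_zero_of_sum_ne_zero h
  rw [Finset.mem_antidiagonal] at h1
  exact ⟨_, _, h1⟩

theorem valS_ne_bot (ζ : Simplex n) (s : S n) : valS ζ s ≠ ⊥ := by
  by_cases hs : s = 0
  · rw [hs, valS_zero]; exact top_ne_bot
  · obtain ⟨r, A, -, -, -, h⟩ := exists_leading ζ hs
    rw [h]; exact EReal.coe_ne_bot r

theorem valS_eq_top_iff (ζ : Simplex n) (s : S n) : valS ζ s = ⊤ ↔ s = 0 := by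
  refine ⟨fun h => ?_, fun h => by rw [h, valS_zero]⟩
  by_contra hs
  obtain ⟨r, A, -, -, -, h'⟩ := exists_leading ζ hs
  rw [h'] at h
  exact EReal.coe_ne_top r h

/-- The functions `ν_ζ` on `S` are multiplicative: by the unique product property of the exponent
group, some product of leading monomials is not cancelled. -/
theorem valS_mul (ζ : Simplex n) (s t : S n) : valS ζ (s * t) = valS ζ s + valS ζ t := by
  classical
  by_cases hs : s = 0
  · rw [hs, zero_mul, valS_zero, EReal.top_add_of_ne_bot (valS_ne_bot ζ t)]
  by_cases ht : t = 0
  · rw [ht, mul_zero, valS_zero, EReal.add_top_of_ne_bot (valS_ne_bot ζ s)]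
  obtain ⟨r, A, hA, hA1, hA2, hr⟩ := exists_leading ζ hs
  obtain ⟨q, B, hB, hB1, hB2, hq⟩ := exists_leading ζ ht
  rw [hr, hq, ← EReal.coe_add]
  refine le_antisymm ?_ ?_
  · obtain ⟨a, ha, b, hb, hab⟩ := UniqueSums.uniqueAdd_of_nonempty hA hB
    have ha' := (hA1 a).1 ha
    have hb' := (hB1 b).1 hb
    have h1 : (hat n (s * t)).coeff (a + b) = (hat n s).coeff a * (hat n t).coeff b := by
      rw [map_mul, HahnSeries.coeff_mul]
      refine Finset.sum_eq_single (a, b) (fun c hc hne => ?_) fun h => ?_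
      · rw [Finset.mem_antidiagonal] at hc
        have h2 := hA2 _ hc.1
        have h3 := hB2 _ hc.2.1
        have h4 : wt ζ c.1 + wt ζ c.2 = r + q := by
          rw [← wt_add, hc.2.2, wt_add, ha'.2, hb'.2]
        have h5 := hab ((hA1 c.1).2 ⟨hc.1, by linarith⟩) ((hB1 c.2).2 ⟨hc.2.1, by linarith⟩) hc.2.2
        exact absurd (Prod.ext h5.1 h5.2) hne
      · by_contra h0
        refine h ?_
        rw [Finset.mem_antidiagonal]
        exact ⟨ha'.1, hb'.1, rfl⟩
    have h2 := (le_valS_iff ζ (s * t) _).1 le_rfl (a + b) (by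
      rw [h1]; exact mul_ne_zero ha'.1 hb'.1)
    rwa [wt_add, ha'.2, hb'.2] at h2
  · rw [le_valS_iff]
    intro c hc
    obtain ⟨a, b, ha, hb, rfl⟩ := exists_of_coeff_mul_ne_zero hc
    rw [wt_add, EReal.coe_le_coe_iff]
    exact add_le_add (hA2 a ha) (hB2 b hb)

theorem valS_lmono (ζ : Simplex n) {a : Fin (n + 1) → ℤ} (ha : IsLat a) {c : ℝ} (hc : c ≠ 0) :
    valS ζ (lmono a c) = (wt ζ a : ℝ) := by
  classical
  refine le_antisymm ((le_valS_iff ζ _ _).1 le_rfl a ?_) ((le_valS_iff ζ _ _).2 fun b hb => ?_)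
  · rw [coeff_lmono ha, if_pos rfl]; exact hc
  · rw [coeff_lmono ha] at hb
    rw [show b = a by by_contra h; exact hb (if_neg h)]

theorem sHomogeneous_iff (p : ℤ) (s : S n) :
    SHomogeneous p s ↔ ∀ a, (hat n s).coeff a ≠ 0 → 2 * ∑ i, a i = (n + 1) * p := by
  have key : ∀ x : Mon n, 2 * ∑ i, lat x i = (n + 1) * p ↔ 2 * x.2 = p - 2 * ∑ i, (x.1 i : ℤ) := by
    intro x
    have h : ∑ i, lat x i = (n + 1) * (x.2 + ∑ i, (x.1 i : ℤ)) := by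
      simp only [lat, Finset.sum_add_distrib, Finset.sum_const, Finset.card_univ, Fintype.card_fin,
        ← Finset.mul_sum]
      simp only [nsmul_eq_mul]
      push_cast
      ring
    have hn : ((n : ℤ) + 1) ≠ 0 := by positivity
    rw [h, mul_left_comm, mul_right_inj' hn]
    constructor <;> intro h' <;> linarith
  constructor
  · rintro ⟨f, hf, rfl⟩ a ha
    obtain ⟨x, rfl, hx⟩ := exists_of_lcoeff_ne_zero (f := f) ha
    exact (key x).2 (hf x.1 x.2 hx)
  · intro h
    obtain ⟨f, hf, hf'⟩ := exists_reduced s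
    exact ⟨f, fun k j hj => (key (k, j)).1 (h _ (hf' (k, j) hj)), hf⟩

theorem SHomogeneous.mul {p q : ℤ} {s t : S n} (hs : SHomogeneous p s) (ht : SHomogeneous q t) :
    SHomogeneous (p + q) (s * t) := by
  rw [sHomogeneous_iff] at *
  intro a ha
  obtain ⟨b, c, hb, hc, rfl⟩ := exists_of_coeff_mul_ne_zero ha
  have h1 := hs b hb
  have h2 := ht c hc
  simp only [Pi.add_apply, Finset.sum_add_distrib]
  linarith

theorem sHomogeneous_lmono {a : Fin (n + 1) → ℤ} (ha : IsLat a) (c : ℝ) {p : ℤ}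
    (h : 2 * ∑ i, a i = (n + 1) * p) : SHomogeneous p (lmono a c) := by
  classical
  rw [sHomogeneous_iff]
  intro b hb
  rw [coeff_lmono ha] at hb
  rwa [show b = a by by_contra h; exact hb (if_neg h)]

end Valuations

/-! ### A matrix model of the Dirac module -/

section Model

variable {n : ℕ}

/-- The index set of a basis of the Dirac module: subsets of `{1, …, n}`, as vectors over
`ZMod 2`. -/
abbrev Idx (n : ℕ) : Type := Fin n → ZMod 2

/-- The class of a multi-index modulo two and modulo `(1, …, 1)`. The generator `eᵢ` maps the
basis vector with index `J` to a multiple of the one with index `J + parity (Pi.single i 1)`. -/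
def parity : (Fin (n + 1) → ℤ) →+ Idx n where
  toFun k j := ((k j.succ + k 0 : ℤ) : ZMod 2)
  map_zero' := by funext j; simp
  map_add' k l := by
    funext j
    simp only [Pi.add_apply]
    push_cast
    ring

/-- The representative of a parity class with entries in `{0, 1}` and zeroth entry `0`. -/
def lift (J : Idx n) : Fin (n + 1) → ℤ := Fin.cases 0 fun j => ((J j).val : ℤ)

@[simp] theorem lift_zero (J : Idx n) : lift J 0 = 0 := rfl

@[simp] theorem lift_succ (J : Idx n) (j : Fin n) : lift J j.succ = (J j).val := rfl

theorem parity_lift (J : Idx n) : parity (lift J) = J := by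
  funext j
  change ((lift J j.succ + lift J 0 : ℤ) : ZMod 2) = J j
  simp

theorem idx_add_self (J : Idx n) : J + J = 0 := by
  funext j
  exact CharTwo.add_self_eq_zero (J j)

theorem idx_add_add_cancel (J K : Idx n) : J + K + K = J := by
  rw [add_assoc, idx_add_self, add_zero]

theorem lift_idx_zero : lift (0 : Idx n) = 0 := by
  funext i
  refine Fin.cases rfl (fun j => ?_) i
  simp

/-- Half of `n + 1`, the exponent of `T ^ (1/2)`. -/
def half (n : ℕ) : ℤ := ((n : ℤ) + 1) / 2

theorem two_mul_half (hn : Odd n) : 2 * half n = (n : ℤ) + 1 := by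
  obtain ⟨m, rfl⟩ := hn
  rw [half]
  omega

/-- The exponent vector of the coefficient of an operator that shifts the weight by
`k / 2`, from the basis vector with index `J` to the one with index `J + parity k`. -/
def expo (k : Fin (n + 1) → ℤ) (J : Idx n) : Fin (n + 1) → ℤ :=
  fun i => half n * (lift J i + k i - lift (J + parity k) i)

theorem expo_add (k l : Fin (n + 1) → ℤ) (J : Idx n) :
    expo k J + expo l (J + parity k) = expo (k + l) J := by
  funext i
  simp only [expo, Pi.add_apply, map_add, add_assoc]
  ring

theorem expo_zero (J : Idx n) : expo 0 J = 0 := by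
  funext i
  simp [expo]

theorem isLat_expo (hn : Odd n) (k : Fin (n + 1) → ℤ) (J : Idx n) : IsLat (expo k J) := by
  refine Fin.cases (by simp) fun j => ?_
  have h : (2 : ℤ) ∣ (lift J j.succ + k j.succ - lift (J + parity k) j.succ) - k 0 := by
    rw [← Nat.cast_ofNat, ← ZMod.intCast_zmod_eq_zero_iff_dvd]
    have h1 : parity k j = ((k j.succ : ℤ) : ZMod 2) + ((k 0 : ℤ) : ZMod 2) := by
      rw [← Int.cast_add]; rfl
    have h2 : ((k 0 : ℤ) : ZMod 2) + ((k 0 : ℤ) : ZMod 2) = 0 := CharTwo.add_self_eq_zero _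
    simp only [lift_succ, Pi.add_apply]
    push_cast
    simp only [ZMod.natCast_val, ZMod.cast_id', id]
    rw [h1]
    linear_combination -h2
  obtain ⟨c, hc⟩ := h
  refine ⟨c, ?_⟩
  rw [← two_mul_half hn]
  simp only [expo, lift_zero]
  linear_combination half n * hc

/-! #### Signs -/

/-- The nontrivial character of `ZMod 2`. -/
def chi (x : ZMod 2) : ℤˣ := (-1) ^ x.val

theorem chi_add : ∀ x y : ZMod 2, chi (x + y) = chi x * chi y := by decide

theorem chi_zero : chi 0 = 1 := rfl

theorem chi_one : chi 1 = -1 := rfl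

/-- The exponents of the characters by which the signs of the generators change. -/
def charExp (i : Fin (n + 1)) : Fin n → ℕ :=
  Fin.cases (fun l : Fin n => (l : ℕ) + 1) (fun (j l : Fin n) => if l < j then 1 else 0) i

/-- The character by which the sign of the generator `eᵢ` changes. -/
def cha (i : Fin (n + 1)) (K : Idx n) : ℤˣ := ∏ l, chi (K l) ^ charExp i l

theorem cha_add (i : Fin (n + 1)) (J K : Idx n) : cha i (J + K) = cha i J * cha i K := by
  rw [cha, cha, cha, ← Finset.prod_mul_distrib]
  refine Finset.prod_congr rfl fun l _ => ?_
  rw [Pi.add_apply, chi_add, mul_pow]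

theorem cha_parity_succ (i : Fin (n + 1)) (l : Fin n) :
    cha i (parity (Pi.single l.succ 1)) = (-1) ^ charExp i l := by
  rw [cha, Finset.prod_eq_single l]
  · have : parity (Pi.single l.succ 1) l = 1 := by simp [parity]
    rw [this, chi_one]
  · intro m _ hm
    have : parity (Pi.single l.succ 1) m = 0 := by simp [parity, hm]
    rw [this, chi_zero, one_pow]
  · exact fun h => absurd (Finset.mem_univ l) h

theorem cha_parity_zero (i : Fin (n + 1)) :
    cha i (parity (Pi.single 0 1)) = (-1) ^ ∑ l, charExp i l := by
  rw [cha, ← Finset.prod_pow_eq_pow_sum]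
  refine Finset.prod_congr rfl fun l _ => ?_
  have : parity (Pi.single 0 1) l = 1 := by simp [parity]
  rw [this, chi_one]

theorem sum_charExp_succ (j : Fin n) : ∑ l, charExp j.succ l = j := by
  simp only [charExp, Fin.cases_succ]
  rw [Finset.sum_boole, Finset.filter_gt_eq_Iio, Fin.card_Iio]
  rfl

theorem sum_charExp_zero : ∑ l, charExp (0 : Fin (n + 1)) l = n * (n + 1) / 2 := by
  change ∑ l : Fin n, ((l : ℕ) + 1) = _
  rw [Fin.sum_univ_eq_sum_range (fun l => l + 1) n]
  have h := Finset.sum_range_id_mul_two (n + 1)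
  rw [Finset.sum_range_succ'] at h
  simp only [add_zero, Nat.add_sub_cancel] at h
  rw [mul_comm n]
  omega

/-- The generators anticommute: the signs in the two orders differ. -/
theorem cha_mul_cha {i l : Fin (n + 1)} (h : i ≠ l) :
    cha i (parity (Pi.single l 1)) * cha l (parity (Pi.single i 1)) = -1 := by
  have h0 : ∀ j : Fin n, cha 0 (parity (Pi.single j.succ 1)) * cha j.succ (parity (Pi.single 0 1)) =
      -1 := fun j => by
    rw [cha_parity_succ, cha_parity_zero, sum_charExp_succ, ← pow_add]
    exact Odd.neg_one_pow ⟨j, by simp only [charExp, Fin.cases_zero]; ring⟩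
  induction i using Fin.cases with
  | zero =>
    induction l using Fin.cases with
    | zero => exact absurd rfl h
    | succ l => exact h0 l
  | succ i =>
    induction l using Fin.cases with
    | zero => rw [mul_comm]; exact h0 i
    | succ l =>
      rw [cha_parity_succ, cha_parity_succ]
      simp only [charExp, Fin.cases_succ]
      rcases lt_or_gt_of_ne fun h' => h (congrArg Fin.succ h') with h1 | h1
      · rw [if_neg h1.not_gt, if_pos h1]; rfl
      · rw [if_pos h1, if_neg h1.not_gt]; rfl

/-- The sign in the action of `eᵢ` on the basis vector with index `J`; the parameter `κ` is
a common sign for `e₀`. -/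
def sg (κ : ℤˣ) (i : Fin (n + 1)) (J : Idx n) : ℤˣ := (if i = 0 then κ else 1) * cha i J

theorem sg_add (κ : ℤˣ) (i : Fin (n + 1)) (J K : Idx n) :
    sg κ i (J + K) = sg κ i J * cha i K := by
  rw [sg, sg, cha_add, mul_assoc]

theorem sg_anticomm (κ : ℤˣ) {i l : Fin (n + 1)} (h : i ≠ l) (J : Idx n) :
    sg κ l (J + parity (Pi.single i 1)) * sg κ i J =
      -(sg κ i (J + parity (Pi.single l 1)) * sg κ l J) := by
  have h1 := cha_mul_cha h
  have h2 : cha l (parity (Pi.single i 1)) = -cha i (parity (Pi.single l 1)) := by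
    rw [← mul_right_inj (cha i (parity (Pi.single l 1))), h1, mul_neg, Int.units_mul_self]
  rw [sg_add, sg_add, h2]
  rw [mul_neg, neg_mul]
  congr 1
  exact by rw [mul_right_comm, mul_comm (sg κ l J), mul_right_comm]

theorem sg_sq (κ : ℤˣ) (i : Fin (n + 1)) (J : Idx n) :
    sg κ i (J + parity (Pi.single i 1)) * sg κ i J =
      if i = 0 then (-1) ^ (n * (n + 1) / 2) else 1 := by
  rw [sg_add, mul_right_comm, Int.units_mul_self, one_mul]
  induction i using Fin.cases with
  | zero => rw [cha_parity_zero, sum_charExp_zero, if_pos rfl]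
  | succ j => rw [cha_parity_succ, if_neg (Fin.succ_ne_zero j)]; simp [charExp]

/-- A sign as a real number. -/
def rs : ℤˣ →* ℝ := (Int.castRingHom ℝ : ℤ →* ℝ).comp (Units.coeHom ℤ)

theorem rs_neg (u : ℤˣ) : rs (-u) = -rs u := by simp [rs]

theorem rs_mul_self (u : ℤˣ) : rs u * rs u = 1 := by
  rw [← map_mul, Int.units_mul_self, map_one]

theorem rs_ne_zero (u : ℤˣ) : rs u ≠ 0 := left_ne_zero_of_mul_eq_one (rs_mul_self u)

/-! #### The operators -/

/-- The coefficient of the operator `eᵢ` at the basis vector with index `J`. -/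
def opCoeff (κ : ℤˣ) (i : Fin (n + 1)) (J : Idx n) : S n :=
  lmono (expo (Pi.single i 1) J) (rs (sg κ i J))

theorem opCoeff_mul (hn : Odd n) (κ : ℤˣ) (i l : Fin (n + 1)) (J : Idx n) :
    opCoeff κ l (J + parity (Pi.single i 1)) * opCoeff κ i J =
      lmono (expo (Pi.single i 1 + Pi.single l 1) J)
        (rs (sg κ l (J + parity (Pi.single i 1)) * sg κ i J)) := by
  rw [opCoeff, opCoeff, lmono_mul (isLat_expo hn _ _) (isLat_expo hn _ _), add_comm, expo_add,
    map_mul]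

/-- The operator `eᵢ` in the model. -/
def op (κ : ℤˣ) (i : Fin (n + 1)) : (Idx n → S n) →ₗ[S n] (Idx n → S n) where
  toFun v I := opCoeff κ i (I + parity (Pi.single i 1)) * v (I + parity (Pi.single i 1))
  map_add' v w := by
    funext I
    simp only [Pi.add_apply, mul_add]
  map_smul' r v := by
    funext I
    simp only [Pi.smul_apply, smul_eq_mul, RingHom.id_apply, mul_left_comm]

theorem op_apply (κ : ℤˣ) (i : Fin (n + 1)) (v : Idx n → S n) (I : Idx n) :
    op κ i v I = opCoeff κ i (I + parity (Pi.single i 1)) * v (I + parity (Pi.single i 1)) := rfl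

theorem op_single (κ : ℤˣ) (i : Fin (n + 1)) (J : Idx n) (r : S n) :
    op κ i (Pi.single J r) = Pi.single (J + parity (Pi.single i 1)) (opCoeff κ i J * r) := by
  funext I
  rw [op_apply]
  by_cases h : I + parity (Pi.single i 1) = J
  · subst h
    rw [idx_add_add_cancel, Pi.single_eq_same, Pi.single_eq_same]
  · rw [Pi.single_eq_of_ne h, mul_zero, Pi.single_eq_of_ne]
    rintro rfl
    exact h (idx_add_add_cancel _ _)

theorem op_op (hn : Odd n) (κ : ℤˣ) (i l : Fin (n + 1)) (v : Idx n → S n) (I : Idx n) :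
    op κ l (op κ i v) I =
      lmono (expo (Pi.single i 1 + Pi.single l 1) (I + parity (Pi.single l 1) + parity (Pi.single i 1)))
        (rs (sg κ l (I + parity (Pi.single l 1)) *
          sg κ i (I + parity (Pi.single l 1) + parity (Pi.single i 1)))) *
        v (I + parity (Pi.single l 1) + parity (Pi.single i 1)) := by
  rw [op_apply, op_apply, ← mul_assoc]
  have h := opCoeff_mul hn κ i l (I + parity (Pi.single l 1) + parity (Pi.single i 1))
  rw [idx_add_add_cancel] at h
  rw [h]

theorem op_anticomm (hn : Odd n) (κ : ℤˣ) {i l : Fin (n + 1)} (h : i ≠ l) (v : Idx n → S n) :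
    op κ i (op κ l v) = -op κ l (op κ i v) := by
  funext I
  rw [Pi.neg_apply, op_op hn, op_op hn]
  have h2 := sg_anticomm κ h (I + parity (Pi.single l 1) + parity (Pi.single i 1))
  have h3 : I + parity (Pi.single l 1) + parity (Pi.single i 1) + parity (Pi.single l 1) =
      I + parity (Pi.single i 1) := by
    rw [add_right_comm, idx_add_add_cancel]
  rw [idx_add_add_cancel, h3] at h2
  rw [add_right_comm I (parity (Pi.single i 1)), h2, add_comm (Pi.single l 1 : Fin (n + 1) → ℤ),
    rs_neg, ← neg_mul]
  congr 1
  rw [eq_neg_iff_add_eq_zero, ← lmono_add, add_neg_cancel, lmono_zero]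

theorem op_sq (hn : Odd n) (κ : ℤˣ) (i : Fin (n + 1)) (v : Idx n → S n) :
    op κ i (op κ i v) = z n i • v := by
  funext I
  have h2 := sg_sq κ i I
  have h3 : (Pi.single i 1 + Pi.single i 1 : Fin (n + 1) → ℤ) = Pi.single i 2 := by
    rw [← Pi.single_add]; rfl
  have h4 : expo (Pi.single i 1 + Pi.single i 1) I = Pi.single i ((n : ℤ) + 1) := by
    funext l
    have h5 : parity (Pi.single i 2) = (0 : Idx n) := by
      rw [← h3, map_add, idx_add_self]
    rw [h3, expo, h5, add_zero, add_sub_cancel_left, ← two_mul_half hn]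
    rcases eq_or_ne l i with rfl | h
    · simp [mul_comm]
    · simp [h]
  rw [op_op hn, idx_add_add_cancel, h2, Pi.smul_apply, smul_eq_mul, z_eq, h4]
  congr 2
  split_ifs <;> simp [rs]

/-- The sign in the action of a word in the generators. -/
def wordSign (κ : ℤˣ) : List (Fin (n + 1)) → ℤˣ
  | [] => 1
  | i :: w => sg κ i (parity fun l => (w.count l : ℤ)) * wordSign κ w

/-- The number of occurrences of each letter in a word. -/
def cnt (w : List (Fin (n + 1))) : Fin (n + 1) → ℤ := fun l => (w.count l : ℤ)

theorem cnt_cons (i : Fin (n + 1)) (w : List (Fin (n + 1))) :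
    cnt (i :: w) = cnt w + Pi.single i 1 := by
  funext l
  rcases eq_or_ne l i with rfl | h
  · simp [cnt]
  · simp [cnt, h, h.symm]

theorem cnt_nil : cnt ([] : List (Fin (n + 1))) = 0 := by
  funext l
  simp [cnt]

theorem op_word (hn : Odd n) (κ : ℤˣ) (w : List (Fin (n + 1))) :
    (w.map (op κ)).prod (Pi.single 0 1) =
      Pi.single (parity (cnt w)) (lmono (expo (cnt w) 0) (rs (wordSign κ w))) := by
  induction w with
  | nil => rw [cnt_nil, map_zero, expo_zero, wordSign, map_one, lmono_zero_one]; rfl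
  | cons i w ih =>
    rw [List.map_cons, List.prod_cons, Module.End.mul_apply, ih, op_single, cnt_cons, map_add,
      wordSign, opCoeff, lmono_mul (isLat_expo hn _ _) (isLat_expo hn _ _), ← expo_add, zero_add,
      add_comm (expo (Pi.single i 1) _), ← map_mul rs]
    rfl

end Model

/-! ### The Clifford action on the model and a basis of the Dirac module -/

section Representation

variable {n : ℕ}

/-- The linear map to which the Clifford representation on the model is associated. -/
def opLin (κ : ℤˣ) : (Fin (n + 1) → S n) →ₗ[S n] Module.End (S n) (Idx n → S n) :=
  Fintype.linearCombination (S n) (op κ)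

theorem opLin_mul_self (hn : Odd n) (κ : ℤˣ) (x : Fin (n + 1) → S n) :
    opLin κ x * opLin κ x = algebraMap (S n) (Module.End (S n) (Idx n → S n)) (form n x) := by
  refine LinearMap.ext fun v => ?_
  have h1 : ∀ w : Idx n → S n, opLin κ x w = ∑ i, x i • op κ i w := fun w => by
    rw [opLin, Fintype.linearCombination_apply, LinearMap.sum_apply]
    rfl
  have h2 : ∀ i l, x i • op κ i (x l • op κ l v) + x l • op κ l (x i • op κ i v) =
      if i = l then (2 * (x i * x i * z n i)) • v else 0 := by
    intro i l
    rw [map_smul, map_smul, smul_smul, smul_smul, mul_comm (x l)]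
    split_ifs with h
    · subst h
      rw [op_sq hn, smul_smul, two_mul, add_smul]
    · rw [op_anticomm hn κ h, smul_neg, neg_add_cancel]
  have h3 : (2 : ℝ) • ∑ i, ∑ l, x i • op κ i (x l • op κ l v) =
      (2 : ℝ) • ∑ i, (x i * x i * z n i) • v := by
    rw [two_smul, two_smul]
    conv_lhs => arg 2; rw [Finset.sum_comm]
    rw [← Finset.sum_add_distrib, ← Finset.sum_add_distrib]
    refine Finset.sum_congr rfl fun i _ => ?_
    rw [← Finset.sum_add_distrib, Finset.sum_congr rfl fun l _ => h2 i l, Finset.sum_ite_eq,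
      if_pos (Finset.mem_univ i), two_mul, add_smul]
  have h4 := smul_right_injective (Idx n → S n) (two_ne_zero (α := ℝ)) h3
  rw [Module.End.mul_apply, h1, h1]
  rw [show ∑ i, x i • op κ i (∑ l, x l • op κ l v) = ∑ i, ∑ l, x i • op κ i (x l • op κ l v) from
    Finset.sum_congr rfl fun i _ => by rw [map_sum, Finset.smul_sum], h4, ← Finset.sum_smul,
    Module.algebraMap_end_apply, form, QuadraticMap.weightedSumSquares_apply]
  congr 1
  refine Finset.sum_congr rfl fun i _ => ?_
  rw [smul_eq_mul, mul_comm]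

/-- The representation of the Clifford algebra on the model. -/
def rep (hn : Odd n) (κ : ℤˣ) : Cl n →ₐ[S n] Module.End (S n) (Idx n → S n) :=
  CliffordAlgebra.lift (form n) ⟨opLin κ, opLin_mul_self hn κ⟩

theorem rep_e (hn : Odd n) (κ : ℤˣ) (i : Fin (n + 1)) : rep hn κ (e n i) = op κ i := by
  rw [e, rep, CliffordAlgebra.lift_ι_apply, opLin]
  simp

/-- The word `e₁ ⋯ eₙ`. -/
def topWord (n : ℕ) : List (Fin (n + 1)) := List.ofFn Fin.succ

theorem cnt_topWord_succ (j : Fin n) : cnt (topWord n) j.succ = 1 := by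
  have h1 : (topWord n).Nodup := List.nodup_ofFn.2 (Fin.succ_injective n)
  have h2 : j.succ ∈ topWord n := List.mem_ofFn.2 ⟨j, rfl⟩
  rw [cnt, List.count_eq_one_of_mem h1 h2]
  rfl

theorem cnt_topWord_zero : cnt (topWord n) 0 = 0 := by
  have h2 : (0 : Fin (n + 1)) ∉ topWord n := fun h => by
    obtain ⟨j, hj⟩ := List.mem_ofFn.1 h
    exact Fin.succ_ne_zero j hj
  rw [cnt, List.count_eq_zero_of_not_mem h2]
  rfl

theorem wordSign_eq_of_notMem (κ κ' : ℤˣ) (w : List (Fin (n + 1))) (h : (0 : Fin (n + 1)) ∉ w) :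
    wordSign κ w = wordSign κ' w := by
  induction w with
  | nil => rfl
  | cons i w ih =>
    rw [List.mem_cons, not_or] at h
    rw [wordSign, wordSign, ih h.2, sg, sg, if_neg (Ne.symm h.1), if_neg (Ne.symm h.1)]

/-- For a suitable sign, the relation of the Dirac module holds for the zeroth basis vector of
the model. -/
theorem exists_sign (hn : Odd n) (ε : ℤˣ) : ∃ κ : ℤˣ,
    rep hn κ ((ε : ℤ) • (List.ofFn (e n)).prod -
      algebraMap (S n) (Cl n) (novToS n (Tpow ((n + 1) / 2)))) (Pi.single 0 1) = 0 := by
  have h0 : (0 : Fin (n + 1)) ∉ topWord n := fun h => by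
    obtain ⟨j, hj⟩ := List.mem_ofFn.1 h
    exact Fin.succ_ne_zero j hj
  refine ⟨ε * wordSign 1 (0 :: topWord n), ?_⟩
  set κ := ε * wordSign 1 (0 :: topWord n) with hκ
  have hw : List.ofFn (e n) = ((0 : Fin (n + 1)) :: topWord n).map (e n) := by
    rw [List.ofFn_succ, List.map_cons, topWord, List.map_ofFn]
    rfl
  have h1 : ((List.ofFn (e n)).map (rep hn κ)) = ((0 : Fin (n + 1)) :: topWord n).map (op κ) := by
    rw [hw, List.map_map]
    exact List.map_congr_left fun i _ => rep_e hn κ i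
  have hs : (ε : ℤˣ) * wordSign κ (0 :: topWord n) = 1 := by
    have h2 : wordSign κ (0 :: topWord n) = κ * wordSign 1 (0 :: topWord n) := by
      rw [wordSign, wordSign, wordSign_eq_of_notMem κ 1 _ h0, sg, sg, if_pos rfl, if_pos rfl, one_mul,
        mul_assoc]
    rw [h2, ← mul_assoc, hκ, ← mul_assoc, Int.units_mul_self, one_mul, Int.units_mul_self]
  have hc : cnt ((0 : Fin (n + 1)) :: topWord n) = fun _ => 1 := by
    funext i
    rw [cnt_cons]
    refine Fin.cases ?_ (fun j => ?_) i
    · simp [cnt_topWord_zero]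
    · simp [cnt_topWord_succ]
  have hp : parity (fun _ : Fin (n + 1) => (1 : ℤ)) = 0 := by
    funext j
    change (((1 : ℤ) + 1 : ℤ) : ZMod 2) = 0
    decide
  have hx : expo (fun _ : Fin (n + 1) => (1 : ℤ)) 0 = fun _ => half n := by
    funext i
    rw [expo, hp, add_zero, add_sub_cancel_left, mul_one]
  rw [map_sub, map_zsmul, map_list_prod, h1, LinearMap.sub_apply, LinearMap.smul_apply,
    op_word hn, AlgHom.commutes, Module.algebraMap_end_apply, hc, hp, hx, novToS_Tpow,
    ← Pi.single_smul, ← Pi.single_smul, smul_eq_mul, mul_one, sub_eq_zero]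
  congr 1
  apply hat_injective
  rw [map_zsmul, hat_lmono fun i => by simp, hat_lmono fun i => by simp]
  ext a
  have h3 : (((ε : ℤ) : ℝ) * rs (wordSign κ (0 :: topWord n))) = 1 := by
    have := congrArg rs hs
    rwa [map_mul, map_one] at this
  rw [HahnSeries.coeff_smul, zsmul_eq_mul, HahnSeries.coeff_single, HahnSeries.coeff_single]
  by_cases h : a = fun _ => half n
  · rw [if_pos h]
    exact h3.trans (if_pos h).symm
  · rw [if_neg h, mul_zero]
    exact (if_neg h).symm

/-- The class of `1` in the Dirac module. -/
def vac (n : ℕ) (ε : ℤˣ) : DiracModule n ε := Submodule.Quotient.mk 1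

/-- The representation on the model descends to a map from the Dirac module. -/
theorem exists_toModel (hn : Odd n) (ε : ℤˣ) : ∃ (κ : ℤˣ) (π : DiracModule n ε →ₗ[S n] (Idx n → S n)),
    π (vac n ε) = Pi.single 0 1 ∧ ∀ i m, π (e n i • m) = op κ i (π m) := by
  obtain ⟨κ, hκ⟩ := exists_sign hn ε
  set f : Cl n →ₗ[S n] (Idx n → S n) :=
    (LinearMap.applyₗ (Pi.single 0 1)).comp (rep hn κ).toLinearMap with hf
  have hfa : ∀ c, f c = rep hn κ c (Pi.single 0 1) := fun c => rfl
  have hfm : ∀ c d, f (c * d) = rep hn κ c (f d) := fun c d => by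
    rw [hfa, hfa, map_mul, Module.End.mul_apply]
  have h : (diracIdeal n ε).restrictScalars (S n) ≤ LinearMap.ker f := fun c hc => by
    rw [Submodule.restrictScalars_mem, diracIdeal] at hc
    rw [LinearMap.mem_ker]
    induction hc using Submodule.span_induction with
    | mem x hx => rw [Set.mem_singleton_iff.1 hx]; exact hκ
    | zero => exact map_zero f
    | add x y _ _ hx hy => rw [map_add, hx, hy, add_zero]
    | smul a x _ hx => rw [smul_eq_mul, hfm, hx, map_zero]
  refine ⟨κ, (Submodule.liftQ _ f h).comp
    (Submodule.Quotient.restrictScalarsEquiv (S n) (diracIdeal n ε)).symm.toLinearMap, ?_, ?_⟩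
  · change f 1 = _
    rw [hfa, map_one]
    rfl
  · intro i m
    obtain ⟨c, rfl⟩ := Submodule.Quotient.mk_surjective _ m
    change f (e n i * c) = op κ i (f c)
    rw [hfm, rep_e]

/-! #### Spanning -/

theorem form_apply (x : Fin (n + 1) → S n) : form n x = ∑ i, z n i • (x i * x i) := by
  rw [form, QuadraticMap.weightedSumSquares_apply]

theorem e_mul_self (i : Fin (n + 1)) : e n i * e n i = algebraMap (S n) (Cl n) (z n i) := by
  rw [e, CliffordAlgebra.ι_sq_scalar, form_apply]
  congr 1
  rw [Finset.sum_eq_single i (fun j _ hj => by simp [hj]) (by simp)]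
  simp

theorem e_mul_e {i l : Fin (n + 1)} (h : i ≠ l) : e n i * e n l = -(e n l * e n i) := by
  rw [eq_neg_iff_add_eq_zero, e, e, CliffordAlgebra.ι_mul_ι_add_swap, QuadraticMap.polar,
    form_apply, form_apply, form_apply]
  rw [← Finset.sum_sub_distrib, ← Finset.sum_sub_distrib, Finset.sum_eq_zero, map_zero]
  intro j _
  rcases eq_or_ne j i with rfl | hj
  · simp [h]
  · simp [hj]

/-- The span of the products of subwords of a word in `e₁, …, eₙ`, applied to the class of `1`. -/
def wordSpan (ε : ℤˣ) : List (Fin n) → Submodule (S n) (DiracModule n ε)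
  | [] => Submodule.span (S n) {vac n ε}
  | i :: L => wordSpan ε L ⊔ (wordSpan ε L).map (Algebra.lsmul (S n) (S n) (DiracModule n ε) (e n i.succ))

theorem e_smul_e_smul (ε : ℤˣ) (i : Fin (n + 1)) (m : DiracModule n ε) :
    e n i • e n i • m = z n i • m := by
  rw [smul_smul, e_mul_self, algebraMap_smul]

theorem e_smul_e_smul_of_ne (ε : ℤˣ) {i l : Fin (n + 1)} (h : i ≠ l) (m : DiracModule n ε) :
    e n i • e n l • m = -(e n l • e n i • m) := by
  rw [smul_smul, e_mul_e h, neg_smul, smul_smul]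

theorem mem_wordSpan_cons {ε : ℤˣ} {i : Fin n} {L : List (Fin n)} {m : DiracModule n ε} :
    m ∈ wordSpan ε (i :: L) ↔ ∃ y ∈ wordSpan ε L, ∃ y' ∈ wordSpan ε L, y + e n i.succ • y' = m := by
  rw [wordSpan, Submodule.mem_sup]
  simp only [Submodule.mem_map]
  constructor
  · rintro ⟨y, hy, _, ⟨y', hy', rfl⟩, rfl⟩
    exact ⟨y, hy, y', hy', rfl⟩
  · rintro ⟨y, hy, y', hy', rfl⟩
    exact ⟨y, hy, _, ⟨y', hy', rfl⟩, rfl⟩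

theorem smul_mem_wordSpan (ε : ℤˣ) (L : List (Fin n)) (i : Fin n) (hi : i ∈ L)
    (m : DiracModule n ε) (hm : m ∈ wordSpan ε L) : e n i.succ • m ∈ wordSpan ε L := by
  induction L generalizing m with
  | nil => simp at hi
  | cons j L ih =>
    obtain ⟨y, hy, y', hy', rfl⟩ := mem_wordSpan_cons.1 hm
    rw [mem_wordSpan_cons]
    by_cases h : i = j
    · subst h
      refine ⟨z n i.succ • y', Submodule.smul_mem _ _ hy', y, hy, ?_⟩
      rw [smul_add, e_smul_e_smul, add_comm]
    · have hi' := (List.mem_cons.1 hi).resolve_left h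
      refine ⟨_, ih hi' y hy, -(e n i.succ • y'), neg_mem (ih hi' y' hy'), ?_⟩
      rw [smul_add, smul_neg, ← e_smul_e_smul_of_ne ε fun h' => h (Fin.succ_injective n h')]

theorem vac_mem_wordSpan (ε : ℤˣ) (L : List (Fin n)) : vac n ε ∈ wordSpan ε L := by
  induction L with
  | nil => exact Submodule.mem_span_singleton_self _
  | cons j L ih => exact mem_wordSpan_cons.2 ⟨_, ih, 0, zero_mem _, by rw [smul_zero, add_zero]⟩

theorem word_smul_vac_mem (ε : ℤˣ) (L w : List (Fin n)) (hw : ∀ i ∈ w, i ∈ L) :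
    (w.map fun i => e n i.succ).prod • vac n ε ∈ wordSpan ε L := by
  induction w with
  | nil => rw [List.map_nil, List.prod_nil, one_smul]; exact vac_mem_wordSpan ε L
  | cons i w ih =>
    rw [List.map_cons, List.prod_cons, mul_smul]
    exact smul_mem_wordSpan ε L i (hw i List.mem_cons_self) _
      (ih fun j hj => hw j (List.mem_cons_of_mem i hj))

/-- The relation of the Dirac module expresses `e₀` on the class of `1` through `e₁, …, eₙ`, since
`T ^ (1/2)` is invertible. -/
theorem e_zero_smul_vac_mem (ε : ℤˣ) : e n 0 • vac n ε ∈ wordSpan ε (List.finRange n) := by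
  set u : DiracModule n ε := ((List.finRange n).map fun i => e n i.succ).prod • vac n ε with hu
  have hu' : u ∈ wordSpan ε (List.finRange n) := word_smul_vac_mem ε _ _ fun i hi => hi
  set τ := novToS n (Tpow ((n + 1) / 2)) with hτ
  have h1 : (ε : ℤ) • e n 0 • u = τ • vac n ε := by
    have h2 : ((ε : ℤ) • (List.ofFn (e n)).prod - algebraMap (S n) (Cl n) τ) • vac n ε = 0 := by
      change (Submodule.Quotient.mk (_ * 1) : DiracModule n ε) = 0
      rw [mul_one, Submodule.Quotient.mk_eq_zero]
      exact Submodule.mem_span_singleton_self _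
    rw [sub_smul, sub_eq_zero, algebraMap_smul] at h2
    rw [← h2, smul_assoc, List.ofFn_succ, List.prod_cons, hu, mul_smul, List.ofFn_eq_map]
  have h3 : τ • e n 0 • vac n ε ∈ wordSpan ε (List.finRange n) := by
    have h4 : τ • e n 0 • vac n ε = (ε : ℤ) • z n 0 • u := by
      rw [smul_comm τ, ← h1, smul_comm (e n 0) (ε : ℤ), e_smul_e_smul]
    rw [h4]
    exact Submodule.smul_of_tower_mem _ _ (Submodule.smul_mem _ _ hu')
  have h5 : novToS n (Tpow (-((n + 1) / 2))) * τ = 1 := by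
    rw [hτ, ← map_mul, Tpow, Tpow, HahnSeries.single_mul_single, neg_add_cancel, mul_one]
    exact map_one _
  have h6 := Submodule.smul_mem _ (novToS n (Tpow (-((n + 1) / 2)))) h3
  have h7 : novToS n (Tpow (-((n + 1) / 2))) • τ • e n 0 • vac n ε = e n 0 • vac n ε := by
    refine (mul_smul (novToS n (Tpow (-((n + 1) / 2)))) τ (e n 0 • vac n ε)).symm.trans ?_
    rw [h5]
    exact one_smul (S n) _
  exact h7 ▸ h6

theorem e_zero_smul_mem (ε : ℤˣ) (L : List (Fin n)) (m : DiracModule n ε) (hm : m ∈ wordSpan ε L) :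
    e n 0 • m ∈ wordSpan ε (List.finRange n) := by
  induction L generalizing m with
  | nil =>
    obtain ⟨r, rfl⟩ := Submodule.mem_span_singleton.1 hm
    rw [smul_comm]
    exact Submodule.smul_mem _ _ (e_zero_smul_vac_mem ε)
  | cons j L ih =>
    obtain ⟨y, hy, y', hy', rfl⟩ := mem_wordSpan_cons.1 hm
    rw [smul_add, e_smul_e_smul_of_ne ε (Fin.succ_ne_zero j).symm]
    exact add_mem (ih y hy) (neg_mem (smul_mem_wordSpan ε _ j (List.mem_finRange j) _ (ih y' hy')))

/-- The words in `e₁, …, eₙ` span the Dirac module: their span contains the class of `1` and is stable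
under all generators. -/
theorem wordSpan_eq_top (ε : ℤˣ) : wordSpan ε (List.finRange n) = ⊤ := by
  have key : ∀ (c : Cl n), ∀ m ∈ wordSpan ε (List.finRange n), c • m ∈ wordSpan ε (List.finRange n) := by
    intro c
    induction c using CliffordAlgebra.induction with
    | algebraMap r => 
      intro m hm
      rw [algebraMap_smul]
      exact Submodule.smul_mem _ _ hm
    | ι x =>
      intro m hm
      have h1 : CliffordAlgebra.ι (form n) x = ∑ i, x i • e n i := by
        conv_lhs => rw [pi_eq_sum_univ' x]
        rw [map_sum]
        refine Finset.sum_congr rfl fun i _ => ?_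
        rw [map_smul, e]
      rw [h1, Finset.sum_smul]
      refine sum_mem fun i _ => ?_
      rw [smul_assoc]
      refine Submodule.smul_mem _ _ ?_
      refine Fin.cases (e_zero_smul_mem ε _ m hm) (fun j => ?_) i
      exact smul_mem_wordSpan ε _ j (List.mem_finRange j) m hm
    | mul a b ha hb => exact fun m hm => by rw [mul_smul]; exact ha _ (hb m hm)
    | add a b ha hb => exact fun m hm => by rw [add_smul]; exact add_mem (ha m hm) (hb m hm)
  rw [eq_top_iff]
  intro m _
  obtain ⟨c, rfl⟩ := Submodule.Quotient.mk_surjective _ m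
  have h := key c _ (vac_mem_wordSpan ε _)
  rwa [show c • vac n ε = Submodule.Quotient.mk c from
    congrArg Submodule.Quotient.mk (mul_one c)] at h

/-- The increasing word in `e₁, …, eₙ` with letters the elements of `J`, from a list of candidates. -/
def subword (L : List (Fin n)) (J : Idx n) : List (Fin (n + 1)) :=
  (L.filter fun i => J i ≠ 0).map Fin.succ

theorem wordSpan_le (ε : ℤˣ) (L : List (Fin n)) (hL : L.Nodup) : wordSpan ε L ≤
    Submodule.span (S n) (Set.range fun J => ((subword L J).map (e n)).prod • vac n ε) := by
  induction L with
  | nil =>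
    refine Submodule.span_mono ?_
    rintro _ rfl
    exact ⟨0, by simp [subword]⟩
  | cons i L ih =>
    rw [List.nodup_cons] at hL
    have hupd : ∀ (J : Idx n) (c : ZMod 2), subword L (Function.update J i c) = subword L J := by
      intro J c
      rw [subword, subword]
      congr 1
      refine List.filter_congr fun j hj => ?_
      rw [Function.update_of_ne]
      rintro rfl
      exact hL.1 hj
    rw [wordSpan, sup_le_iff, Submodule.map_le_iff_le_comap]
    constructor
    · refine (ih hL.2).trans (Submodule.span_le.2 ?_)
      rintro _ ⟨J, rfl⟩
      refine Submodule.subset_span ⟨Function.update J i 0, ?_⟩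
      have : subword (i :: L) (Function.update J i 0) = subword L J := by
        rw [← hupd J 0, subword, List.filter_cons_of_neg (by simp)]
        rfl
      simp only [this]
    · refine (ih hL.2).trans (Submodule.span_le.2 ?_)
      rintro _ ⟨J, rfl⟩
      refine Submodule.subset_span ⟨Function.update J i 1, ?_⟩
      have : subword (i :: L) (Function.update J i 1) = i.succ :: subword L J := by
        rw [← hupd J 1, subword, List.filter_cons_of_pos (by simp)]
        rfl
      simp only [this, List.map_cons, List.prod_cons, mul_smul]
      rfl

/-- The word whose letters are the elements of `J` in increasing order. -/
def idxWord (J : Idx n) : List (Fin (n + 1)) := subword (List.finRange n) J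

theorem cnt_idxWord (J : Idx n) : cnt (idxWord J) = lift J := by
  funext l
  refine Fin.cases ?_ (fun j => ?_) l
  · have h2 : (0 : Fin (n + 1)) ∉ idxWord J := fun h => by
      obtain ⟨j, -, hj⟩ := List.mem_map.1 h
      exact Fin.succ_ne_zero j hj
    rw [cnt, List.count_eq_zero_of_not_mem h2]
    rfl
  · rw [cnt, idxWord, subword, List.count_map_of_injective _ _ (Fin.succ_injective n), lift_succ]
    by_cases h : J j = 0
    · rw [List.count_eq_zero_of_not_mem (by simp [h]), h]
      rfl
    · have h1 : J j = 1 := by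
        have : ∀ x : ZMod 2, x ≠ 0 → x = 1 := by decide
        exact this _ h
      rw [List.count_filter (by simpa using h),
        List.count_eq_one_of_mem (List.nodup_finRange n) (List.mem_finRange j), h1]
      rfl

theorem map_word (hn : Odd n) {ε κ : ℤˣ} {π : DiracModule n ε →ₗ[S n] (Idx n → S n)}
    (h0 : π (vac n ε) = Pi.single 0 1) (he : ∀ i m, π (e n i • m) = op κ i (π m))
    (w : List (Fin (n + 1))) : π ((w.map (e n)).prod • vac n ε) =
      Pi.single (parity (cnt w)) (lmono (expo (cnt w) 0) (rs (wordSign κ w))) := by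
  rw [← op_word hn κ w]
  induction w with
  | nil => rw [List.map_nil, List.prod_nil, one_smul, h0]; rfl
  | cons i w ih => 
    rw [List.map_cons, List.prod_cons, mul_smul, he, ih, List.map_cons, List.prod_cons]
    rfl

theorem expo_lift (J : Idx n) : expo (lift J) 0 = 0 := by
  funext i
  rw [expo, zero_add, parity_lift, lift_idx_zero]
  simp

/-- The Dirac module has a basis on which the generators act by the monomial matrices of the
model. -/
theorem exists_basis (hn : Odd n) (ε : ℤˣ) :
    ∃ (κ : ℤˣ) (b : Module.Basis (Idx n) (S n) (DiracModule n ε)),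
      (∀ i J, e n i • b J = opCoeff κ i J • b (J + parity (Pi.single i 1))) ∧
      ∀ w : List (Fin (n + 1)), (w.map (e n)).prod • vac n ε =
        lmono (expo (cnt w) 0) (rs (wordSign κ w)) • b (parity (cnt w)) := by
  obtain ⟨κ, π, h0, he⟩ := exists_toModel hn ε
  have hq : ∀ J, π (((idxWord J).map (e n)).prod • vac n ε) =
      Pi.single J (lmono 0 (rs (wordSign κ (idxWord J)))) := fun J => by
    rw [map_word hn h0 he, cnt_idxWord, parity_lift, expo_lift]
  have hunit : ∀ u : ℤˣ, (lmono 0 (rs u) : S n) * lmono 0 (rs u) = 1 := fun u => by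
    rw [lmono_mul (fun i => by simp) (fun i => by simp), rs_mul_self, add_zero, lmono_zero_one]
  have hbij : Function.Bijective π := by
    constructor
    · rw [injective_iff_map_eq_zero]
      intro m hm
      have hm' : m ∈ Submodule.span (S n) (Set.range fun J =>
          ((idxWord J).map (e n)).prod • vac n ε) := by
        refine wordSpan_le ε _ (List.nodup_finRange n) ?_
        rw [wordSpan_eq_top]
        trivial
      obtain ⟨r, rfl⟩ := (Submodule.mem_span_range_iff_exists_fun _).1 hm'
      refine Finset.sum_eq_zero fun J _ => ?_
      have h1 := congrFun hm J
      rw [map_sum, Finset.sum_apply, Finset.sum_eq_single J] at h1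
      · rw [map_smul, hq, Pi.smul_apply, Pi.single_eq_same, Pi.zero_apply, smul_eq_mul] at h1
        have h2 : r J = 0 := by
          rw [← mul_one (r J), ← hunit (wordSign κ (idxWord J)), ← mul_assoc, h1, zero_mul]
        have h3 : ∀ m : DiracModule n ε, (0 : S n) • m = 0 := fun m => zero_smul (S n) m
        rw [h2]
        exact h3 _
      · intro I _ hI
        rw [map_smul, hq, Pi.smul_apply, Pi.single_eq_of_ne hI.symm, smul_zero]
      · exact fun h => absurd (Finset.mem_univ J) h
    · intro v
      refine ⟨∑ J, (v J * lmono 0 (rs (wordSign κ (idxWord J)))) •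
        ((idxWord J).map (e n)).prod • vac n ε, ?_⟩
      rw [map_sum]
      funext I
      rw [Finset.sum_apply, Finset.sum_eq_single I]
      · rw [map_smul, hq, Pi.smul_apply, Pi.single_eq_same, smul_eq_mul, mul_assoc, hunit, mul_one]
      · intro J _ hJ
        rw [map_smul, hq, Pi.smul_apply, Pi.single_eq_of_ne hJ.symm, smul_zero]
      · exact fun h => absurd (Finset.mem_univ I) h
  set E := LinearEquiv.ofBijective π hbij with hE
  set b := Module.Basis.ofEquivFun E with hb
  have hπb : ∀ J, π (b J) = Pi.single J 1 := fun J => by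
    change E (b J) = _
    rw [hb, Module.Basis.coe_ofEquivFun, LinearEquiv.apply_symm_apply]
  refine ⟨κ, b, fun i J => hbij.1 ?_, fun w => hbij.1 ?_⟩
  · rw [he, hπb, op_single, map_smul, hπb, ← Pi.single_smul]
    rfl
  · rw [map_word hn h0 he, map_smul, hπb, ← Pi.single_smul, smul_eq_mul, mul_one]

end Representation

/-! ### The Dirac module as a matrix factorization -/

section DiracBasis

variable {n : ℕ} {ε κ : ℤˣ}

/-- The exponent vector of the valuation of a basis vector. -/
def shift (J : Idx n) : Fin (n + 1) → ℤ := fun i => half n * lift J i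

/-- The degree of a basis vector. -/
def deg (J : Idx n) : ℤ := ∑ i, lift J i

/-- A basis of the Dirac module on which the generators act by the monomial matrices of the
model, together with the resulting action of words. -/
structure IsDiracBasis (κ : ℤˣ) (b : Module.Basis (Idx n) (S n) (DiracModule n ε)) : Prop where
  e_smul : ∀ i J, e n i • b J = opCoeff κ i J • b (J + parity (Pi.single i 1))
  word_smul : ∀ w : List (Fin (n + 1)), (w.map (e n)).prod • vac n ε =
    lmono (expo (cnt w) 0) (rs (wordSign κ w)) • b (parity (cnt w))

theorem exists_isDiracBasis (hn : Odd n) (ε : ℤˣ) :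
    ∃ (κ : ℤˣ) (b : Module.Basis (Idx n) (S n) (DiracModule n ε)), IsDiracBasis κ b := by
  obtain ⟨κ, b, h1, h2⟩ := exists_basis hn ε
  exact ⟨κ, b, h1, h2⟩

theorem scalar_smul_smul (r s : S n) (m : DiracModule n ε) : r • s • m = (r * s) • m :=
  (mul_smul r s m).symm

theorem toM_single (w : List (Fin (n + 1))) (s : S n) :
    toM n ε (Finsupp.single w s) = s • (w.map (e n)).prod • vac n ε := by
  have h : toCl n (Finsupp.single w s) = s • (w.map (e n)).prod := by
    rw [toCl, Finsupp.linearCombination_single]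
  change (Submodule.Quotient.mk (toCl n (Finsupp.single w s)) : DiracModule n ε) =
    Submodule.Quotient.mk (s • ((w.map (e n)).prod * 1))
  rw [h, mul_one]

theorem expo_cnt_add_shift (w : List (Fin (n + 1))) :
    expo (cnt w) 0 + shift (parity (cnt w)) = fun i => half n * cnt w i := by
  funext i
  simp only [Pi.add_apply, expo, shift, lift_idx_zero, Pi.zero_apply, zero_add]
  ring

theorem wt_half_mul (hn : Odd n) (ζ : Simplex n) (k : Fin (n + 1) → ℤ) :
    wt ζ (fun i => half n * k i) = ∑ i, (k i : ℝ) / 2 * ζ.1 i := by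
  have h1 : (2 : ℝ) * half n = n + 1 := by exact_mod_cast two_mul_half hn
  rw [wt, div_eq_iff (by positivity), Finset.sum_mul]
  refine Finset.sum_congr rfl fun i _ => ?_
  rw [← h1]
  push_cast
  ring

theorem sum_word (hn : Odd n) (ζ : Simplex n) (w : List (Fin (n + 1))) :
    (w.map fun i => ζ.1 i / 2).sum = wt ζ (fun i => half n * cnt w i) := by
  rw [wt_half_mul hn]
  induction w with
  | nil => simp [cnt_nil]
  | cons i w ih =>
    rw [List.map_cons, List.sum_cons, ih, cnt_cons]
    simp only [Pi.add_apply, Int.cast_add, add_div, add_mul, Finset.sum_add_distrib]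
    rw [add_comm]
    congr 1
    rw [Finset.sum_eq_single i (fun j _ hj => by simp [hj]) (by simp)]
    simp
    ring

theorem length_eq_sum_cnt (w : List (Fin (n + 1))) : (w.length : ℤ) = ∑ i, cnt w i := by
  induction w with
  | nil => simp [cnt_nil]
  | cons i w ih =>
    rw [cnt_cons]
    simp only [Pi.add_apply, Finset.sum_add_distrib]
    rw [← ih, Finset.sum_pi_single', if_pos (Finset.mem_univ i), List.length_cons]
    push_cast
    rfl

theorem sum_expo (hn : Odd n) (k : Fin (n + 1) → ℤ) (J : Idx n) :
    2 * ∑ i, expo k J i = (n + 1) * (deg J + ∑ i, k i - deg (J + parity k)) := by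
  simp only [expo, deg]
  rw [← Finset.mul_sum, ← mul_assoc, two_mul_half hn, Finset.sum_sub_distrib,
    Finset.sum_add_distrib]

theorem deg_zero : deg (0 : Idx n) = 0 := by simp [deg, lift_idx_zero]

theorem le_valS_sum (ζ : Simplex n) {ι : Type} (t : Finset ι) (c : ι → S n) (r : EReal)
    (h : ∀ i ∈ t, r ≤ valS ζ (c i)) : r ≤ valS ζ (∑ i ∈ t, c i) := by
  classical
  induction t using Finset.induction_on with
  | empty => rw [Finset.sum_empty, valS_zero]; exact le_top
  | insert i t hi ih =>
    rw [Finset.sum_insert hi]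
    exact (le_min (h i (Finset.mem_insert_self i t))
      (ih fun j hj => h j (Finset.mem_insert_of_mem hj))).trans (le_valS_add ζ _ _)

variable {b : Module.Basis (Idx n) (S n) (DiracModule n ε)}

theorem IsDiracBasis.repr_toM (hb : IsDiracBasis κ b) (x : Tensor n) (J : Idx n) :
    b.repr (toM n ε x) J = ∑ w ∈ x.support, if parity (cnt w) = J then
      x w * lmono (expo (cnt w) 0) (rs (wordSign κ w)) else 0 := by
  conv_lhs => rw [← Finsupp.sum_single x, Finsupp.sum]
  rw [map_sum, map_sum, Finsupp.finsetSum_apply]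
  refine Finset.sum_congr rfl fun w _ => ?_
  rw [toM_single, hb.word_smul, scalar_smul_smul, map_smul, Finsupp.smul_apply, b.repr_self,
    Finsupp.single_apply]
  split_ifs
  · rw [smul_eq_mul, mul_one]
  · rw [smul_zero]

/-- An element of the tensor algebra that represents `m`, with support in the increasing words. -/
def liftTensor (κ : ℤˣ) (b : Module.Basis (Idx n) (S n) (DiracModule n ε)) (m : DiracModule n ε) :
    Tensor n :=
  ∑ J, Finsupp.single (idxWord J) (lmono 0 (rs (wordSign κ (idxWord J))) * b.repr m J)

theorem isLat_zero : IsLat (0 : Fin (n + 1) → ℤ) := fun i => by simp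

theorem IsDiracBasis.toM_liftTensor (hb : IsDiracBasis κ b) (m : DiracModule n ε) :
    toM n ε (liftTensor κ b m) = m := by
  rw [liftTensor, map_sum]
  conv_rhs => rw [← b.sum_repr m]
  refine Finset.sum_congr rfl fun J _ => ?_
  rw [toM_single, hb.word_smul, cnt_idxWord, parity_lift, expo_lift, scalar_smul_smul]
  congr 1
  rw [mul_right_comm, lmono_mul isLat_zero isLat_zero, rs_mul_self, add_zero, lmono_zero_one,
    one_mul]

/-- The basis is orthogonal for every `ν_ζ`. -/
theorem IsDiracBasis.le_valM_iff (hb : IsDiracBasis κ b) (hn : Odd n) (ζ : Simplex n)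
    (m : DiracModule n ε) (r : EReal) :
    r ≤ valM ζ m ↔ ∀ J, r ≤ valS ζ (b.repr m J) + (wt ζ (shift J) : ℝ) := by
  constructor
  · intro h J
    refine h.trans (iSup₂_le fun x hx => ?_)
    subst hx
    rw [hb.repr_toM, le_add_coe_iff]
    refine le_valS_sum ζ _ _ _ fun w _ => ?_
    split_ifs with hw
    · rw [← hw, ← le_add_coe_iff, valS_mul, valS_lmono ζ (isLat_expo hn _ _) (rs_ne_zero _), add_assoc,
        ← EReal.coe_add, ← wt_add, expo_cnt_add_shift, ← sum_word hn]
      exact iInf_le _ w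
    · rw [valS_zero]; exact le_top
  · intro h
    refine le_iSup₂_of_le (liftTensor κ b m) (hb.toM_liftTensor m) ?_
    refine le_tensorVal_sum ζ _ _ _ fun J _ => le_iInf fun w => ?_
    by_cases hw : idxWord J = w
    · subst hw
      rw [Finsupp.single_eq_same, valS_mul, valS_lmono ζ isLat_zero (rs_ne_zero _), wt_zero,
        EReal.coe_zero, zero_add, sum_word hn, cnt_idxWord]
      exact h J
    · rw [Finsupp.single_eq_of_ne (Ne.symm hw), valS_zero, EReal.top_add_coe]
      exact le_top

theorem IsDiracBasis.mem_grM_iff (hb : IsDiracBasis κ b) (hn : Odd n) (p : ℤ)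
    (m : DiracModule n ε) :
    m ∈ grM n ε p ↔ ∀ J, SHomogeneous (p - deg J) (b.repr m J) := by
  constructor
  · rintro ⟨x, hx, rfl⟩ J
    rw [hb.repr_toM]
    refine SHomogeneous.sum _ _ fun w _ => ?_
    split_ifs with hw
    · have h1 := (hx w).mul (sHomogeneous_lmono (isLat_expo hn (cnt w) 0) (rs (wordSign κ w))
        (sum_expo hn (cnt w) 0))
      rw [zero_add, deg_zero, zero_add, hw, length_eq_sum_cnt] at h1
      rwa [show p - ∑ i, cnt w i + (∑ i, cnt w i - deg J) = p - deg J by ring] at h1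
    · exact SHomogeneous.zero _
  · intro h
    refine ⟨liftTensor κ b m, fun w => ?_, hb.toM_liftTensor m⟩
    rw [liftTensor, Finsupp.finsetSum_apply]
    refine SHomogeneous.sum _ _ fun J _ => ?_
    by_cases hw : idxWord J = w
    · subst hw
      rw [Finsupp.single_eq_same, length_eq_sum_cnt, cnt_idxWord]
      have h1 := (sHomogeneous_lmono (n := n) isLat_zero (rs (wordSign κ (idxWord J)))
        (p := 0) (by simp)).mul (h J)
      rwa [zero_add] at h1
    · rw [Finsupp.single_eq_of_ne (Ne.symm hw)]
      exact SHomogeneous.zero _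

theorem valS_one (ζ : Simplex n) : valS ζ (1 : S n) = 0 := by
  rw [← lmono_zero_one, valS_lmono ζ isLat_zero one_ne_zero, wt_zero, EReal.coe_zero]

theorem IsDiracBasis.valM_eq (hb : IsDiracBasis κ b) (hn : Odd n) (ζ : Simplex n)
    (m : DiracModule n ε) :
    valM ζ m = ⨅ J, (valS ζ (b.repr m J) + (wt ζ (shift J) : ℝ)) :=
  eq_of_forall_le_iff fun r => by rw [hb.le_valM_iff hn, le_iInf_iff]

theorem IsDiracBasis.exists_valM_eq (hb : IsDiracBasis κ b) (hn : Odd n) (ζ : Simplex n)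
    (m : DiracModule n ε) : ∃ J, valM ζ m = valS ζ (b.repr m J) + (wt ζ (shift J) : ℝ) := by
  obtain ⟨J, hJ⟩ := exists_eq_ciInf_of_finite
    (f := fun J => valS ζ (b.repr m J) + ((wt ζ (shift J) : ℝ) : EReal))
  exact ⟨J, by rw [hb.valM_eq hn, ← hJ]⟩

theorem IsDiracBasis.valM_ne_bot (hb : IsDiracBasis κ b) (hn : Odd n) (ζ : Simplex n)
    (m : DiracModule n ε) : valM ζ m ≠ ⊥ := by
  obtain ⟨J, hJ⟩ := hb.exists_valM_eq hn ζ m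
  rw [hJ, Ne, EReal.add_eq_bot_iff, not_or]
  exact ⟨valS_ne_bot ζ _, EReal.coe_ne_bot _⟩

theorem IsDiracBasis.valM_eq_top_iff (hb : IsDiracBasis κ b) (hn : Odd n) (ζ : Simplex n)
    (m : DiracModule n ε) : valM ζ m = ⊤ ↔ m = 0 := by
  constructor
  · intro h
    refine b.repr.map_eq_zero_iff.1 (Finsupp.ext fun J => ?_)
    rw [Finsupp.zero_apply, ← valS_eq_top_iff ζ]
    have h1 := (hb.le_valM_iff hn ζ m ⊤).1 h.ge J
    rwa [le_add_coe_iff, EReal.top_sub_coe, top_le_iff] at h1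
  · rintro rfl
    exact (dirac n ε).val_zero ζ

theorem IsDiracBasis.valM_basis (hb : IsDiracBasis κ b) (hn : Odd n) (ζ : Simplex n) (J : Idx n) :
    valM ζ (b J) = (wt ζ (shift J) : ℝ) := by
  refine eq_of_forall_le_iff fun r => ?_
  rw [hb.le_valM_iff hn]
  have h : ∀ I, b.repr (b J) I = if J = I then 1 else 0 := fun I => by
    rw [b.repr_self, Finsupp.single_apply]
  constructor
  · intro h1
    have h2 := h1 J
    rwa [h, if_pos rfl, valS_one, zero_add] at h2
  · intro h1 I
    rw [h]
    split_ifs with hI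
    · rwa [valS_one, zero_add, ← hI]
    · rw [valS_zero, EReal.top_add_coe]; exact le_top

theorem IsDiracBasis.valM_smul (hb : IsDiracBasis κ b) (hn : Odd n) (ζ : Simplex n) (s : S n)
    (m : DiracModule n ε) : valM ζ (s • m) = valS ζ s + valM ζ m := by
  by_cases hs : s = 0
  · have h : s • m = 0 := by rw [hs]; exact zero_smul (S n) m
    rw [h, hs, valS_zero, EReal.top_add_of_ne_bot (hb.valM_ne_bot hn ζ m)]
    exact (dirac n ε).val_zero ζ
  · obtain ⟨r, -, -, -, -, hr⟩ := exists_leading ζ hs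
    refine eq_of_forall_le_iff fun c => ?_
    rw [hr, add_comm (r : EReal), le_add_coe_iff, hb.le_valM_iff hn, hb.le_valM_iff hn]
    refine forall_congr' fun J => ?_
    rw [map_smul, Finsupp.smul_apply, smul_eq_mul, valS_mul, hr, ← le_add_coe_iff, add_assoc,
      add_comm (r : EReal)]

theorem novVal_Tpow (k : ℤ) : novVal n (Tpow k) = (((k : ℝ) / (n + 1) : ℝ) : EReal) := by
  refine le_antisymm (iInf₂_le k ?_) (le_iInf₂ fun j hj => ?_)
  · rw [Tpow, HahnSeries.coeff_single_same]
    exact one_ne_zero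
  · have h : j = k := by
      by_contra h
      exact hj (HahnSeries.coeff_single_of_ne h)
    rw [h]

theorem isMatrixFactorization_dirac (hn : Odd n) (ε : ℤˣ) : IsMatrixFactorization (dirac n ε) := by
  obtain ⟨κ, b, hb⟩ := exists_isDiracBasis hn ε
  refine ⟨hb.valM_eq_top_iff hn, hb.valM_ne_bot hn, hb.valM_smul hn, Idx n, inferInstance, b, deg,
    fun J l => (lift J l : ℝ) / 2, hb.mem_grM_iff hn, fun ζ m => ?_, fun ζ J => ?_, fun J l => ?_⟩
  · change valM ζ m = ⨅ J, (valS ζ (b.repr m J) + valM ζ (b J))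
    rw [hb.valM_eq hn]
    simp only [hb.valM_basis hn]
  · change valM ζ (b J) = _
    rw [hb.valM_basis hn, ← wt_half_mul hn]
    rfl
  · refine ⟨Tpow (half n * lift J l), ?_⟩
    rw [novVal_Tpow]
    congr 1
    have h1 : (2 : ℝ) * half n = n + 1 := by exact_mod_cast two_mul_half hn
    rw [div_eq_div_iff (by positivity) two_ne_zero, ← h1]
    push_cast
    ring

end DiracBasis

/-! ### The combinatorial endomorphism complex -/

section Complex

variable {n : ℕ}

/-- The coordinate vectors. -/
abbrev unitVec (i : Fin (n + 1)) : Fin (n + 1) → ℤ := Pi.single i 1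

theorem unitVec_same (i : Fin (n + 1)) : unitVec i i = 1 := Pi.single_eq_same i 1

theorem unitVec_of_ne {i l : Fin (n + 1)} (h : l ≠ i) : unitVec i l = 0 := Pi.single_eq_of_ne h 1

/-- Families of real numbers indexed by a multi-index `k` and a basis index `J`; such a family
stands for the endomorphism `b_J ↦ ∑ₖ c(k, J) z ^ (k/2) b_(J + parity k)`, suitably normalised. -/
abbrev Fam (n : ℕ) : Type := (Fin (n + 1) → ℤ) → Idx n → ℝ

/-- The real sign of a generator. -/
def sr (κ : ℤˣ) (i : Fin (n + 1)) (J : Idx n) : ℝ := rs (sg κ i J)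

theorem sr_mul_self (κ : ℤˣ) (i : Fin (n + 1)) (J : Idx n) : sr κ i J * sr κ i J = 1 :=
  rs_mul_self _

theorem sr_anticomm (κ : ℤˣ) {i l : Fin (n + 1)} (h : i ≠ l) (J : Idx n) :
    sr κ i J * sr κ l J =
      -(sr κ l (J + parity (unitVec i)) * sr κ i (J + parity (unitVec l))) := by
  have h1 := congrArg rs (sg_anticomm κ h J)
  rw [rs_neg, map_mul, map_mul] at h1
  change sr κ l (J + parity (unitVec i)) * sr κ i J =
    -(sr κ i (J + parity (unitVec l)) * sr κ l J) at h1
  have h2 := sr_mul_self κ i J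
  have h3 := sr_mul_self κ i (J + parity (unitVec l))
  linear_combination sr κ i J * sr κ i (J + parity (unitVec l)) * h1 -
    sr κ l (J + parity (unitVec i)) * sr κ i (J + parity (unitVec l)) * h2 - sr κ i J * sr κ l J * h3

/-- The graded commutator with `e₀ + ⋯ + eₙ`, where `u` is the sign `(-1) ^ p` in degree `p`. -/
def famD (κ : ℤˣ) (u : ℝ) : Fam n →ₗ[ℝ] Fam n where
  toFun c k J := ∑ i, (sr κ i (J + parity (k - unitVec i)) * c (k - unitVec i) J -
    u * (sr κ i J * c (k - unitVec i) (J + parity (unitVec i))))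
  map_add' c c' := by
    funext k J
    simp only [Pi.add_apply]
    rw [← Finset.sum_add_distrib]
    exact Finset.sum_congr rfl fun i _ => by ring
  map_smul' r c := by
    funext k J
    simp only [Pi.smul_apply, smul_eq_mul, RingHom.id_apply]
    rw [Finset.mul_sum]
    exact Finset.sum_congr rfl fun i _ => by ring

theorem famD_apply (κ : ℤˣ) (u : ℝ) (c : Fam n) (k : Fin (n + 1) → ℤ) (J : Idx n) :
    famD κ u c k J = ∑ i, (sr κ i (J + parity (k - unitVec i)) * c (k - unitVec i) J -
      u * (sr κ i J * c (k - unitVec i) (J + parity (unitVec i)))) := rfl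

/-- The families of degree `p` supported on multi-indices with entries at least `m`. -/
def famSub (n : ℕ) (m p : ℤ) : Submodule ℝ (Fam n) where
  carrier := {c | ∀ k J, c k J ≠ 0 → (∀ i, m ≤ k i) ∧ ∑ i, k i = p}
  zero_mem' := fun k J h => absurd rfl h
  add_mem' := by
    intro c c' hc hc' k J h
    by_cases h1 : c k J = 0
    · exact hc' k J fun h2 => h (by rw [Pi.add_apply, Pi.add_apply, h1, h2, add_zero])
    · exact hc k J h1
  smul_mem' := fun r c hc k J h => hc k J (right_ne_zero_of_mul h)

theorem famSub_mono {m m' p : ℤ} (h : m ≤ m') : famSub n m' p ≤ famSub n m p :=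
  fun _ hc k J hk => ⟨fun i => h.trans ((hc k J hk).1 i), (hc k J hk).2⟩

theorem famD_mem {κ : ℤˣ} {u : ℝ} {m p q : ℤ} (hpq : p + 1 = q) {c : Fam n} (hc : c ∈ famSub n m p) :
    famD κ u c ∈ famSub n m q := by
  intro k J h
  rw [famD_apply] at h
  obtain ⟨i, -, hi⟩ := Finset.exists_ne_zero_of_sum_ne_zero h
  obtain ⟨I, hI⟩ : ∃ I, c (k - unitVec i) I ≠ 0 := by
    by_contra! h0
    rw [h0, h0] at hi
    simp at hi
  obtain ⟨h1, h2⟩ := hc _ _ hI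
  constructor
  · intro l
    have h3 := h1 l
    rw [Pi.sub_apply] at h3
    have h4 : (0 : ℤ) ≤ unitVec i l := by
      rcases eq_or_ne l i with rfl | hl
      · simp
      · simp [hl]
    linarith
  · simp only [Pi.sub_apply, Finset.sum_sub_distrib] at h2
    rw [Finset.sum_pi_single', if_pos (Finset.mem_univ i)] at h2
    linarith

/-- Division by `eⱼ` as a homotopy on the families supported on entries at least `m`. -/
def famH (κ : ℤˣ) (m : ℤ) (j : Fin (n + 1)) (c : Fam n) : Fam n := fun k J =>
  if m ≤ k j then (1 / 2) * (sr κ j (J + parity k) * c (k + unitVec j) J) else 0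

theorem famH_mem {κ : ℤˣ} {m p : ℤ} {j : Fin (n + 1)} {c : Fam n} (hc : c ∈ famSub n m p) :
    famH κ m j c ∈ famSub n m (p - 1) := by
  intro k J h
  rw [famH] at h
  split_ifs at h with hm
  · obtain ⟨h1, h2⟩ := hc _ _ (right_ne_zero_of_mul (right_ne_zero_of_mul h))
    constructor
    · intro l
      rcases eq_or_ne l j with rfl | hl
      · exact hm
      · have := h1 l
        rwa [Pi.add_apply, unitVec_of_ne hl, add_zero] at this
    · simp only [Pi.add_apply, Finset.sum_add_distrib] at h2
      rw [Finset.sum_pi_single', if_pos (Finset.mem_univ j)] at h2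
      linarith
  · exact absurd rfl h

/-- The homotopy formula: up to homotopy, families are supported on `k j = m`. -/
theorem famD_famH (κ : ℤˣ) (u : ℝ) (m : ℤ) (j : Fin (n + 1)) (c : Fam n)
    (k : Fin (n + 1) → ℤ) (J : Idx n) :
    famD κ (-u) (famH κ m j c) k J + famH κ m j (famD κ u c) k J =
      if m < k j then c k J else if m = k j then
        1 / 2 * (c k J - u * (sr κ j J * sr κ j (J + parity k) * c k (J + parity (unitVec j))))
      else 0 := by
  have hA : ∀ i, J + parity k = J + parity (k - unitVec i) + parity (unitVec i) := fun i => by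
    rw [add_assoc, ← map_add, sub_add_cancel]
  have hB : ∀ i, J + parity (unitVec i) + parity (k - unitVec i) = J + parity k := fun i => by
    rw [add_assoc, ← map_add, add_sub_cancel]
  have h1 : famH κ m j (famD κ u c) k J = ∑ i, if m ≤ k j then
      1 / 2 * (sr κ j (J + parity k) * (sr κ i (J + parity (k - unitVec i) + parity (unitVec j)) *
        c (k - unitVec i + unitVec j) J - u * (sr κ i J *
          c (k - unitVec i + unitVec j) (J + parity (unitVec i))))) else 0 := by
    rw [famH, Finset.sum_ite_irrel, Finset.sum_const_zero, famD_apply, Finset.mul_sum,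
      Finset.mul_sum]
    congr 1
    refine Finset.sum_congr rfl fun i _ => ?_
    rw [add_sub_right_comm, map_add, ← add_assoc]
  rw [h1, famD_apply, ← Finset.sum_add_distrib, Finset.sum_eq_single j]
  · have h2 : (k - unitVec j) j = k j - 1 := by rw [Pi.sub_apply, unitVec_same]
    have h3 := sr_mul_self κ j (J + parity k)
    have h4 := sr_mul_self κ j (J + parity (k - unitVec j))
    simp only [famH, h2, sub_add_cancel, hB]
    rw [← hA]
    rcases lt_trichotomy m (k j) with h | h | h
    · rw [if_pos (show m ≤ k j - 1 by omega), if_pos (show m ≤ k j - 1 by omega),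
        if_pos (show m ≤ k j by omega), if_pos h]
      linear_combination 1 / 2 * c k J * h3 + 1 / 2 * c k J * h4
    · rw [if_neg (show ¬m ≤ k j - 1 by omega), if_neg (show ¬m ≤ k j - 1 by omega),
        if_pos (show m ≤ k j by omega), if_neg (show ¬m < k j by omega), if_pos h]
      linear_combination 1 / 2 * c k J * h3
    · rw [if_neg (show ¬m ≤ k j - 1 by omega), if_neg (show ¬m ≤ k j - 1 by omega),
        if_neg (show ¬m ≤ k j by omega), if_neg (show ¬m < k j by omega),
        if_neg (show ¬m = k j by omega)]
      ring
  · intro i _ hi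
    have h2 : (k - unitVec i) j = k j := by rw [Pi.sub_apply, unitVec_of_ne hi.symm, sub_zero]
    simp only [famH, h2, hB]
    split_ifs with h
    · have h5 := sr_anticomm κ hi (J + parity (k - unitVec i))
      rw [← hA] at h5
      linear_combination 1 / 2 * c (k - unitVec i + unitVec j) J * h5
    · ring
  · exact fun h => absurd (Finset.mem_univ j) h

/-- The sign `(-1) ^ p` as a real number. -/
def par (p : ℤ) : ℝ := ((p.negOnePow : ℤ) : ℝ)

theorem par_sub_one (p : ℤ) : par (p - 1) = -par p := by
  rw [par, par, Int.negOnePow_sub, Int.negOnePow_one, mul_neg, mul_one]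
  simp

/-- The complex of families with entries at least `m` is exact except in degree `m (n + 1)`: the
homotopies in all directions `j` make a closed family cohomologous to one supported on
`k = (m, …, m)`. The hypothesis that the differential squares to zero follows from the
interpretation of families as endomorphisms. -/
theorem exists_primitive {κ : ℤˣ} {m p : ℤ} (hm : 0 ≤ m) (hp : p ≠ m * (n + 1))
    (hdd : ∀ q, ∀ c ∈ famSub n 0 q, famD κ (par (q + 1)) (famD κ (par q) c) = 0)
    {c : Fam n} (hc : c ∈ famSub n m p) (hd : famD κ (par p) c = 0) :
    ∃ b ∈ famSub n m (p - 1), famD κ (par (p - 1)) b = c := by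
  classical
  have key : ∀ s : Finset (Fin (n + 1)), ∃ b ∈ famSub n m (p - 1), ∀ k J,
      (c - famD κ (par (p - 1)) b) k J ≠ 0 → ∀ j ∈ s, k j = m := by
    intro s
    induction s using Finset.induction_on with
    | empty => exact ⟨0, zero_mem _, fun k J _ j hj => absurd hj (Finset.notMem_empty j)⟩
    | insert j s hj ih =>
      obtain ⟨b, hb, hb'⟩ := ih
      set c' := c - famD κ (par (p - 1)) b with hc'
      have hc'm : c' ∈ famSub n m p := sub_mem hc (famD_mem (sub_add_cancel p 1) hb)
      have hd' : famD κ (par p) c' = 0 := by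
        have := hdd (p - 1) b (famSub_mono hm hb)
        rw [sub_add_cancel] at this
        rw [hc', map_sub, hd, this, sub_zero]
      refine ⟨b + famH κ m j c', add_mem hb (famH_mem hc'm), fun k J hk => ?_⟩
      have h1 := famD_famH κ (par p) m j c' k J
      have h2 : famH κ m j (famD κ (par p) c') k J = 0 := by
        rw [hd', famH]
        simp
      rw [h2, add_zero, ← par_sub_one] at h1
      have h3 : (c - famD κ (par (p - 1)) (b + famH κ m j c')) k J =
          c' k J - famD κ (par (p - 1)) (famH κ m j c') k J := by
        rw [map_add, ← sub_sub]
        rfl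
      rw [h3, h1] at hk
      have h4 : k j = m := by
        rcases lt_trichotomy m (k j) with h | h | h
        · rw [if_pos h, sub_self] at hk
          exact absurd rfl hk
        · exact h.symm
        · rw [if_neg (show ¬m < k j by omega), if_neg (show ¬m = k j by omega), sub_zero] at hk
          have := (hc'm k J hk).1 j
          omega
      have h5 : ∃ I, c' k I ≠ 0 := by
        by_contra! h0
        rw [h0, h0] at hk
        simp at hk
      obtain ⟨I, hI⟩ := h5
      intro l hl
      rcases Finset.mem_insert.1 hl with rfl | hl
      · exact h4
      · exact hb' k I hI l hl
  obtain ⟨b, hb, hb'⟩ := key Finset.univ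
  refine ⟨b, hb, ?_⟩
  rw [eq_comm, ← sub_eq_zero]
  funext k J
  by_contra h
  have h1 := hb' k J h
  have h2 := ((sub_mem hc (famD_mem (sub_add_cancel p 1) hb) :
    c - famD κ (par (p - 1)) b ∈ famSub n m p) k J h).2
  rw [Finset.sum_congr rfl h1, Finset.sum_const, Finset.card_univ, Fintype.card_fin,
    nsmul_eq_mul] at h2
  refine hp ?_
  rw [← h2]
  push_cast
  ring

end Complex

/-! ### Endomorphisms of the Dirac module -/

section Endomorphisms

variable {n : ℕ} {ε κ : ℤˣ} {b : Module.Basis (Idx n) (S n) (DiracModule n ε)}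

theorem half_pos (hn : Odd n) : 0 < half n := by
  have := two_mul_half hn
  omega

/-- The coefficient of the Laurent monomial `a` in a matrix entry of an endomorphism. -/
def entryCoeff (b : Module.Basis (Idx n) (S n) (DiracModule n ε))
    (Φ : DiracModule n ε →ₗ[S n] DiracModule n ε) (I J : Idx n) (a : Fin (n + 1) → ℤ) : ℝ :=
  (hat n (b.repr (Φ (b J)) I)).coeff a

/-- The coefficients of an endomorphism at the monomials of weight in `(1/2) ℤ ^ (n + 1)`. -/
def coeffFam (b : Module.Basis (Idx n) (S n) (DiracModule n ε)) :
    (DiracModule n ε →ₗ[S n] DiracModule n ε) →ₗ[ℝ] Fam n where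
  toFun Φ k J := entryCoeff b Φ (J + parity k) J (expo k J)
  map_add' Φ Ψ := by
    funext k J
    change (hat n (b.repr (Φ (b J) + Ψ (b J)) _)).coeff _ = _
    rw [map_add b.repr (Φ (b J)) (Ψ (b J)), Finsupp.add_apply, map_add (hat n)]
    rfl
  map_smul' c Φ := by
    funext k J
    change (hat n (b.repr (c • Φ (b J)) _)).coeff _ = c * _
    rw [← algebraMap_smul (S n) c (Φ (b J)), map_smul, Finsupp.smul_apply, smul_eq_mul,
      ← Algebra.smul_def, hat_smul]
    rfl

theorem coeffFam_apply (Φ : DiracModule n ε →ₗ[S n] DiracModule n ε) (k : Fin (n + 1) → ℤ)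
    (J : Idx n) : coeffFam b Φ k J = entryCoeff b Φ (J + parity k) J (expo k J) := rfl

theorem IsDiracBasis.repr_e_smul (hb : IsDiracBasis κ b) (i : Fin (n + 1)) (m : DiracModule n ε)
    (I : Idx n) : b.repr (e n i • m) I =
      opCoeff κ i (I + parity (unitVec i)) * b.repr m (I + parity (unitVec i)) := by
  have h : b.equivFun.toLinearMap ∘ₗ Algebra.lsmul (S n) (S n) (DiracModule n ε) (e n i) =
      op κ i ∘ₗ b.equivFun.toLinearMap := by
    refine b.ext fun J => ?_
    change b.equivFun (e n i • b J) = op κ i (b.equivFun (b J))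
    have h1 : ∀ J, b.equivFun (b J) = Pi.single J 1 := fun J => by
      funext I
      rw [b.equivFun_apply, b.repr_self, Finsupp.single_apply, Pi.single_apply]
      simp only [eq_comm]
    rw [hb.e_smul, map_smul, h1, h1, op_single, mul_one, ← Pi.single_smul, smul_eq_mul, mul_one]
  exact congrFun (LinearMap.congr_fun h m) I

theorem expo_sub_unitVec (k : Fin (n + 1) → ℤ) (i : Fin (n + 1)) (J : Idx n) :
    expo k J - expo (unitVec i) (J + parity (k - unitVec i)) = expo (k - unitVec i) J := by
  rw [sub_eq_iff_eq_add, expo_add, sub_add_cancel]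

theorem expo_sub_unitVec' (k : Fin (n + 1) → ℤ) (i : Fin (n + 1)) (J : Idx n) :
    expo k J - expo (unitVec i) J = expo (k - unitVec i) (J + parity (unitVec i)) := by
  rw [sub_eq_iff_eq_add, add_comm (expo (k - unitVec i) _), expo_add, add_sub_cancel]

/-- The coefficients intertwine the differentials. -/
theorem IsDiracBasis.coeffFam_delta (hb : IsDiracBasis κ b) (hn : Odd n) (p : ℤ)
    (Φ : DiracModule n ε →ₗ[S n] DiracModule n ε) :
    coeffFam b ((dirac n ε).delta p Φ) = famD κ (par p) (coeffFam b Φ) := by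
  have hD : ∀ m, (dirac n ε).D m = ∑ i, e n i • m := fun m => by
    change (∑ i, e n i) • m = _
    rw [Finset.sum_smul]
  have h1 : coeffFam b ((dirac n ε).D ∘ₗ Φ) = fun k J =>
      ∑ i, sr κ i (J + parity (k - unitVec i)) * coeffFam b Φ (k - unitVec i) J := by
    funext k J
    rw [coeffFam_apply, entryCoeff, LinearMap.comp_apply, hD, map_sum, Finsupp.finsetSum_apply,
      map_sum, HahnSeries.coeff_sum]
    refine Finset.sum_congr rfl fun i _ => ?_
    have h2 : J + parity k + parity (unitVec i) = J + parity (k - unitVec i) := by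
      rw [← idx_add_add_cancel (J + parity (k - unitVec i)) (parity (unitVec i)),
        add_assoc J (parity (k - unitVec i)), ← map_add, sub_add_cancel]
    rw [hb.repr_e_smul, h2, opCoeff, coeff_lmono_mul (isLat_expo hn _ _), expo_sub_unitVec]
    rfl
  have h2 : coeffFam b (Φ ∘ₗ (dirac n ε).D) = fun k J =>
      ∑ i, sr κ i J * coeffFam b Φ (k - unitVec i) (J + parity (unitVec i)) := by
    funext k J
    rw [coeffFam_apply, entryCoeff, LinearMap.comp_apply, hD, map_sum, map_sum,
      Finsupp.finsetSum_apply, map_sum, HahnSeries.coeff_sum]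
    refine Finset.sum_congr rfl fun i _ => ?_
    have h3 : J + parity k = J + parity (unitVec i) + parity (k - unitVec i) := by
      rw [add_assoc, ← map_add, add_sub_cancel]
    rw [hb.e_smul, map_smul, map_smul, Finsupp.smul_apply, smul_eq_mul, opCoeff,
      coeff_lmono_mul (isLat_expo hn _ _), expo_sub_unitVec', h3]
    rfl
  change coeffFam b ((dirac n ε).D ∘ₗ Φ - par p • (Φ ∘ₗ (dirac n ε).D)) = _
  rw [map_sub, map_smul, h1, h2]
  funext k J
  rw [famD_apply, Finset.sum_sub_distrib, ← Finset.mul_sum]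
  rfl

/-! #### The norm in terms of coefficients -/

theorem le_neg_coe_sub_iff (r x : ℝ) (y : EReal) :
    (r : EReal) ≤ -((x : EReal) - y) ↔ ((r + x : ℝ) : EReal) ≤ y := by
  induction y with
  | bot => simp
  | top => simp
  | coe y =>
    rw [← EReal.coe_sub, ← EReal.coe_neg, EReal.coe_le_coe_iff, EReal.coe_le_coe_iff]
    constructor <;> intro h <;> linarith

/-- A lower bound for a linear function on the open simplex bounds its values at the vertices. -/
theorem forall_le_wt_iff (r : ℝ) (a : Fin (n + 1) → ℤ) :
    (∀ ζ : Simplex n, r ≤ wt ζ a) ↔ ∀ l, r * (n + 1) ≤ a l := by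
  have hn : (0 : ℝ) < n + 1 := by positivity
  constructor
  · intro h l
    by_contra! hl
    set C : ℝ := (∑ i, (a i : ℝ)) / (n + 1) with hC
    set d : ℝ := r * (n + 1) - a l with hd
    have hd0 : 0 < d := sub_pos.2 hl
    set t : ℝ := d / (2 * (d + |C - a l|)) with ht
    have hq : 0 < d + |C - a l| := by positivity
    have ht0 : 0 < t := by positivity
    have ht1 : t < 1 := by
      rw [ht, div_lt_one (by positivity)]
      have := abs_nonneg (C - a l)
      linarith
    -- the point of the segment from the vertex to the barycentre with parameter `t`
    have hsum : ∑ i : Fin (n + 1), ((1 - t) * (if i = l then 1 else 0) + t / (n + 1)) = 1 := by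
      rw [Finset.sum_add_distrib, ← Finset.mul_sum, Finset.sum_ite_eq', if_pos (Finset.mem_univ l),
        Finset.sum_const, Finset.card_univ, Fintype.card_fin, nsmul_eq_mul]
      push_cast
      field_simp
      ring
    have h1 : r ≤ (∑ i, (a i : ℝ) * ((1 - t) * (if i = l then 1 else 0) + t / (n + 1))) / (n + 1) :=
      h ⟨fun i => (1 - t) * (if i = l then 1 else 0) + t / (n + 1), fun i => by
        have : 0 < t / (n + 1) := by positivity
        change 0 < (1 - t) * (if i = l then 1 else 0) + t / (n + 1)
        split_ifs <;> linarith, hsum⟩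
    rw [le_div_iff₀ hn] at h1
    simp only [mul_add, Finset.sum_add_distrib] at h1
    have h2 : ∑ i, (a i : ℝ) * ((1 - t) * (if i = l then 1 else 0)) = (1 - t) * a l := by
      rw [Finset.sum_eq_single l (fun i _ hi => by simp [hi]) (by simp), if_pos rfl]
      ring
    have h3 : ∑ i, (a i : ℝ) * (t / (n + 1)) = t * C := by
      rw [← Finset.sum_mul, hC]
      ring
    rw [h2, h3] at h1
    have h4 : t * (C - a l) ≤ d / 2 := by
      have h5 : t * |C - a l| ≤ d / 2 := by
        rw [ht, div_mul_eq_mul_div, div_le_div_iff₀ (by positivity) two_pos]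
        nlinarith [abs_nonneg (C - a l)]
      exact (mul_le_mul_of_nonneg_left (le_abs_self _) ht0.le).trans h5
    have h6 : r * (n + 1) = a l + d := by rw [hd]; ring
    linarith
  · intro h ζ
    rw [wt, le_div_iff₀ hn]
    calc r * (n + 1) = ∑ i, r * (n + 1) * ζ.1 i := by rw [← Finset.mul_sum, ζ.2.2, mul_one]
      _ ≤ _ := Finset.sum_le_sum fun i _ => mul_le_mul_of_nonneg_right (h i) (ζ.2.1 i).le

/-- The norm of an endomorphism is bounded below through the exponent vectors of its
coefficients. -/
theorem IsDiracBasis.coe_le_endVal_iff (hb : IsDiracBasis κ b) (hn : Odd n) (r : ℝ)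
    (Φ : DiracModule n ε →ₗ[S n] DiracModule n ε) :
    (r : EReal) ≤ (dirac n ε).endVal Φ ↔ ∀ I J a, entryCoeff b Φ I J a ≠ 0 →
      ∀ l, r * (n + 1) ≤ ((a + shift I - shift J) l : ℤ) := by
  simp only [← forall_le_wt_iff]
  constructor
  · intro h I J a ha ζ
    have h1 := h.trans ((dirac n ε).endVal_le Φ ζ (b J))
    change (r : EReal) ≤ -(valM ζ (b J) - valM ζ (Φ (b J))) at h1
    rw [hb.valM_basis hn, le_neg_coe_sub_iff, hb.le_valM_iff hn] at h1
    have h2 := h1 I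
    rw [le_add_coe_iff, ← EReal.coe_sub, le_valS_iff] at h2
    have h3 := EReal.coe_le_coe_iff.1 (h2 a ha)
    rw [wt_sub, wt_add]
    linarith
  · intro h
    refine le_iInf fun ζ => le_iInf₂ fun m hm => ?_
    change (r : EReal) ≤ -(valM ζ m - valM ζ (Φ m))
    obtain ⟨x, hx⟩ : ∃ x : ℝ, valM ζ m = x := by
      refine ⟨(valM ζ m).toReal, (EReal.coe_toReal ?_ (hb.valM_ne_bot hn ζ m)).symm⟩
      exact fun h0 => hm ((hb.valM_eq_top_iff hn ζ m).1 h0)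
    rw [hx, le_neg_coe_sub_iff, hb.le_valM_iff hn]
    intro I
    have h1 : b.repr (Φ m) I = ∑ J, b.repr m J * b.repr (Φ (b J)) I := by
      conv_lhs => rw [← b.sum_repr m]
      rw [map_sum, map_sum, Finsupp.finsetSum_apply]
      refine Finset.sum_congr rfl fun J _ => ?_
      rw [map_smul, map_smul, Finsupp.smul_apply, smul_eq_mul]
    rw [h1, le_add_coe_iff]
    refine le_valS_sum ζ _ _ _ fun J _ => ?_
    rw [← le_add_coe_iff, valS_mul]
    have h2 : ((r + wt ζ (shift J) - wt ζ (shift I) : ℝ) : EReal) ≤ valS ζ (b.repr (Φ (b J)) I) := by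
      rw [le_valS_iff]
      intro a ha
      have := h I J a ha ζ
      rw [wt_sub, wt_add] at this
      rw [EReal.coe_le_coe_iff]
      linarith
    have h3 := (hb.le_valM_iff hn ζ m x).1 hx.ge J
    calc ((r + x : ℝ) : EReal) = (x : EReal) + (r : EReal) := by rw [add_comm, EReal.coe_add]
      _ ≤ valS ζ (b.repr m J) + (wt ζ (shift J) : ℝ) + (r : EReal) := add_le_add_left h3 _
      _ = valS ζ (b.repr m J) + ((r + wt ζ (shift J) - wt ζ (shift I) : ℝ) : EReal) +
          (wt ζ (shift I) : ℝ) := by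
        rw [add_assoc, add_assoc, ← EReal.coe_add, ← EReal.coe_add]
        congr 2
        ring
      _ ≤ _ := add_le_add_left (add_le_add_right h2 _) _

theorem IsDiracBasis.zero_le_endVal_iff (hb : IsDiracBasis κ b) (hn : Odd n)
    (Φ : DiracModule n ε →ₗ[S n] DiracModule n ε) :
    0 ≤ (dirac n ε).endVal Φ ↔ ∀ I J a, entryCoeff b Φ I J a ≠ 0 →
      ∀ l, 0 ≤ (a + shift I - shift J) l := by
  rw [← EReal.coe_zero, hb.coe_le_endVal_iff hn]
  simp only [zero_mul]
  exact forall_congr' fun I => forall_congr' fun J => forall_congr' fun a => forall_congr' fun _ =>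
    forall_congr' fun l => by exact_mod_cast Iff.rfl

theorem IsDiracBasis.endVal_pos_iff (hb : IsDiracBasis κ b) (hn : Odd n)
    (Φ : DiracModule n ε →ₗ[S n] DiracModule n ε) :
    0 < (dirac n ε).endVal Φ ↔ ∀ I J a, entryCoeff b Φ I J a ≠ 0 →
      ∀ l, 1 ≤ (a + shift I - shift J) l := by
  have hn' : (0 : ℝ) < n + 1 := by positivity
  constructor
  · intro h I J a ha l
    obtain ⟨r, hr, hr'⟩ := EReal.lt_iff_exists_real_btwn.1 h
    have h1 := (hb.coe_le_endVal_iff hn r Φ).1 hr'.le I J a ha l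
    have h2 : (0 : ℝ) < ((a + shift I - shift J) l : ℤ) :=
      (mul_pos (EReal.coe_pos.1 hr) hn').trans_le h1
    have h3 : 0 < (a + shift I - shift J) l := by exact_mod_cast h2
    omega
  · intro h
    have h1 : (((1 / (n + 1) : ℝ)) : EReal) ≤ (dirac n ε).endVal Φ := by
      rw [hb.coe_le_endVal_iff hn]
      intro I J a ha l
      rw [one_div_mul_cancel hn'.ne']
      exact_mod_cast h I J a ha l
    exact (EReal.coe_pos.2 (by positivity)).trans_le h1

theorem IsDiracBasis.mem_endGr_iff (hb : IsDiracBasis κ b) (hn : Odd n) (p : ℤ)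
    (Φ : DiracModule n ε →ₗ[S n] DiracModule n ε) :
    Φ ∈ (dirac n ε).endGr p ↔ ∀ I J, SHomogeneous (p + deg J - deg I) (b.repr (Φ (b J)) I) := by
  constructor
  · intro h I J
    have h1 : b J ∈ grM n ε (deg J) := (hb.mem_grM_iff hn _ _).2 fun K => by
      rw [b.repr_self, Finsupp.single_apply]
      split_ifs with hK
      · rw [hK, sub_self, ← lmono_zero_one]
        exact sHomogeneous_lmono isLat_zero 1 (by simp)
      · exact SHomogeneous.zero _
    have h2 := (hb.mem_grM_iff hn _ _).1 (h (deg J) (b J) h1) I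
    rwa [add_comm (deg J)] at h2
  · intro h q m hm
    refine (hb.mem_grM_iff hn _ _).2 fun I => ?_
    have h1 : b.repr (Φ m) I = ∑ J, b.repr m J * b.repr (Φ (b J)) I := by
      conv_lhs => rw [← b.sum_repr m]
      rw [map_sum, map_sum, Finsupp.finsetSum_apply]
      refine Finset.sum_congr rfl fun J _ => ?_
      rw [map_smul, map_smul, Finsupp.smul_apply, smul_eq_mul]
    rw [h1]
    refine SHomogeneous.sum _ _ fun J _ => ?_
    have h2 := ((hb.mem_grM_iff hn _ _).1 hm J).mul (h I J)
    rwa [show q - deg J + (p + deg J - deg I) = q + p - deg I by ring] at h2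

theorem expo_add_shift_sub (k : Fin (n + 1) → ℤ) (J : Idx n) (l : Fin (n + 1)) :
    (expo k J + shift (J + parity k) - shift J) l = half n * k l := by
  simp only [Pi.sub_apply, Pi.add_apply, expo, shift]
  ring

theorem IsDiracBasis.coeffFam_mem (hb : IsDiracBasis κ b) (hn : Odd n) {p : ℤ}
    {Φ : DiracModule n ε →ₗ[S n] DiracModule n ε} (hΦ : Φ ∈ (dirac n ε).endNonneg p) :
    coeffFam b Φ ∈ famSub n 0 p := by
  intro k J h
  constructor
  · intro l
    have h1 := (hb.zero_le_endVal_iff hn Φ).1 hΦ.2 _ _ _ h l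
    rw [expo_add_shift_sub] at h1
    exact nonneg_of_mul_nonneg_right h1 (half_pos hn)
  · have h1 := (sHomogeneous_iff _ _).1 ((hb.mem_endGr_iff hn p Φ).1 hΦ.1 (J + parity k) J)
      (expo k J) h
    rw [sum_expo hn] at h1
    have h2 := mul_left_cancel₀ (by positivity : ((n : ℤ) + 1) ≠ 0) h1
    linarith

/-- An endomorphism of non-negative norm has positive norm if and only if this holds for the part
captured by `coeffFam`: an exponent vector with a vanishing entry lies in `(n + 1) / 2` times the
integral vectors. -/
theorem IsDiracBasis.mem_endPos_iff (hb : IsDiracBasis κ b) (hn : Odd n) {p : ℤ}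
    {Φ : DiracModule n ε →ₗ[S n] DiracModule n ε} (hΦ : Φ ∈ (dirac n ε).endNonneg p) :
    Φ ∈ (dirac n ε).endPos p ↔ coeffFam b Φ ∈ famSub n 1 p := by
  have hh := half_pos hn
  constructor
  · intro h k J hk
    refine ⟨fun l => ?_, (hb.coeffFam_mem hn hΦ k J hk).2⟩
    have h1 := (hb.endVal_pos_iff hn Φ).1 h.2 _ _ _ hk l
    rw [expo_add_shift_sub] at h1
    have h2 : 0 < k l := pos_of_mul_pos_right (show 0 < half n * k l by omega) hh.le
    omega
  · intro h
    refine ⟨hΦ.1, (hb.endVal_pos_iff hn Φ).2 fun I J a ha l => ?_⟩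
    have h0 := (hb.zero_le_endVal_iff hn Φ).1 hΦ.2 I J a ha
    by_contra! hl
    have hl0 : (a + shift I - shift J) l = 0 := le_antisymm (by omega) (h0 l)
    have hlat : IsLat a := isLat_of_coeff_ne_zero ha
    have hdvd : ∀ i, half n ∣ (a + shift I - shift J) i := by
      intro i
      have h1 : half n ∣ a i - a l := by
        have h2 := (hlat i).sub (hlat l)
        rw [sub_sub_sub_cancel_right, ← two_mul_half hn] at h2
        exact (Dvd.intro_left 2 rfl).trans h2
      have h3 : (a + shift I - shift J) i = (a + shift I - shift J) i - (a + shift I - shift J) l := by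
        rw [hl0, sub_zero]
      rw [h3]
      have h4 : (a + shift I - shift J) i - (a + shift I - shift J) l = (a i - a l) +
          half n * (lift I i - lift J i - lift I l + lift J l) := by
        simp only [Pi.sub_apply, Pi.add_apply, shift]
        ring
      rw [h4]
      exact h1.add (Dvd.intro _ rfl)
    choose k hk using hdvd
    have hI : I = J + parity k := by
      funext j
      obtain ⟨c, hc⟩ := hlat j.succ
      have h1 := hk j.succ
      have h2 := hk 0
      simp only [Pi.sub_apply, Pi.add_apply, shift, lift_zero, mul_zero, add_zero, sub_zero] at h1 h2
      rw [← two_mul_half hn] at hc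
      have h3 : half n * (k j.succ - k 0 - lift I j.succ + lift J j.succ) = half n * (2 * c) := by
        linear_combination hc - h1 + h2
      have h4 := mul_left_cancel₀ hh.ne' h3
      have h5 := congrArg (Int.cast : ℤ → ZMod 2) h4
      simp only [lift_succ] at h5
      push_cast at h5
      simp only [ZMod.natCast_val, ZMod.cast_id', id] at h5
      have h6 : (2 : ZMod 2) = 0 := rfl
      have h7 : parity k j = ((k j.succ : ℤ) : ZMod 2) + ((k 0 : ℤ) : ZMod 2) := by
        rw [← Int.cast_add]; rfl
      rw [Pi.add_apply, h7]
      linear_combination -h5 - ((k 0 : ZMod 2) + (c : ZMod 2)) * h6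
    have hka : a = expo k J := by
      funext i
      have h1 := hk i
      simp only [Pi.sub_apply, Pi.add_apply, shift] at h1
      rw [expo, ← hI]
      linear_combination h1
    have h1 := (h k J (by rw [coeffFam_apply, ← hI, ← hka]; exact ha)).1 l
    rw [hk l] at hl
    nlinarith

/-- The families of non-negative support are the coefficients of endomorphisms of non-negative norm. -/
theorem IsDiracBasis.exists_coeffFam_eq (hb : IsDiracBasis κ b) (hn : Odd n) {p : ℤ} {c : Fam n}
    (hc : c ∈ famSub n 0 p) : ∃ Φ ∈ (dirac n ε).endNonneg p, coeffFam b Φ = c := by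
  classical
  have hh := half_pos hn
  set K : Finset (Fin (n + 1) → ℤ) :=
    {k ∈ Fintype.piFinset fun _ => Finset.Icc 0 p | ∑ i, k i = p} with hK
  set Φ : DiracModule n ε →ₗ[S n] DiracModule n ε := b.constr (S n) fun J =>
    ∑ k ∈ K, (lmono (expo k J) (c k J) : S n) • b (J + parity k) with hΦ
  have hrepr : ∀ I J, b.repr (Φ (b J)) I =
      ∑ k ∈ K, if J + parity k = I then lmono (expo k J) (c k J) else 0 := fun I J => by
    rw [hΦ, b.constr_basis, map_sum, Finsupp.finsetSum_apply]
    refine Finset.sum_congr rfl fun k _ => ?_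
    rw [map_smul, Finsupp.smul_apply, b.repr_self, Finsupp.single_apply]
    split_ifs <;> simp
  have hcoeff : ∀ I J a, entryCoeff b Φ I J a =
      ∑ k ∈ K, if J + parity k = I ∧ a = expo k J then c k J else 0 := fun I J a => by
    rw [entryCoeff, hrepr, map_sum, HahnSeries.coeff_sum]
    refine Finset.sum_congr rfl fun k _ => ?_
    by_cases h1 : J + parity k = I
    · rw [if_pos h1, coeff_lmono (isLat_expo hn _ _)]
      simp [h1]
    · rw [if_neg h1, map_zero, if_neg fun h => h1 h.1]
      rfl
  have hmemK : ∀ k, k ∈ K ↔ (∀ i, 0 ≤ k i ∧ k i ≤ p) ∧ ∑ i, k i = p := fun k => by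
    rw [hK, Finset.mem_filter, Fintype.mem_piFinset]
    simp only [Finset.mem_Icc]
  refine ⟨Φ, ⟨(hb.mem_endGr_iff hn p Φ).2 fun I J => ?_, (hb.zero_le_endVal_iff hn Φ).2
    fun I J a ha l => ?_⟩, ?_⟩
  · rw [hrepr]
    refine SHomogeneous.sum _ _ fun k hk => ?_
    split_ifs with h1
    · refine sHomogeneous_lmono (isLat_expo hn _ _) _ ?_
      rw [sum_expo hn, ((hmemK k).1 hk).2, h1, add_comm p]
    · exact SHomogeneous.zero _
  · rw [hcoeff] at ha
    obtain ⟨k, hk, hk'⟩ := Finset.exists_ne_zero_of_sum_ne_zero ha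
    have h1 : J + parity k = I ∧ a = expo k J := by
      by_contra h
      exact hk' (if_neg h)
    obtain ⟨rfl, rfl⟩ := h1
    rw [expo_add_shift_sub]
    exact mul_nonneg hh.le (((hmemK k).1 hk).1 l).1
  · funext k J
    rw [coeffFam_apply, hcoeff, Finset.sum_eq_single k]
    · rw [if_pos ⟨rfl, rfl⟩]
    · intro k' _ hne
      refine if_neg fun h => hne ?_
      funext i
      have h1 := congrFun h.2 i
      simp only [expo] at h1
      rw [h.1] at h1
      have h2 := mul_left_cancel₀ hh.ne' h1
      linarith
    · intro hk
      rw [if_pos ⟨rfl, rfl⟩]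
      by_contra h
      obtain ⟨h1, h2⟩ := hc k J h
      refine hk ((hmemK k).2 ⟨fun i => ⟨h1 i, ?_⟩, h2⟩)
      rw [← h2]
      exact Finset.single_le_sum (fun i _ => h1 i) (Finset.mem_univ i)

end Endomorphisms

/-! ### The cohomology of the endomorphism complex -/

section Cohomology

variable {n : ℕ}

theorem eq_of_le_of_sum_eq {m : ℤ} {k : Fin (n + 1) → ℤ} (h : ∀ i, m ≤ k i)
    (hs : ∑ i, k i = m * (n + 1)) : k = fun _ => m := by
  have h1 : ∑ i, (k i - m) = 0 := by
    rw [Finset.sum_sub_distrib, hs, Finset.sum_const, Finset.card_univ, Fintype.card_fin, nsmul_eq_mul]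
    push_cast
    ring
  have h2 := (Finset.sum_eq_zero_iff_of_nonneg fun i _ => sub_nonneg.2 (h i)).1 h1
  exact funext fun i => sub_eq_zero.1 (h2 i (Finset.mem_univ i))

theorem famSub_eq_bot {m p : ℤ} (h : p < m * (n + 1)) : famSub n m p = ⊥ := by
  rw [eq_bot_iff]
  intro c hc
  rw [Submodule.mem_bot]
  funext k J
  by_contra hk
  obtain ⟨h1, h2⟩ := hc k J hk
  have h3 := Finset.sum_le_sum fun i (_ : i ∈ Finset.univ) => h1 i
  rw [h2, Finset.sum_const, Finset.card_univ, Fintype.card_fin, nsmul_eq_mul] at h3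
  push_cast at h3
  linarith

/-- The family with value `v` at all `(k₀, J)`. -/
def pointFam (k₀ : Fin (n + 1) → ℤ) (v : ℝ) : Fam n := fun k _ => if k = k₀ then v else 0

theorem pointFam_mem (m : ℤ) (v : ℝ) : pointFam (fun _ => m) v ∈ famSub n m (m * (n + 1)) := by
  intro k J h
  have hk : k = fun _ => m := by
    by_contra hk
    exact h (if_neg hk)
  subst hk
  refine ⟨fun _ => le_rfl, ?_⟩
  rw [Finset.sum_const, Finset.card_univ, Fintype.card_fin, nsmul_eq_mul]
  push_cast
  ring

theorem famD_pointFam (κ : ℤˣ) {k₀ : Fin (n + 1) → ℤ} (hk₀ : parity k₀ = 0) (v : ℝ) :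
    famD κ 1 (pointFam k₀ v) = 0 := by
  funext k J
  rw [famD_apply]
  refine Finset.sum_eq_zero fun i _ => ?_
  simp only [pointFam]
  by_cases h : k - unitVec i = k₀
  · rw [if_pos h, h, hk₀, add_zero, one_mul, sub_self]
  · rw [if_neg h, mul_zero, mul_zero, mul_zero, sub_self]

/-- A closed family supported at a single multi-index of trivial parity is constant. -/
theorem eq_of_famD_eq_zero {κ : ℤˣ} {k₀ : Fin (n + 1) → ℤ} (hk₀ : parity k₀ = 0) {c : Fam n}
    (hc : ∀ k J, c k J ≠ 0 → k = k₀) (hd : famD κ 1 c = 0) (J : Idx n) : c k₀ J = c k₀ 0 := by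
  classical
  have h1 : ∀ i J, c k₀ (J + parity (unitVec i)) = c k₀ J := by
    intro i J
    have h2 := congrFun (congrFun hd (k₀ + unitVec i)) J
    rw [famD_apply, Finset.sum_eq_single i] at h2
    · rw [add_sub_cancel_right, hk₀, add_zero, one_mul, ← mul_sub] at h2
      exact (sub_eq_zero.1 ((mul_eq_zero.1 h2).resolve_left (rs_ne_zero _))).symm
    · intro l _ hl
      have h3 : ∀ I, c (k₀ + unitVec i - unitVec l) I = 0 := by
        intro I
        by_contra h4
        have h5 := congrFun (hc _ _ h4) l
        rw [Pi.sub_apply, Pi.add_apply, unitVec_same, unitVec_of_ne hl] at h5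
        omega
      rw [h3, h3, mul_zero, mul_zero, mul_zero, sub_self]
    · exact fun h => absurd (Finset.mem_univ i) h
  have h2 : ∀ (j : Fin n) (x : ZMod 2) (J : Idx n), c k₀ (J + Pi.single j x) = c k₀ J := by
    intro j x J
    have hx : x = 0 ∨ x = 1 := by revert x; decide
    rcases hx with rfl | rfl
    · rw [Pi.single_zero, add_zero]
    · have h3 : parity (unitVec j.succ) = Pi.single j 1 := by
        funext l
        rcases eq_or_ne l j with rfl | hl
        · simp [parity]
        · simp [parity, hl]
      rw [← h3, h1]
  have h3 : ∀ s : Finset (Fin n), c k₀ (∑ j ∈ s, Pi.single j (J j)) = c k₀ 0 := by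
    intro s
    induction s using Finset.induction_on with
    | empty => rw [Finset.sum_empty]
    | insert j s hj ih => rw [Finset.sum_insert hj, add_comm, h2, ih]
  rw [← h3 Finset.univ, Finset.univ_sum_single]

variable {ε κ : ℤˣ} {b : Module.Basis (Idx n) (S n) (DiracModule n ε)}

theorem IsDiracBasis.famD_famD (hb : IsDiracBasis κ b) (hn : Odd n) (q : ℤ) (c : Fam n)
    (hc : c ∈ famSub n 0 q) : famD κ (par (q + 1)) (famD κ (par q) c) = 0 := by
  obtain ⟨Φ, -, rfl⟩ := hb.exists_coeffFam_eq hn hc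
  rw [← hb.coeffFam_delta hn, ← hb.coeffFam_delta hn, FilteredFactorization.delta_delta, map_zero]

theorem IsDiracBasis.mk_eq_zero_iff (hb : IsDiracBasis κ b) (hn : Odd n) {p : ℤ}
    (Φ : (dirac n ε).endNonneg p) :
    (Submodule.Quotient.mk Φ : (dirac n ε).EndZero p) = 0 ↔ coeffFam b Φ.1 ∈ famSub n 1 p := by
  rw [Submodule.Quotient.mk_eq_zero]
  exact hb.mem_endPos_iff hn Φ.2

theorem IsDiracBasis.mk_mem_ker_iff (hb : IsDiracBasis κ b) (hn : Odd n) {p : ℤ}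
    (Φ : (dirac n ε).endNonneg p) :
    (Submodule.Quotient.mk Φ : (dirac n ε).EndZero p) ∈
        LinearMap.ker ((dirac n ε).deltaZero p (p + 1) rfl) ↔
      famD κ (par p) (coeffFam b Φ.1) ∈ famSub n 1 (p + 1) := by
  rw [LinearMap.mem_ker, ← hb.coeffFam_delta hn]
  exact hb.mk_eq_zero_iff hn ⟨(dirac n ε).delta p Φ.1, (dirac n ε).delta_mem_endGr p _ rfl Φ.2.1,
    Φ.2.2.trans ((dirac n ε).le_endVal_delta p Φ.1)⟩

theorem IsDiracBasis.mk_mem_range_iff (hb : IsDiracBasis κ b) (hn : Odd n) {p : ℤ}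
    (Φ : (dirac n ε).endNonneg p) :
    (Submodule.Quotient.mk Φ : (dirac n ε).EndZero p) ∈
        LinearMap.range ((dirac n ε).deltaZero (p - 1) p (sub_add_cancel p 1)) ↔
      ∃ c ∈ famSub n 0 (p - 1), coeffFam b Φ.1 - famD κ (par (p - 1)) c ∈ famSub n 1 p := by
  have key : ∀ Ψ : (dirac n ε).endNonneg (p - 1),
      (dirac n ε).deltaZero (p - 1) p (sub_add_cancel p 1) (Submodule.Quotient.mk Ψ) =
        Submodule.Quotient.mk Φ ↔
      coeffFam b Φ.1 - famD κ (par (p - 1)) (coeffFam b Ψ.1) ∈ famSub n 1 p := by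
    intro Ψ
    rw [eq_comm, ← sub_eq_zero, ← hb.coeffFam_delta hn, ← map_sub]
    exact hb.mk_eq_zero_iff hn (Φ - ⟨(dirac n ε).delta (p - 1) Ψ.1,
      (dirac n ε).delta_mem_endGr (p - 1) p (sub_add_cancel p 1) Ψ.2.1,
      Ψ.2.2.trans ((dirac n ε).le_endVal_delta (p - 1) Ψ.1)⟩)
  constructor
  · rintro ⟨y, hy⟩
    obtain ⟨Ψ, rfl⟩ := Submodule.Quotient.mk_surjective _ y
    exact ⟨_, hb.coeffFam_mem hn Ψ.2, (key Ψ).1 hy⟩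
  · rintro ⟨c, hc, h⟩
    obtain ⟨Ψ, hΨ, rfl⟩ := hb.exists_coeffFam_eq hn hc
    exact ⟨Submodule.Quotient.mk ⟨Ψ, hΨ⟩, (key ⟨Ψ, hΨ⟩).2 h⟩

theorem subsingleton_H (hn : Odd n) (ε : ℤˣ) {p : ℤ} (h0 : p ≠ 0) (h1 : p ≠ n) :
    Subsingleton ((dirac n ε).H p) := by
  obtain ⟨κ, b, hb⟩ := exists_isDiracBasis hn ε
  refine subsingleton_quot fun y hy => ?_
  obtain ⟨Φ, rfl⟩ := Submodule.Quotient.mk_surjective _ y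
  rw [hb.mk_mem_ker_iff hn] at hy
  rw [hb.mk_mem_range_iff hn]
  have hc := hb.coeffFam_mem hn Φ.2
  set c := coeffFam b Φ.1 with hcd
  obtain ⟨e, he, hde⟩ := exists_primitive zero_le_one (by omega) (hb.famD_famD hn) hy
    (hb.famD_famD hn p c hc)
  rw [add_sub_cancel_right] at he hde
  obtain ⟨f, hf, hdf⟩ := exists_primitive (m := 0) (c := c - e) le_rfl (by omega) (hb.famD_famD hn)
    (sub_mem hc (famSub_mono zero_le_one he)) (by rw [map_sub, hde, sub_self])
  exact ⟨f, hf, by rw [hdf, sub_sub_cancel]; exact he⟩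

/-- A functional on `End(M)₀` in a degree where the map to families is injective. -/
theorem IsDiracBasis.exists_functional (hb : IsDiracBasis κ b) (hn : Odd n) {p : ℤ}
    (hp : p < n + 1) (f : Fam n →ₗ[ℝ] ℝ) :
    ∃ g : (dirac n ε).EndZero p →ₗ[ℝ] ℝ, ∀ Φ : (dirac n ε).endNonneg p,
      g (Submodule.Quotient.mk Φ) = f (coeffFam b Φ.1) := by
  refine ⟨Submodule.liftQ _ (f ∘ₗ coeffFam b ∘ₗ ((dirac n ε).endNonneg p).subtype) fun Φ hΦ => ?_,
    fun Φ => rfl⟩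
  have h1 := (hb.mk_eq_zero_iff hn Φ).1 ((Submodule.Quotient.mk_eq_zero _).2 hΦ)
  rw [famSub_eq_bot (by omega), Submodule.mem_bot] at h1
  rw [LinearMap.mem_ker]
  change f (coeffFam b Φ.1) = 0
  rw [h1, map_zero]

theorem par_zero : par 0 = 1 := by simp [par]

/-- The coefficient of a family at `(k, 0)`. -/
def evalFam (k : Fin (n + 1) → ℤ) : Fam n →ₗ[ℝ] ℝ :=
  (LinearMap.proj (0 : Idx n) : (Idx n → ℝ) →ₗ[ℝ] ℝ) ∘ₗ LinearMap.proj k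

/-- A closed family in degree `m (n + 1)` with entries at least `m` is determined by one coefficient. -/
theorem eq_zero_of_mem_famSub {κ : ℤˣ} {m : ℤ} (hm : parity (fun _ : Fin (n + 1) => m) = 0)
    {c : Fam n} (hc : c ∈ famSub n m (m * (n + 1))) (hd : famD κ 1 c = 0)
    (h : c (fun _ => m) 0 = 0) : c = 0 := by
  have hs : ∀ k J, c k J ≠ 0 → k = fun _ => m := fun k J hk =>
    eq_of_le_of_sum_eq (hc k J hk).1 (hc k J hk).2
  funext k J
  by_contra hk
  obtain rfl := hs k J hk
  exact hk ((eq_of_famD_eq_zero hm hs hd J).trans h)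

/-- A functional on families that vanishes, among closed families, exactly on the exact ones
identifies the cohomology of `End(M)₀` with `ℝ`. -/
theorem IsDiracBasis.nonempty_H_equiv (hb : IsDiracBasis κ b) (hn : Odd n) {p : ℤ}
    (hp : p < n + 1) (f : Fam n →ₗ[ℝ] ℝ)
    (hf : ∀ c ∈ famSub n 0 p, famD κ (par p) c ∈ famSub n 1 (p + 1) →
      (f c = 0 ↔ ∃ c' ∈ famSub n 0 (p - 1), c - famD κ (par (p - 1)) c' ∈ famSub n 1 p))
    (hs : ∀ v : ℝ, ∃ c ∈ famSub n 0 p, famD κ (par p) c ∈ famSub n 1 (p + 1) ∧ f c = v) :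
    Nonempty ((dirac n ε).H p ≃ₗ[ℝ] ℝ) := by
  obtain ⟨g, hg⟩ := hb.exists_functional hn hp f
  refine nonempty_quot_equiv_of_surjective g (fun y hy => ?_) fun v => ?_
  · obtain ⟨Φ, rfl⟩ := Submodule.Quotient.mk_surjective _ y
    rw [hb.mk_mem_ker_iff hn] at hy
    rw [hb.mk_mem_range_iff hn, hg]
    exact hf _ (hb.coeffFam_mem hn Φ.2) hy
  · obtain ⟨c, hc, hd, hv⟩ := hs v
    obtain ⟨Φ, hΦ, rfl⟩ := hb.exists_coeffFam_eq hn hc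
    have h1 := (hb.mk_mem_ker_iff hn ⟨Φ, hΦ⟩).2 hd
    have h2 := (hg ⟨Φ, hΦ⟩).trans hv
    exact ⟨_, h1, h2⟩

/-- The classes of degree zero are the multiples of the identity. -/
theorem nonempty_H_zero (hn : Odd n) (ε : ℤˣ) : Nonempty ((dirac n ε).H 0 ≃ₗ[ℝ] ℝ) := by
  obtain ⟨κ, b, hb⟩ := exists_isDiracBasis hn ε
  have hn1 : 0 < n := hn.pos
  have hpar : parity (fun _ : Fin (n + 1) => (0 : ℤ)) = 0 := map_zero parity
  refine hb.nonempty_H_equiv hn (by omega) (evalFam fun _ => 0) (fun c hc hd => ?_) fun v => ?_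
  · rw [famSub_eq_bot (by omega), Submodule.mem_bot, par_zero] at hd
    constructor
    · intro h
      have h1 : c = 0 := eq_zero_of_mem_famSub hpar (by rwa [zero_mul]) hd h
      exact ⟨0, zero_mem _, by rw [h1, map_zero, sub_zero]; exact zero_mem _⟩
    · rintro ⟨c', hc', h⟩
      rw [famSub_eq_bot (by omega), Submodule.mem_bot] at hc'
      rw [hc', map_zero, sub_zero, famSub_eq_bot (by omega), Submodule.mem_bot] at h
      rw [h, map_zero]
  · have h1 := pointFam_mem (n := n) 0 v
    rw [zero_mul] at h1
    refine ⟨_, h1, ?_, if_pos rfl⟩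
    rw [par_zero, famD_pointFam κ hpar]
    exact zero_mem _

theorem par_succ_of_odd (hn : Odd n) : par ((n : ℤ) + 1) = 1 := by
  rw [par, Int.negOnePow_even _ (by exact_mod_cast hn.add_one)]
  simp

/-- The classes of degree `n` are detected by the differential in the complex of all families,
whose value has positive norm. -/
theorem nonempty_H_top (hn : Odd n) (ε : ℤˣ) : Nonempty ((dirac n ε).H n ≃ₗ[ℝ] ℝ) := by
  obtain ⟨κ, b, hb⟩ := exists_isDiracBasis hn ε
  have hn1 : 0 < n := hn.pos
  have hpar : parity (fun _ : Fin (n + 1) => (1 : ℤ)) = 0 := by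
    funext j
    change (((1 : ℤ) + 1 : ℤ) : ZMod 2) = 0
    decide
  refine hb.nonempty_H_equiv hn (by omega) ((evalFam fun _ => 1) ∘ₗ famD κ (par n))
    (fun c hc hd => ?_) fun v => ?_
  · have hdd := hb.famD_famD hn n _ hc
    rw [par_succ_of_odd hn] at hdd
    constructor
    · intro h
      have h1 : famD κ (par n) c = 0 := eq_zero_of_mem_famSub hpar (by rwa [one_mul]) hdd h
      obtain ⟨f, hf, hdf⟩ := exists_primitive (m := 0) le_rfl (by omega) (hb.famD_famD hn) hc h1
      exact ⟨f, hf, by rw [hdf, sub_self]; exact zero_mem _⟩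
    · rintro ⟨c', hc', h⟩
      rw [famSub_eq_bot (by omega), Submodule.mem_bot, sub_eq_zero] at h
      have h1 := hb.famD_famD hn _ c' hc'
      rw [sub_add_cancel, ← h] at h1
      rw [LinearMap.comp_apply, h1, map_zero]
  · have h1 := pointFam_mem (n := n) 1 v
    rw [one_mul] at h1
    obtain ⟨c, hc, hdc⟩ := exists_primitive (κ := κ) (m := 0) le_rfl (by omega) (hb.famD_famD hn)
      (famSub_mono zero_le_one h1) (by rw [par_succ_of_odd hn, famD_pointFam κ hpar])
    rw [add_sub_cancel_right] at hc hdc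
    refine ⟨c, hc, by rw [hdc]; exact h1, ?_⟩
    rw [LinearMap.comp_apply, hdc]
    exact if_pos rfl

end Cohomology

/-! ### The residue field and the comparison -/

/-- The residue field of the Novikov field. -/
theorem bijective_algebraMap_novikovResidue (n : ℕ) :
    Function.Bijective (algebraMap ℝ (NovikovResidue n)) := by
  have hval : ∀ c : ℝ, ((realToNonneg n c : novNonneg n) : Novikov).coeff 0 = c := fun c =>
    HahnSeries.coeff_single_same 0 c
  constructor
  · rw [injective_iff_map_eq_zero]
    intro c hc
    have h1 : realToNonneg n c ∈ novPos n := Ideal.Quotient.eq_zero_iff_mem.1 hc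
    have h2 := (novVal_pos_iff n _).1 h1 0 one_pos
    rwa [hval] at h2
  · intro y
    obtain ⟨r, rfl⟩ := Ideal.Quotient.mk_surjective y
    refine ⟨(r : Novikov).coeff 0, Ideal.Quotient.eq.2 ?_⟩
    refine (novVal_pos_iff n _).2 fun j hj => ?_
    rw [AddSubgroupClass.coe_sub, HahnSeries.coeff_sub]
    rcases lt_or_eq_of_le (show j ≤ 0 by omega) with h | rfl
    · rw [(novVal_nonneg_iff n r).1 r.2 j h, (novVal_nonneg_iff n _).1 (realToNonneg n _).2 j h,
        sub_zero]
    · rw [hval, sub_self]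

theorem nonempty_residue_equiv (n : ℕ) : Nonempty (ℝ ≃ₗ[ℝ] NovikovResidue n) :=
  ⟨LinearEquiv.ofBijective (Algebra.linearMap ℝ (NovikovResidue n))
    (bijective_algebraMap_novikovResidue n)⟩

/-- The cohomology of `End(M)₀` agrees with that of every space with the cohomology of the
`n`-sphere. -/
theorem hIso_dirac {n : ℕ} (hn : Odd n) (ε : ℤˣ) (X : Type) [TopologicalSpace X] [Nonempty X]
    (h : Nonempty (RH X (NovikovResidue n) (n + 1) ≃ₗ[ℝ] NovikovResidue n))
    (h' : ∀ m, m ≠ n + 1 → Subsingleton (RH X (NovikovResidue n) m)) :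
    (dirac n ε).HIso X (NovikovResidue n) := by
  obtain ⟨r⟩ := nonempty_residue_equiv n
  obtain ⟨⟨s0⟩, ⟨sn⟩, hs⟩ := singularCohomology_of_RH (NovikovResidue n) hn.pos h h'
  obtain ⟨f0⟩ := nonempty_H_zero hn ε
  obtain ⟨fn⟩ := nonempty_H_top hn ε
  refine ⟨fun k => ?_, fun p hp => subsingleton_H hn ε hp.ne (by omega)⟩
  rcases eq_or_ne k 0 with rfl | hk0
  · exact ⟨f0.trans (r.trans s0.symm)⟩
  rcases eq_or_ne k n with rfl | hkn
  · exact ⟨fn.trans (r.trans sn.symm)⟩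
  · have h1 := subsingleton_H hn ε (p := k) (by omega) (by omega)
    have h2 := hs k hk0 hkn
    exact ⟨LinearEquiv.ofSubsingleton _ _⟩

theorem hIso_projective {n : ℕ} (hn : Odd n) (ε : ℤˣ) :
    (dirac n ε).HIso (RealProjectiveSpace n) (NovikovResidue n) := by
  obtain ⟨h1, h2⟩ := RH_projective (NovikovResidue n) hn
  exact hIso_dirac hn ε _ h1 h2

theorem isSpherical_dirac {n : ℕ} (hn : Odd n) (ε : ℤˣ) : IsSpherical (dirac n ε) := by
  obtain ⟨h1, h2⟩ := RH_sphere (NovikovResidue n) n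
  exact ⟨isMatrixFactorization_dirac hn ε, hIso_dirac hn ε _ h1 h2⟩

end

end DiracMF

theorem theorem1p5 (n : ℕ) (hn : Odd n) (ε : ℤˣ) :
    Function.Bijective (algebraMap ℝ (DiracMF.NovikovResidue n)) ∧
    (DiracMF.dirac n ε).HIso (DiracMF.RealProjectiveSpace n) (DiracMF.NovikovResidue n) ∧
    (Nonempty ((DiracMF.dirac n ε).H 0 ≃ₗ[ℝ] ℝ) ∧ Nonempty ((DiracMF.dirac n ε).H n ≃ₗ[ℝ] ℝ) ∧
      ∀ p : ℤ, p ≠ 0 → p ≠ n → Subsingleton ((DiracMF.dirac n ε).H p)) ∧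
    DiracMF.IsSpherical (DiracMF.dirac n ε) := by
  have h : Nonempty ((DiracMF.dirac n ε).H 0 ≃ₗ[ℝ] ℝ) ∧
      Nonempty ((DiracMF.dirac n ε).H n ≃ₗ[ℝ] ℝ) ∧
      ∀ p : ℤ, p ≠ 0 → p ≠ n → Subsingleton ((DiracMF.dirac n ε).H p) :=
    ⟨DiracMF.nonempty_H_zero hn ε, DiracMF.nonempty_H_top hn ε,
      fun _ h h' => DiracMF.subsingleton_H hn ε h h'⟩
  exact ⟨DiracMF.bijective_algebraMap_novikovResidue n, DiracMF.hIso_projective hn ε, h,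
    DiracMF.isSpherical_dirac hn ε⟩
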